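/- **Setting.** Let $X$ be a set with at least two points and $\rho:X\times X\to[0,\infty)$ a quasi-metric: $\rho(x,y)=0\iff x=y$, $\rho(y,x)\le C_0\,\rho(x,y)$ and $\rho(x,y)\le C_1\max\{\rho(x,z),\rho(z,y)\}$ for all $x,y,z$, with constants $C_0,C_1\in(0,\infty)$. Put $B_\rho(x,r)=\{y:\rho(x,y)<r\}$ and $\operatorname{diam}_\rho(X)=\sup_{x,y}\rho(x,y)\in(0,\infty]$. Let $\mu$ be a nonnegative measure on a $\sigma$-algebra containing all Borel sets (for the topology in which $O$ is open iff every $x\in O$ has a ball $B_\rho(x,r)\subset O$, $r>0$), such that all balls are $\mu$-measurable and $0<\mu(B_\rho(x,r))<\infty$ for all $x\in X$, $r\in(0,\infty)$. *Index.* Let $C_\varrho=\sup\frac{\varrho(x,y)}{\max\{\varrho(x,z),\varrho(z,y)\}}$, the supremum over $x,y,z\in X$ not all equal, and $\operatorname{ind}(X,\rho)=\sup_\varrho(\log_2C_\varrho)^{-1}\in(0,\infty]$, the supremum over all quasi-metrics $\varrho$ on $X$ with $c^{-1}\varrho\le\rho\le c\varrho$ for some $c\in(0,\infty)$ (and $0^{-1}=\infty$).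 For $s\in(0,\infty)$ and $q\in(0,\infty]$ write $s\preceq_q\operatorname{ind}(X,\rho)$ if $s\le\operatorname{ind}(X,\rho)$, where $s=\operatorname{ind}(X,\rho)$ is allowed only if $q=\infty$ and the supremum defining $\operatorname{ind}(X,\rho)$ is attained. *Function spaces.* A fractional $s$-gradient of a measurable $u:X\to\mathbb R$ is a sequence $\vec g=\{g_k\}_{k\in\mathbb Z}$ of nonnegative $\mu$-measurable functions for which there is a $\mu$-null set $E$ with $|u(x)-u(y)|\le\rho(x,y)^s\,(g_k(x)+g_k(y))$ for all $k\in\mathbb Z$ and all $x,y\in X\setminus E$ with $2^{-k-1}\le\rho(x,y)<2^{-k}$. For $p\in(0,\infty)$, $\|u\|_{\dot M^s_{p,q}}$ and $\|u\|_{\dot N^s_{p,q}}$ are the infima, over all such $\vec g$, of $\big\|\,\|\{g_k\}_k\|_{\ell^q}\big\|_{L^p(X)}$ and $\big\|\{\|g_k\|_{L^p(X)}\}_k\big\|_{\ell^q}$ respectively ($\inf\emptyset=\infty$); $\dot M^s_{p,q}$ and $\dot N^s_{p,q}$ consist of the measurable $u:X\to\mathbb R$ for which the respective quantity is finite. *Conditions.*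 $\mu$ is *$Q$-doubling* if for some $\kappa>0$, $\kappa\,(r/R)^Q\le\mu(B_\rho(x,r))/\mu(B_\rho(y,R))$ whenever $0<r\le R<\infty$ and $B_\rho(x,r)\subset B_\rho(y,R)$. $(X,\rho)$ is *uniformly perfect* if for some $\lambda\in(0,1)$, for all $x\in X$, $r\in(0,\infty)$: $X\setminus B_\rho(x,r)\ne\emptyset$ implies $B_\rho(x,r)\setminus B_\rho(x,\lambda r)\neq\emptyset$. Write $u_B$ for the mean value of $u$ on $B$. **Theorem.** Let $s,Q\in(0,\infty)$ and $q\in(0,\infty]$ satisfy $s\preceq_q\operatorname{ind}(X,\rho)$, and suppose that $\operatorname{diam}_\rho(X)<\infty$ or $\mu$ is $Q$-doubling. For $p\in(0,Q/s)$ put $p^*=Qp/(Q-sp)$. Consider the following statements, where $\dot F^s_{p,q}$ stands for $\dot M^s_{p,q}$. * (a) $\mu$ is lower $Q$-Ahlfors-regular: there is $\kappa>0$ with $\kappa r^Q\le\mu(B_\rho(x,r))$ for all $x\in X$ and all finite $r\in(0,\operatorname{diam}_\rho(X)]$. * (b)$_p$ There is $C\in(0,\infty)$ such that, for all $u\in\dot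 F^s_{p,q}$ with $\|u\|_{L^p(X)}<\infty$, $$\|u\|_{L^{p^*}(X)}\le C\|u\|_{\dot F^s_{p,q}}+\frac{C}{[\operatorname{diam}_\rho(X)]^s}\|u\|_{L^p(X)}$$ (the last term is $0$ if $\operatorname{diam}_\rho(X)=\infty$). * (c)$_p$ There is $C\in(0,\infty)$ such that $\inf_{\gamma\in\mathbb R}\|u-\gamma\|_{L^{p^*}(X)}\le C\|u\|_{\dot F^s_{p,q}}$ for all $u\in\dot F^s_{p,q}$. * (d) There are $c_1,c_2,\omega\in(0,\infty)$ such that every $u\in\dot F^s_{Q/s,q}$ that is not $\mu$-a.e. constant is integrable on every ball $B$ of (finite) radius at most $\operatorname{diam}_\rho(X)$ and $$\frac1{\mu(B)}\int_B\exp\Big[\Big(c_1\frac{|u-u_B|}{\|u\|_{\dot F^s_{Q/s,q}}}\Big)^{\omega}\Big]\,d\mu\le c_2 .$$ * (e)$_p$ There is $C\in(0,\infty)$ such that every $u\in\dot F^s_{p,q}$ agrees $\mu$-a.e. with a function $v$ satisfying $|v(x)-v(y)|\le C\,\rho(x,y)^{s-Q/p}\,\|u\|_{\dot F^s_{p,q}}$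 for all $x,y\in X$. Then the following are equivalent: (a); (b)$_p$ for some $p\in(0,Q/s)$; (b)$_p$ for every $p\in(0,Q/s)$. If $(X,\rho)$ is uniformly perfect, these are further equivalent to each of: (c)$_p$ for some $p\in(0,Q/s)$; (c)$_p$ for every $p\in(0,Q/s)$; (d); (e)$_p$ for some $p\in(Q/s,\infty)$; (e)$_p$ for every $p\in(Q/s,\infty)$. In addition, the same holds with $\dot F^s_{p,q}=\dot N^s_{p,q}$ when all exponents $p$ are restricted to $p\ge q$. That is: if $q<Q/s$, then (a) is equivalent to (b)$_p$ for some, and to (b)$_p$ for every, $p\in(0,Q/s)$ with $p\ge q$; and, if moreover $(X,\rho)$ is uniformly perfect, (a) is equivalent to (c)$_p$ for some, and to (c)$_p$ for every, such $p$. If $(X,\rho)$ is uniformly perfect, then (a) is equivalent to (d) when $q\le Q/s$, and, when $q<\infty$, to (e)$_p$ for some, and to (e)$_p$ for every, $p\in(Q/s,\infty)$ with $p\ge q$. -/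

import Mathlib

open Set MeasureTheory
open scoped ENNReal NNReal

namespace HajlaszEmbedding

noncomputable section

/-! ### Quasi-metric spaces -/

/-- `ρ` is a quasi-metric on `X`: nonnegative, nondegenerate, quasi-symmetric and
quasi-subadditive. -/
structure IsQuasiMetric {X : Type*} (ρ : X → X → ℝ) : Prop where
  nonneg : ∀ x y, 0 ≤ ρ x y
  eq_zero_iff : ∀ x y, ρ x y = 0 ↔ x = y
  quasi_symm : ∃ C₀ : ℝ, 0 < C₀ ∧ ∀ x y, ρ y x ≤ C₀ * ρ x y
  quasi_max : ∃ C₁ : ℝ, 0 < C₁ ∧ ∀ x y z, ρ x y ≤ C₁ * max (ρ x z) (ρ z y)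

/-- The `ρ`-ball `B_ρ(x, r) = {y : ρ(x, y) < r}`. -/
def ball {X : Type*} (ρ : X → X → ℝ) (x : X) (r : ℝ) : Set X := {y | ρ x y < r}

/-- `O` is open in the topology generated by `ρ`. -/
def IsOpenFor {X : Type*} (ρ : X → X → ℝ) (O : Set X) : Prop :=
  ∀ x ∈ O, ∃ r : ℝ, 0 < r ∧ ball ρ x r ⊆ O

/-- `diam_ρ(X) = sup_{x, y} ρ(x, y)`, as an element of `[0, ∞]`. -/
def diam {X : Type*} (ρ : X → X → ℝ) : ℝ≥0∞ := ⨆ (x : X) (y : X), ENNReal.ofReal (ρ x y)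

/-- Equivalence (that is, bi-Lipschitz equivalence) of two quasi-metrics. -/
def Equivalent {X : Type*} (ρ ϱ : X → X → ℝ) : Prop :=
  ∃ c : ℝ, 0 < c ∧ ∀ x y, c⁻¹ * ϱ x y ≤ ρ x y ∧ ρ x y ≤ c * ϱ x y

/-- The least constant `C_ρ` in the quasi-subadditivity condition: the supremum of
`ρ(x, y) / max {ρ(x, z), ρ(z, y)}` over all points `x, y, z` that are not all equal. -/
def quasiConst {X : Type*} (ρ : X → X → ℝ) : ℝ :=
  sSup {t : ℝ | ∃ x y z : X, ¬ (x = y ∧ y = z) ∧ t = ρ x y / max (ρ x z) (ρ z y)}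

/-- `(log₂ C_ρ)⁻¹ ∈ (0, ∞]`, with value `∞` when `C_ρ = 1`. -/
def invLogConst {X : Type*} (ρ : X → X → ℝ) : ℝ≥0∞ :=
  (ENNReal.ofReal (Real.logb 2 (quasiConst ρ)))⁻¹

/-- The lower smoothness index `ind(X, ρ) ∈ (0, ∞]`: the supremum of `(log₂ C_ϱ)⁻¹` over all
quasi-metrics `ϱ` equivalent to `ρ`. -/
def ind {X : Type*} (ρ : X → X → ℝ) : ℝ≥0∞ :=
  ⨆ (ϱ : X → X → ℝ) (_ : IsQuasiMetric ϱ ∧ Equivalent ϱ ρ), invLogConst ϱ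

/-- The supremum which defines `ind(X, ρ)` is attained. -/
def IndAttained {X : Type*} (ρ : X → X → ℝ) : Prop :=
  ∃ ϱ : X → X → ℝ, (IsQuasiMetric ϱ ∧ Equivalent ϱ ρ) ∧ invLogConst ϱ = ind ρ

/-- `s ⪯_q ind(X, ρ)`: `s ≤ ind(X, ρ)`, with `s = ind(X, ρ)` permitted only if `q = ∞` and the
supremum defining `ind(X, ρ)` is attained. -/
def PrecInd {X : Type*} (ρ : X → X → ℝ) (s : ℝ) (q : ℝ≥0∞) : Prop :=
  ENNReal.ofReal s ≤ ind ρ ∧ (ENNReal.ofReal s = ind ρ → q = ∞ ∧ IndAttained ρ)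

/-- `(X, ρ)` is uniformly perfect. -/
def UniformlyPerfect {X : Type*} (ρ : X → X → ℝ) : Prop :=
  ∃ l : ℝ, 0 < l ∧ l < 1 ∧ ∀ (x : X) (r : ℝ), 0 < r →
    ((ball ρ x r)ᶜ).Nonempty → (ball ρ x r \ ball ρ x (l * r)).Nonempty

/-! ### Measures -/

/-- `(X, ρ, μ)` is a quasi-metric measure space (the standing assumption that `X` has at least two
points is left to `Nontrivial X`): `μ` is defined on a `σ`-algebra which contains all sets that
are open for `ρ`, and all `ρ`-balls are `μ`-measurable with positive and finite measure. -/
structure IsQuasiMetricMeasure {X : Type*} [MeasurableSpace X] (ρ : X → X → ℝ) (μ : Measure X) :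
    Prop where
  quasiMetric : IsQuasiMetric ρ
  borel : ∀ O : Set X, IsOpenFor ρ O → MeasurableSet O
  ball_measurable : ∀ (x : X) (r : ℝ), 0 < r → NullMeasurableSet (ball ρ x r) μ
  ball_pos : ∀ (x : X) (r : ℝ), 0 < r → 0 < μ (ball ρ x r)
  ball_lt_top : ∀ (x : X) (r : ℝ), 0 < r → μ (ball ρ x r) < ∞

/-- `μ` is lower `Q`-Ahlfors-regular. -/
def LowerAhlfors {X : Type*} [MeasurableSpace X] (ρ : X → X → ℝ) (μ : Measure X) (Q : ℝ) : Prop :=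
  ∃ κ : ℝ, 0 < κ ∧ ∀ (x : X) (r : ℝ), 0 < r → ENNReal.ofReal r ≤ diam ρ →
    ENNReal.ofReal (κ * r ^ Q) ≤ μ (ball ρ x r)

/-- `μ` is `Q`-doubling. -/
def QDoubling {X : Type*} [MeasurableSpace X] (ρ : X → X → ℝ) (μ : Measure X) (Q : ℝ) : Prop :=
  ∃ κ : ℝ, 0 < κ ∧ ∀ (x y : X) (r R : ℝ), ball ρ x r ⊆ ball ρ y R → 0 < r → r ≤ R →
    ENNReal.ofReal (κ * (r / R) ^ Q) ≤ μ (ball ρ x r) / μ (ball ρ y R)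

/-! ### Hajłasz–Triebel–Lizorkin and Hajłasz–Besov spaces -/

/-- `g = (g_k)_{k ∈ ℤ}` is a fractional `s`-gradient of `u`. -/
def IsFracGradient {X : Type*} [MeasurableSpace X] (ρ : X → X → ℝ) (μ : Measure X) (s : ℝ)
    (u : X → ℝ) (g : ℤ → X → ℝ≥0) : Prop :=
  (∀ k, AEMeasurable (g k) μ) ∧
    ∃ E : Set X, μ E = 0 ∧ ∀ (k : ℤ) (x y : X), x ∉ E → y ∉ E →
      (2 : ℝ) ^ (-k - 1) ≤ ρ x y → ρ x y < (2 : ℝ) ^ (-k) →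
        |u x - u y| ≤ ρ x y ^ s * ((g k x : ℝ) + (g k y : ℝ))

/-- The `ℓ^q` (quasi-)norm of a sequence indexed by `ℤ`, for `q ∈ (0, ∞]`. -/
def ellNorm (q : ℝ≥0∞) (a : ℤ → ℝ≥0∞) : ℝ≥0∞ :=
  if q = ∞ then ⨆ k, a k else (∑' k, a k ^ q.toReal) ^ (1 / q.toReal)

/-- The `L^p` (quasi-)norm, `p ∈ (0, ∞)`, of a `[0, ∞]`-valued function. -/
def lebNorm {X : Type*} [MeasurableSpace X] (μ : Measure X) (p : ℝ) (f : X → ℝ≥0∞) : ℝ≥0∞ :=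
  (∫⁻ x, f x ^ p ∂μ) ^ (1 / p)

/-- The homogeneous Hajłasz–Triebel–Lizorkin semi-norm: the infimum of `‖g‖_{L^p(X, ℓ^q)}` over
all fractional `s`-gradients `g` of `u` (equal to `∞` if there is none). -/
def tlNorm {X : Type*} [MeasurableSpace X] (ρ : X → X → ℝ) (μ : Measure X) (s : ℝ) (q : ℝ≥0∞)
    (p : ℝ) (u : X → ℝ) : ℝ≥0∞ :=
  ⨅ (g : ℤ → X → ℝ≥0) (_ : IsFracGradient ρ μ s u g),
    lebNorm μ p (fun x => ellNorm q (fun k => (g k x : ℝ≥0∞)))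

/-- The homogeneous Hajłasz–Besov semi-norm: the infimum of `‖g‖_{ℓ^q(L^p(X))}` over
all fractional `s`-gradients `g` of `u` (equal to `∞` if there is none). -/
def besovNorm {X : Type*} [MeasurableSpace X] (ρ : X → X → ℝ) (μ : Measure X) (s : ℝ) (q : ℝ≥0∞)
    (p : ℝ) (u : X → ℝ) : ℝ≥0∞ :=
  ⨅ (g : ℤ → X → ℝ≥0) (_ : IsFracGradient ρ μ s u g),
    ellNorm q (fun k => lebNorm μ p (fun x => (g k x : ℝ≥0∞)))

/-- Membership in the homogeneous space given by the semi-norm `N` (below, `N` is either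
`tlNorm ρ μ s q p` or `besovNorm ρ μ s q p`): `u` is `μ`-measurable and `N u < ∞`. -/
def MemSpace {X : Type*} [MeasurableSpace X] (μ : Measure X) (N : (X → ℝ) → ℝ≥0∞)
    (u : X → ℝ) : Prop :=
  AEMeasurable u μ ∧ N u < ∞

/-- The Sobolev exponent `p* = Q p / (Q - s p)`. -/
def sobExp (s Q p : ℝ) : ℝ := Q * p / (Q - s * p)

/-! ### The global embeddings, for the space with semi-norm `N` -/

/-- The global Sobolev inequality
`‖u‖_{L^{p*}} ≤ C ‖u‖_N + C diam_ρ(X)^{-s} ‖u‖_{L^p}`, for all `u` in the space with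
`‖u‖_{L^p} < ∞` (if `‖u‖_{L^p} = ∞`, the right-hand side is regarded as infinite). If
`diam_ρ(X) = ∞`, the last term is zero. -/
def SobolevIneq {X : Type*} [MeasurableSpace X] (ρ : X → X → ℝ) (μ : Measure X) (s Q p : ℝ)
    (N : (X → ℝ) → ℝ≥0∞) : Prop :=
  ∃ C : ℝ, 0 < C ∧ ∀ u : X → ℝ, MemSpace μ N u → eLpNorm u (ENNReal.ofReal p) μ < ∞ →
    eLpNorm u (ENNReal.ofReal (sobExp s Q p)) μ ≤
      ENNReal.ofReal C * N u +
        ENNReal.ofReal C / diam ρ ^ s * eLpNorm u (ENNReal.ofReal p) μ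

/-- The global Sobolev–Poincaré inequality `inf_γ ‖u - γ‖_{L^{p*}} ≤ C ‖u‖_N`. -/
def PoincareIneq {X : Type*} [MeasurableSpace X] (μ : Measure X) (s Q p : ℝ)
    (N : (X → ℝ) → ℝ≥0∞) : Prop :=
  ∃ C : ℝ, 0 < C ∧ ∀ u : X → ℝ, MemSpace μ N u →
    ⨅ γ : ℝ, eLpNorm (fun x => u x - γ) (ENNReal.ofReal (sobExp s Q p)) μ ≤
      ENNReal.ofReal C * N u

/-- The exponential integrability bound: every `u` in the space which is not (a.e.) constant is
integrable on every ball `B` of radius at most `diam_ρ(X)`, and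
`⨍_B exp ((c₁ |u - u_B| / ‖u‖_N) ^ ω) ≤ c₂`. -/
def ExpIntegrability {X : Type*} [MeasurableSpace X] (ρ : X → X → ℝ) (μ : Measure X)
    (N : (X → ℝ) → ℝ≥0∞) : Prop :=
  ∃ c₁ c₂ ω : ℝ, 0 < c₁ ∧ 0 < c₂ ∧ 0 < ω ∧
    ∀ (x₀ : X) (r : ℝ), 0 < r → ENNReal.ofReal r ≤ diam ρ →
      ∀ u : X → ℝ, MemSpace μ N u → (¬ ∃ c : ℝ, ∀ᵐ x ∂μ, u x = c) →
        IntegrableOn u (ball ρ x₀ r) μ ∧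
          ⨍⁻ x in ball ρ x₀ r, ENNReal.ofReal (Real.exp
            ((c₁ * (|u x - ⨍ y in ball ρ x₀ r, u y ∂μ| / (N u).toReal)) ^ ω)) ∂μ ≤
            ENNReal.ofReal c₂

/-- The global Hölder condition: every `u` in the space agrees a.e. with a function `v` such that
`|v(x) - v(y)| ≤ C ρ(x, y)^{s - Q/p} ‖u‖_N` for all `x, y`. -/
def HolderCond {X : Type*} [MeasurableSpace X] (ρ : X → X → ℝ) (μ : Measure X) (s Q p : ℝ)
    (N : (X → ℝ) → ℝ≥0∞) : Prop :=
  ∃ C : ℝ, 0 < C ∧ ∀ u : X → ℝ, MemSpace μ N u →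
    ∃ v : X → ℝ, (∀ᵐ x ∂μ, u x = v x) ∧
      ∀ x y, |v x - v y| ≤ C * ρ x y ^ (s - Q / p) * (N u).toReal

end

end HajlaszEmbedding

namespace HajlaszEmbedding

/-! ### Quasi-metrics and their regularization -/

/-! Both families of spaces enter through two properties of a semi-norm `N`. `HajlaszDominated` says
that `N` controls the `L^p` norm of a single Hajłasz gradient `h`; `BumpBound` estimates `N` on
Hölder bumps. For the Besov semi-norm, domination needs `ℓ^q ⊆ ℓ^p`, and this is why `q ≤ p` is
required there.

Lower regularity implies the embeddings. By Chebyshev, a ball of measure larger than `A^p / t^p`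
contains a point with `h ≤ t`. From a point with `h ≤ t M^n` one walks to points where the bound on
`h` drops by a factor `M` each time, inside balls of radius `r₀ η^k` with `η^Q M^p = 1`. The
increments of `u` are then of size `(M η^s)^k = (M^(1 - sp/Q))^k` (`exists_chain`,
`LowerAhlfors.exists_center`). If `sp < Q`, the sum grows geometrically and `|u - c|^{p*}` is
bounded by a constant plus a multiple of `h^p`. If `sp = Q`, it grows like `log h`, which gives
exponential integrability. If `sp > Q`, it is bounded, which gives Hölder continuity. No maximal
function occurs, and doubling serves only to pass from balls to a space of infinite diameter.

The embeddings imply lower regularity. Test them on bumps which are one on `S (j + 1)` and vanish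
off `S j`, where the `S j` are shrinking sublevel sets of a regularized `ρ^β`. The Sobolev
inequality becomes `μ (S (j+1))^(1/p*) ≤ C Λ^j r^(-s) μ (S j)^(1/p)`. Since `1/p* < 1/p`, a value of
`μ (S 0)` much smaller than `r^Q` would force `μ (S j) → 0`, although all `S j` contain a fixed set
of positive measure (`exists_le_of_iteration`). Conditions that ignore additive constants also need
a second set on which the bump vanishes; uniform perfectness provides it. The Hölder condition needs
only one bump.

The index condition supplies the bumps: some equivalent quasi-metric has a `β`-th power with
constant `2`, for a `β ≥ s`, and Frink's chain construction turns this power into a Lipschitz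
function. For `q < ∞` one has `β > s`, so the dyadic gradients of a bump are `ℓ^q`-summable. -/

theorem IsQuasiMetric.exists_const {X : Type*} {ρ : X → X → ℝ} (h : IsQuasiMetric ρ) :
    ∃ C : ℝ, 1 ≤ C ∧ (∀ x y, ρ y x ≤ C * ρ x y) ∧
      ∀ x y z, ρ x y ≤ C * max (ρ x z) (ρ z y) := by
  obtain ⟨C₀, hC₀, h₀⟩ := h.quasi_symm
  obtain ⟨C₁, hC₁, h₁⟩ := h.quasi_max
  refine ⟨max 1 (max C₀ C₁), le_max_left _ _, fun x y => (h₀ x y).trans ?_,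
    fun x y z => (h₁ x y z).trans ?_⟩
  · exact mul_le_mul_of_nonneg_right ((le_max_left _ _).trans (le_max_right _ _)) (h.nonneg _ _)
  · exact mul_le_mul_of_nonneg_right ((le_max_right _ _).trans (le_max_right _ _))
      (le_max_of_le_left (h.nonneg _ _))

theorem IsQuasiMetric.self {X : Type*} {ρ : X → X → ℝ} (h : IsQuasiMetric ρ) (x : X) :
    ρ x x = 0 := (h.eq_zero_iff x x).2 rfl

theorem IsQuasiMetric.pos {X : Type*} {ρ : X → X → ℝ} (h : IsQuasiMetric ρ) {x y : X}
    (hxy : x ≠ y) : 0 < ρ x y :=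
  lt_of_le_of_ne (h.nonneg x y) fun h0 => hxy ((h.eq_zero_iff x y).1 h0.symm)

theorem IsQuasiMetric.le_quasiConst {X : Type*} {ρ : X → X → ℝ} (h : IsQuasiMetric ρ)
    (x y z : X) : ρ x y ≤ quasiConst ρ * max (ρ x z) (ρ z y) := by
  obtain ⟨C, hC, -, hmax⟩ := h.exists_const
  by_cases hxyz : x = y ∧ y = z
  · obtain ⟨rfl, rfl⟩ := hxyz
    simp [h.self]
  have hpos : 0 < max (ρ x z) (ρ z y) := by
    rcases eq_or_ne x z with rfl | hne
    · rcases eq_or_ne x y with rfl | hne'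
      · exact absurd ⟨rfl, rfl⟩ hxyz
      · exact lt_max_of_lt_right (h.pos hne')
    · exact lt_max_of_lt_left (h.pos hne)
  have hbdd : BddAbove {t : ℝ | ∃ x y z : X, ¬ (x = y ∧ y = z) ∧
      t = ρ x y / max (ρ x z) (ρ z y)} := by
    refine ⟨C, ?_⟩
    rintro t ⟨x, y, z, -, rfl⟩
    exact div_le_of_le_mul₀ (le_max_of_le_left (h.nonneg _ _)) (by linarith) (hmax x y z)
  rw [← div_le_iff₀ hpos]
  exact le_csSup hbdd ⟨x, y, z, hxyz, rfl⟩

/-- Frink's chain inequality. -/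
theorem chain_le {X : Type*} {d : X → X → ℝ}
    (hnn : ∀ x y, 0 ≤ d x y) (hmax : ∀ x y z, d x y ≤ 2 * max (d x z) (d z y)) (c : ℕ → X) :
    ∀ n i : ℕ, d (c i) (c (i + n + 2)) ≤
      2 * d (c i) (c (i + 1)) + 4 * ∑ j ∈ Finset.range n, d (c (i + j + 1)) (c (i + j + 2)) +
        2 * d (c (i + n + 1)) (c (i + n + 2)) := by
  intro n
  induction n using Nat.strong_induction_on with
  | _ n ih =>
    intro i
    have hS : ∀ m k : ℕ, 0 ≤ ∑ j ∈ Finset.range m, d (c (k + j + 1)) (c (k + j + 2)) :=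
      fun m k => Finset.sum_nonneg fun _ _ => hnn _ _
    set a := d (c i) (c (i + n + 2)) with ha
    rcases (hnn (c i) (c (i + n + 2))).eq_or_lt with h0 | h0
    · rw [← ha] at h0
      rw [← h0]
      have := hS n i
      have := hnn (c i) (c (i + 1))
      have := hnn (c (i + n + 1)) (c (i + n + 2))
      linarith
    rw [← ha] at h0
    by_cases hend : a ≤ 2 * d (c (i + n + 1)) (c (i + n + 2))
    · have := hS n i
      have := hnn (c i) (c (i + 1))
      linarith
    push Not at hend
    -- the first index at which `a ≤ 2 d(c r, c end)` fails
    have hex : ∃ r, 2 * d (c (i + r)) (c (i + n + 2)) < a := ⟨n + 1, hend⟩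
    classical
    obtain ⟨r, hr, hmin⟩ : ∃ r, 2 * d (c (i + r)) (c (i + n + 2)) < a ∧
        ∀ m < r, ¬ 2 * d (c (i + m)) (c (i + n + 2)) < a :=
      ⟨Nat.find hex, Nat.find_spec hex, fun m hm => Nat.find_min hex hm⟩
    have hrn : r ≤ n + 1 := by
      by_contra! hlt
      exact hmin _ hlt hend
    have hr1 : a ≤ 2 * d (c i) (c (i + r)) := by
      have := hmax (c i) (c (i + n + 2)) (c (i + r))
      rw [← ha, mul_max_of_nonneg _ _ (by norm_num : (0:ℝ) ≤ 2)] at this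
      rcases le_max_iff.1 this with h | h
      · exact h
      · linarith
    rcases r with _ | _ | r
    · simp only [add_zero, ← ha] at hr
      linarith
    · have := hS n i
      have := hnn (c (i + n + 1)) (c (i + n + 2))
      simp only [zero_add] at hr1
      linarith
    -- The chain is cut into two subchains sharing the link from `c (i + r + 1)` to `c (i + r + 2)`.
    -- Each of them bounds `a / 2`, and the shared link, an end link in both, receives the
    -- coefficient `2 + 2 = 4` of an interior link.
    · have h2 : a ≤ 2 * d (c (i + r + 1)) (c (i + n + 2)) := by
        have := hmin (r + 1) (by omega)
        push Not at this
        simpa [add_assoc] using this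
      obtain ⟨m, rfl⟩ : ∃ m, n = r + m + 1 := ⟨n - r - 1, by omega⟩
      have e1 := ih r (by omega) i
      have e2 := ih m (by omega) (i + r + 1)
      have hsum : ∑ j ∈ Finset.range (r + m + 1), d (c (i + j + 1)) (c (i + j + 2)) =
          ∑ j ∈ Finset.range r, d (c (i + j + 1)) (c (i + j + 2)) +
          d (c (i + r + 1)) (c (i + r + 2)) +
          ∑ j ∈ Finset.range m, d (c (i + r + 1 + j + 1)) (c (i + r + 1 + j + 2)) := by
        rw [add_right_comm, Finset.sum_range_add, Finset.sum_range_succ]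
        simp only [add_assoc, add_comm, add_left_comm]
      rw [hsum]
      have e3 : i + r + 1 + m + 2 = i + (r + m + 1) + 2 := by omega
      have e4 : i + r + 1 + m + 1 = i + (r + m + 1) + 1 := by omega
      have e5 : i + r + 1 + 1 = i + r + 2 := by omega
      rw [e3, e4, e5] at e2
      have e6 : i + (r + 1 + 1) = i + r + 2 := by omega
      rw [e6] at hr1
      linarith

theorem le_four_mul_chain {X : Type*} {d : X → X → ℝ} (hself : ∀ x, d x x = 0)
    (hnn : ∀ x y, 0 ≤ d x y) (hmax : ∀ x y z, d x y ≤ 2 * max (d x z) (d z y)) (c : ℕ → X)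
    (n : ℕ) : d (c 0) (c n) ≤ 4 * ∑ j ∈ Finset.range n, d (c j) (c (j + 1)) := by
  rcases n with _ | _ | n
  · simp [hself]
  · simp only [zero_add, Finset.range_one, Finset.sum_singleton]
    have := hnn (c 0) (c 1)
    linarith
  · have h := chain_le hnn hmax c n 0
    rw [Finset.sum_range_succ, Finset.sum_range_succ']
    simp only [zero_add] at h ⊢
    have := hnn (c 0) (c 1)
    have := hnn (c (n + 1)) (c (n + 2))
    have e : ∀ j, j + 1 + 1 = j + 2 := fun j => rfl
    simp only [e]
    linarith

/-- For a quasi-metric-like function with constant `2`, the infimum over chains is a comparable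
function which is `1`-Lipschitz in its second variable. -/
theorem exists_lipschitz_regularization {X : Type*} {d : X → X → ℝ} (hself : ∀ x, d x x = 0)
    (hnn : ∀ x y, 0 ≤ d x y) (hsymm : ∀ x y, d x y = d y x)
    (hmax : ∀ x y z, d x y ≤ 2 * max (d x z) (d z y)) :
    ∃ F : X → X → ℝ, (∀ x y z, |F x y - F x z| ≤ d y z) ∧
      (∀ x y, F x y ≤ d x y) ∧ ∀ x y, d x y ≤ 4 * F x y := by
  set S : X → X → Set ℝ := fun x y => {t | ∃ (n : ℕ) (c : ℕ → X), c 0 = x ∧ c n = y ∧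
    t = ∑ j ∈ Finset.range n, d (c j) (c (j + 1))} with hS
  have hmem : ∀ x y, d x y ∈ S x y := fun x y =>
    ⟨1, fun j => if j = 0 then x else y, by simp, by simp, by simp⟩
  have hbdd : ∀ x y, BddBelow (S x y) := fun x y => by
    refine ⟨0, ?_⟩
    rintro t ⟨n, c, -, -, rfl⟩
    exact Finset.sum_nonneg fun _ _ => hnn _ _
  have hstep : ∀ x y z, sInf (S x z) ≤ sInf (S x y) + d y z := by
    intro x y z
    rw [← sub_le_iff_le_add]
    refine le_csInf ⟨_, hmem x y⟩ ?_
    rintro t ⟨n, c, hc0, hcn, rfl⟩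
    rw [sub_le_iff_le_add]
    refine csInf_le (hbdd x z) ⟨n + 1, fun j => if j ≤ n then c j else z, by simp [hc0],
      by simp, ?_⟩
    rw [Finset.sum_range_succ]
    congr 1
    · refine Finset.sum_congr rfl fun j hj => ?_
      have := Finset.mem_range.1 hj
      simp only [show j ≤ n by omega, show j + 1 ≤ n by omega, if_true]
    · simp [hcn]
  refine ⟨fun x y => sInf (S x y), fun x y z => ?_, fun x y => csInf_le (hbdd x y) (hmem x y),
    fun x y => ?_⟩
  · rw [abs_sub_le_iff]
    constructor
    · have := hstep x z y
      rw [hsymm z y] at this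
      linarith
    · have := hstep x y z
      linarith
  · have : d x y / 4 ≤ sInf (S x y) := by
      refine le_csInf ⟨_, hmem x y⟩ ?_
      rintro t ⟨n, c, hc0, hcn, rfl⟩
      have := le_four_mul_chain hself hnn hmax c n
      rw [hc0, hcn] at this
      linarith
    linarith

/-- `F` is a regularized version of `ρ ^ β`: it is comparable to `ρ ^ β`, and it is
`β`-Hölder continuous with respect to `ρ` in its second variable. -/
structure IsRegularization {X : Type*} (ρ : X → X → ℝ) (β K : ℝ) (F : X → X → ℝ) : Prop where
  one_le : 1 ≤ K
  holder : ∀ x y z, |F x y - F x z| ≤ K * ρ y z ^ β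
  le : ∀ x y, F x y ≤ K * ρ x y ^ β
  ge : ∀ x y, ρ x y ^ β ≤ K * F x y

/-- Raising to the power `β` turns the constant `2^(1/β)` into `2`, the largest one that the chain
construction accepts. Symmetrizing by a maximum keeps the constant and costs only a factor in the
comparison with `ρ`. -/
theorem exists_regularization {X : Type*} {ρ ϱ : X → X → ℝ} (hρ : IsQuasiMetric ρ)
    (hϱ : IsQuasiMetric ϱ) (he : Equivalent ϱ ρ) {β : ℝ} (hβ : 0 < β)
    (hC : quasiConst ϱ ≤ 2 ^ (1 / β)) : ∃ K F, IsRegularization ρ β K F := by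
  obtain ⟨c, hc, hce⟩ := he
  obtain ⟨C, hC1, hCsymm, -⟩ := hρ.exists_const
  set σ : X → X → ℝ := fun x y => max (ϱ x y) (ϱ y x) with hσ
  have hσnn : ∀ x y, 0 ≤ σ x y := fun x y => le_max_of_le_left (hϱ.nonneg _ _)
  have hq : ∀ x y z, σ x y ≤ 2 ^ (1 / β) * max (σ x z) (σ z y) := by
    have h2 : (0:ℝ) ≤ 2 ^ (1 / β) := by positivity
    have key : ∀ x y z, ϱ x y ≤ 2 ^ (1 / β) * max (ϱ x z) (ϱ z y) := fun x y z =>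
      (hϱ.le_quasiConst x y z).trans
        (mul_le_mul_of_nonneg_right hC (le_max_of_le_left (hϱ.nonneg _ _)))
    intro x y z
    refine max_le ((key x y z).trans ?_) ((key y x z).trans ?_)
    · exact mul_le_mul_of_nonneg_left (max_le_max (le_max_left _ _) (le_max_left _ _)) h2
    · rw [max_comm]
      exact mul_le_mul_of_nonneg_left (max_le_max (le_max_right _ _) (le_max_right _ _)) h2
  obtain ⟨F, hF1, hF2, hF3⟩ := exists_lipschitz_regularization (d := fun x y => σ x y ^ β)
    (fun x => by simp [hσ, hϱ.self, Real.zero_rpow hβ.ne']) (fun x y => by have := hσnn x y; positivity)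
    (fun x y => by simp only [hσ, max_comm]) (fun x y z => by
      have h1 := Real.rpow_le_rpow (hσnn x y) (hq x y z) hβ.le
      rw [Real.mul_rpow (by positivity) (le_max_of_le_left (hσnn _ _)), ← Real.rpow_mul (by norm_num),
        one_div_mul_cancel hβ.ne', Real.rpow_one] at h1
      refine h1.trans_eq ?_
      congr 1
      exact (Real.monotoneOn_rpow_Ici_of_exponent_nonneg hβ.le).map_max (hσnn x z) (hσnn z y))
  have hup : ∀ x y, σ x y ^ β ≤ (c * C) ^ β * ρ x y ^ β := fun x y => by
    rw [← Real.mul_rpow (by positivity) (hρ.nonneg _ _)]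
    refine Real.rpow_le_rpow (hσnn x y) (max_le ((hce x y).2.trans ?_) ((hce y x).2.trans ?_)) hβ.le
    · rw [mul_assoc]
      refine mul_le_mul_of_nonneg_left ?_ hc.le
      exact le_mul_of_one_le_left (hρ.nonneg _ _) hC1
    · rw [mul_assoc]
      exact mul_le_mul_of_nonneg_left (hCsymm _ _) hc.le
  have hlow : ∀ x y, ρ x y ^ β ≤ c ^ β * σ x y ^ β := fun x y => by
    rw [← Real.mul_rpow hc.le (hσnn _ _)]
    refine Real.rpow_le_rpow (hρ.nonneg x y) ?_ hβ.le
    have := (hce x y).1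
    rw [inv_mul_le_iff₀ hc] at this
    exact this.trans (mul_le_mul_of_nonneg_left (le_max_left _ _) hc.le)
  have hρβ : ∀ x y, 0 ≤ ρ x y ^ β := fun x y => Real.rpow_nonneg (hρ.nonneg x y) _
  have hFnn : ∀ x y, 0 ≤ F x y := fun x y => by
    have h1 := hF3 x y
    have h2 := Real.rpow_nonneg (hσnn x y) β
    linarith
  refine ⟨max 1 (max ((c * C) ^ β) (4 * c ^ β)), F, le_max_left _ _, fun x y z => ?_,
    fun x y => ?_, fun x y => ?_⟩
  · exact (hF1 x y z).trans ((hup y z).trans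
      (mul_le_mul_of_nonneg_right ((le_max_left _ _).trans (le_max_right _ _)) (hρβ _ _)))
  · exact (hF2 x y).trans ((hup x y).trans
      (mul_le_mul_of_nonneg_right ((le_max_left _ _).trans (le_max_right _ _)) (hρβ _ _)))
  · refine (hlow x y).trans ((mul_le_mul_of_nonneg_left (hF3 x y) (by positivity)).trans ?_)
    rw [← mul_assoc, mul_comm (c ^ β) 4]
    exact mul_le_mul_of_nonneg_right ((le_max_right _ _).trans (le_max_right _ _)) (hFnn _ _)

theorem quasiConst_le_of_le_invLogConst {X : Type*} {ϱ : X → X → ℝ}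
    {β : ℝ} (hβ : 0 < β) (h : ENNReal.ofReal β ≤ invLogConst ϱ) :
    quasiConst ϱ ≤ 2 ^ (1 / β) := by
  rcases le_or_gt (quasiConst ϱ) 0 with h0 | h0
  · exact h0.trans (by positivity)
  rw [invLogConst, ENNReal.le_inv_iff_le_inv, ← ENNReal.ofReal_inv_of_pos hβ,
    ENNReal.ofReal_le_ofReal_iff (by positivity)] at h
  rw [one_div]
  exact (Real.logb_le_iff_le_rpow (by norm_num) h0).1 h

/-- The smoothness condition provides regularizations of `ρ ^ β`, with `β > s` if `q < ∞`. -/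
theorem PrecInd.exists_regularization {X : Type*} {ρ : X → X → ℝ} (hρ : IsQuasiMetric ρ)
    {s : ℝ} (hs : 0 < s) {q : ℝ≥0∞} (h : PrecInd ρ s q) :
    ∃ β K F, s ≤ β ∧ (q ≠ ∞ → s < β) ∧ IsRegularization ρ β K F := by
  rcases h.1.lt_or_eq with hlt | heq
  · rw [ind] at hlt
    simp only [lt_iSup_iff] at hlt
    obtain ⟨ϱ, ⟨hϱ, he⟩, hlt⟩ := hlt
    obtain ⟨b, hb1, hb2⟩ := exists_between hlt
    have hbt : b ≠ ∞ := ne_top_of_lt hb2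
    have hsb : s < b.toReal := (ENNReal.ofReal_lt_iff_lt_toReal hs.le hbt).1 hb1
    obtain ⟨K, F, hF⟩ := HajlaszEmbedding.exists_regularization hρ hϱ he (hs.trans hsb)
      (quasiConst_le_of_le_invLogConst (hs.trans hsb) (by rw [ENNReal.ofReal_toReal hbt]; exact hb2.le))
    exact ⟨b.toReal, K, F, hsb.le, fun _ => hsb, hF⟩
  · obtain ⟨hq, ϱ, ⟨hϱ, he⟩, hatt⟩ := h.2 heq
    obtain ⟨K, F, hF⟩ := HajlaszEmbedding.exists_regularization hρ hϱ he hs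
      (quasiConst_le_of_le_invLogConst hs (by rw [hatt]; exact heq.le))
    exact ⟨s, K, F, le_rfl, fun h => absurd hq h, hF⟩

/-! ### Fast decay of sequences -/

/-- A De Giorgi type iteration: the gain `θ < τ` beats the geometric factor `Λ^j`, so a small `y 0`
makes `y j` decay geometrically, against `δ ≤ y j`. The threshold `ε` does not depend on `δ`. -/
theorem exists_le_of_iteration {θ τ K Λ : ℝ} (hθ : 0 < θ) (hθτ : θ < τ) (hK : 0 < K)
    (hΛ : 1 ≤ Λ) : ∃ ε : ℝ, 0 < ε ∧ ∀ (y : ℕ → ℝ) (δ : ℝ), 0 < δ → (∀ j, δ ≤ y j) →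
      (∀ j, y (j + 1) ^ θ ≤ K * Λ ^ j * y j ^ τ) → ε ≤ y 0 := by
  have hd : 0 < τ - θ := sub_pos.2 hθτ
  -- The decay rate is chosen so that `Λ η^(τ - θ) ≤ 1`; below, `ε` solves `K ε^(τ - θ) = η^θ`. With
  -- these, `y j ≤ ε η^j` passes to `j + 1`.
  set η : ℝ := (2 * Λ) ^ (-(1 / (τ - θ))) with hη
  have hη0 : 0 < η := by positivity
  have hη1 : η < 1 := Real.rpow_lt_one_of_one_lt_of_neg (by linarith) (by simpa using hd)
  have hηΛ : Λ * η ^ (τ - θ) ≤ 1 := by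
    rw [hη, ← Real.rpow_mul (by positivity), neg_mul, one_div_mul_cancel hd.ne', Real.rpow_neg_one,
      ← div_eq_mul_inv, div_le_one (by positivity)]
    linarith
  set ε : ℝ := (η ^ θ / K) ^ (1 / (τ - θ)) with hε
  have hε0 : 0 < ε := by positivity
  have hεK : K * ε ^ (τ - θ) = η ^ θ := by
    rw [hε, ← Real.rpow_mul (by positivity), one_div_mul_cancel hd.ne', Real.rpow_one]
    field_simp
  refine ⟨ε, hε0, fun y δ hδ hy hstep => ?_⟩
  by_contra! hlt
  have hpos : ∀ j, 0 < y j := fun j => hδ.trans_le (hy j)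
  have key : ∀ j, y j ≤ ε * η ^ j := by
    intro j
    induction j with
    | zero => simpa using hlt.le
    | succ j ih =>
      have hb : 0 < ε * η ^ j := by positivity
      have h1 : y (j + 1) ^ θ ≤ (ε * η ^ (j + 1)) ^ θ := by
        refine (hstep j).trans ?_
        have h2 : y j ^ τ ≤ (ε * η ^ j) ^ τ :=
          Real.rpow_le_rpow (hpos j).le ih (hθ.trans hθτ).le
        refine (mul_le_mul_of_nonneg_left h2 (by positivity)).trans ?_
        have h3 : (ε * η ^ j) ^ τ = (ε * η ^ j) ^ θ * (ε ^ (τ - θ) * (η ^ (τ - θ)) ^ j) := by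
          rw [← Real.rpow_natCast (η ^ (τ - θ)), ← Real.rpow_mul hη0.le, mul_comm (τ - θ),
            Real.rpow_mul hη0.le, Real.rpow_natCast, ← Real.mul_rpow hε0.le (by positivity),
            ← Real.rpow_add hb]
          congr 1; ring
        have h4 : (ε * η ^ (j + 1)) ^ θ = (ε * η ^ j) ^ θ * η ^ θ := by
          rw [← Real.mul_rpow hb.le hη0.le]; congr 1; ring
        rw [h3, h4]
        have h5 : (Λ * η ^ (τ - θ)) ^ j ≤ 1 := pow_le_one₀ (by positivity) hηΛ
        calc K * Λ ^ j * ((ε * η ^ j) ^ θ * (ε ^ (τ - θ) * (η ^ (τ - θ)) ^ j))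
            = (ε * η ^ j) ^ θ * (K * ε ^ (τ - θ)) * (Λ * η ^ (τ - θ)) ^ j := by
              rw [mul_pow]; ring
          _ ≤ (ε * η ^ j) ^ θ * (K * ε ^ (τ - θ)) * 1 :=
              mul_le_mul_of_nonneg_left h5 (by positivity)
          _ = _ := by rw [hεK, mul_one]
      exact (Real.rpow_le_rpow_iff (hpos _).le (by positivity) hθ).1 h1
  have hlim : Filter.Tendsto (fun j : ℕ => ε * η ^ j) Filter.atTop (nhds 0) := by
    simpa using (tendsto_pow_atTop_nhds_zero_of_lt_one hη0.le hη1).const_mul ε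
  have := ge_of_tendsto' hlim fun j => (hy j).trans (key j)
  linarith

/-! ### Sequence and Lebesgue norms -/

theorem ellNorm_const_mul {q : ℝ≥0∞} (hq : 0 < q) (c : ℝ≥0∞) (a : ℤ → ℝ≥0∞) :
    ellNorm q (fun k => c * a k) = c * ellNorm q a := by
  unfold ellNorm
  split_ifs with h
  · rw [ENNReal.mul_iSup]
  · have hq' : 0 < q.toReal := ENNReal.toReal_pos hq.ne' h
    simp_rw [ENNReal.mul_rpow_of_nonneg _ _ hq'.le, ENNReal.tsum_mul_left]
    rw [ENNReal.mul_rpow_of_nonneg _ _ (by positivity), ← ENNReal.rpow_mul,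
      mul_one_div_cancel hq'.ne', ENNReal.rpow_one]

theorem ellNorm_sub_right (q : ℝ≥0∞) (a : ℤ → ℝ≥0∞) (m : ℤ) :
    ellNorm q (fun k => a (k - m)) = ellNorm q a := by
  unfold ellNorm
  split_ifs with h
  · exact (Equiv.subRight m).iSup_comp (g := a)
  · rw [← (Equiv.subRight m).tsum_eq (fun k => a k ^ q.toReal)]
    rfl

theorem ellNorm_zero {q : ℝ≥0∞} (hq : 0 < q) : ellNorm q (fun _ => 0) = 0 := by
  simpa using ellNorm_const_mul hq 0 (fun _ => 0)

theorem le_ellNorm {q : ℝ≥0∞} (hq : 0 < q) (a : ℤ → ℝ≥0∞) (k : ℤ) : a k ≤ ellNorm q a := by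
  unfold ellNorm
  split_ifs with h
  · exact le_iSup a k
  · have hq' : 0 < q.toReal := ENNReal.toReal_pos hq.ne' h
    calc a k = (a k ^ q.toReal) ^ (1 / q.toReal) := by
          rw [← ENNReal.rpow_mul, mul_one_div_cancel hq'.ne', ENNReal.rpow_one]
      _ ≤ _ := ENNReal.rpow_le_rpow (ENNReal.le_tsum k) (by positivity)

theorem aemeasurable_ellNorm {X : Type*} [MeasurableSpace X] {μ : Measure X} (q : ℝ≥0∞)
    {g : ℤ → X → ℝ≥0∞} (hg : ∀ k, AEMeasurable (g k) μ) :
    AEMeasurable (fun x => ellNorm q (fun k => g k x)) μ := by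
  unfold ellNorm
  split_ifs with h
  · exact AEMeasurable.iSup hg
  · exact (AEMeasurable.tsum fun k => (hg k).pow_const _).pow_const _

theorem tsum_rpow_le_rpow_tsum {ι : Type*} {r : ℝ} (hr : 1 ≤ r) (a : ι → ℝ≥0∞) :
    ∑' k, a k ^ r ≤ (∑' k, a k) ^ r := by
  have hr1 : 0 ≤ r - 1 := by linarith
  have hsplit : ∀ b : ℝ≥0∞, b ^ r = b * b ^ (r - 1) := fun b => by
    conv_lhs => rw [show r = 1 + (r - 1) by ring,
      ENNReal.rpow_add_of_nonneg _ _ zero_le_one hr1, ENNReal.rpow_one]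
  calc ∑' k, a k ^ r ≤ ∑' k, a k * (∑' k, a k) ^ (r - 1) := by
        refine ENNReal.tsum_le_tsum fun k => ?_
        rw [hsplit]
        gcongr
        exact ENNReal.le_tsum k
    _ = _ := by rw [ENNReal.tsum_mul_right, ← hsplit]

/-- `ℓ^q ⊆ ℓ^p` for `q ≤ p < ∞`. -/
theorem tsum_rpow_le_ellNorm_rpow {q : ℝ≥0∞} (hq : 0 < q) {p : ℝ} (hqp : q ≤ ENNReal.ofReal p)
    (a : ℤ → ℝ≥0∞) : ∑' k, a k ^ p ≤ ellNorm q a ^ p := by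
  have hqt : q ≠ ∞ := ne_top_of_le_ne_top ENNReal.ofReal_ne_top hqp
  have hq' : 0 < q.toReal := ENNReal.toReal_pos hq.ne' hqt
  have hp : q.toReal ≤ p := by
    by_contra! h
    have : q < q := hqp.trans_lt (by
      rw [← ENNReal.ofReal_toReal hqt]
      exact (ENNReal.ofReal_lt_ofReal_iff hq').2 h)
    exact lt_irrefl _ this
  rw [ellNorm, if_neg hqt, ← ENNReal.rpow_mul, one_div_mul_eq_div]
  refine le_trans (le_of_eq ?_) (tsum_rpow_le_rpow_tsum ((one_le_div hq').2 hp) _)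
  refine tsum_congr fun k => ?_
  rw [← ENNReal.rpow_mul, mul_div_cancel₀ _ hq'.ne']

theorem lebNorm_indicator_const {X : Type*} [MeasurableSpace X] {μ : Measure X} {p : ℝ}
    (hp : 0 < p) {B : Set X} (hB : MeasurableSet B) (c : ℝ≥0∞) :
    lebNorm μ p (B.indicator fun _ => c) = c * μ B ^ (1 / p) := by
  have : (fun x => (B.indicator (fun _ => c) x) ^ p) = B.indicator fun _ => c ^ p := by
    ext x
    by_cases hx : x ∈ B
    · simp [hx]
    · simp [hx, hp]
  rw [lebNorm, this, lintegral_indicator_const hB,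
    ENNReal.mul_rpow_of_nonneg _ _ (by positivity), ← ENNReal.rpow_mul,
    mul_one_div_cancel hp.ne', ENNReal.rpow_one]

theorem lebNorm_rpow {X : Type*} [MeasurableSpace X] {μ : Measure X} {p : ℝ}
    (hp : 0 < p) (f : X → ℝ≥0∞) : lebNorm μ p f ^ p = ∫⁻ x, f x ^ p ∂μ := by
  rw [lebNorm, ← ENNReal.rpow_mul, one_div_mul_cancel hp.ne', ENNReal.rpow_one]

/-! ### Hajłasz gradients -/

/-- `u` has a Hajłasz `s`-gradient whose `L^p` norm is at most `A`. -/
def HajlaszBound {X : Type*} [MeasurableSpace X] (ρ : X → X → ℝ) (μ : Measure X) (s p A : ℝ)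
    (u : X → ℝ) : Prop :=
  ∃ (h : X → ℝ≥0) (E : Set X), AEMeasurable h μ ∧ μ E = 0 ∧
    (∀ x y, x ∉ E → y ∉ E → |u x - u y| ≤ ρ x y ^ s * ((h x : ℝ) + h y)) ∧
    ∫⁻ x, (h x : ℝ≥0∞) ^ p ∂μ ≤ ENNReal.ofReal A ^ p

/-- The semi-norm `N` dominates the Hajłasz semi-norm with exponents `s` and `p`. -/
def HajlaszDominated {X : Type*} [MeasurableSpace X] (ρ : X → X → ℝ) (μ : Measure X) (s p : ℝ)
    (N : (X → ℝ) → ℝ≥0∞) : Prop :=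
  ∀ (u : X → ℝ) (A : ℝ), 0 < A → N u < ENNReal.ofReal A → HajlaszBound ρ μ s p A u

/-- Every pair of distinct points lies in exactly one dyadic annulus, so a common majorant of all `g
k` is a Hajłasz gradient. The points where it is infinite join the exceptional null set. -/
theorem IsFracGradient.hajlaszBound {X : Type*} [MeasurableSpace X] {ρ : X → X → ℝ}
    (hρ : IsQuasiMetric ρ) {μ : Measure X} {s p A : ℝ} (hp : 0 < p)
    {u : X → ℝ} {g : ℤ → X → ℝ≥0} (hg : IsFracGradient ρ μ s u g) {G : X → ℝ≥0∞}
    (hG : AEMeasurable G μ) (hgG : ∀ k x, (g k x : ℝ≥0∞) ≤ G x)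
    (hA : ∫⁻ x, G x ^ p ∂μ ≤ ENNReal.ofReal A ^ p) : HajlaszBound ρ μ s p A u := by
  obtain ⟨-, E, hE, hgE⟩ := hg
  have hfin : ∀ᵐ x ∂μ, G x ^ p < ∞ :=
    ae_lt_top' (hG.pow_const p)
      (ne_top_of_le_ne_top (ENNReal.rpow_ne_top_of_nonneg hp.le ENNReal.ofReal_ne_top) hA)
  refine ⟨fun x => (G x).toNNReal, E ∪ {x | ¬ G x ^ p < ∞}, hG.ennreal_toNNReal,
    measure_union_null hE (ae_iff.1 hfin), ?_, ?_⟩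
  · intro x y hx hy
    simp only [mem_union, mem_ofPred_eq, not_or, not_not] at hx hy
    have hle : ∀ z, G z ^ p < ∞ → ∀ k, (g k z : ℝ) ≤ (G z).toNNReal := by
      intro z hz k
      have hz' : G z ≠ ∞ := by
        intro h
        simp [h, hp] at hz
      have := ENNReal.toNNReal_mono hz' (hgG k z)
      rw [ENNReal.toNNReal_coe] at this
      exact_mod_cast this
    rcases eq_or_ne x y with rfl | hne
    · simp only [sub_self, abs_zero]
      exact mul_nonneg (Real.rpow_nonneg (hρ.nonneg _ _) _) (by positivity)
    -- The annulus `2^n ≤ ρ x y < 2^(n+1)` has index `k = -n - 1`.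
    · obtain ⟨n, hn⟩ := exists_mem_Ico_zpow (hρ.pos hne) (one_lt_two (α := ℝ))
      refine (hgE (-n - 1) x y hx.1 hy.1 ?_ ?_).trans ?_
      · simpa using hn.1
      · rw [show -(-n - 1) = n + 1 by ring]
        exact hn.2
      · have := hle x hx.2 (-n - 1)
        have := hle y hy.2 (-n - 1)
        exact mul_le_mul_of_nonneg_left (by linarith) (Real.rpow_nonneg (hρ.nonneg _ _) _)
  · refine le_trans (lintegral_mono fun x => ?_) hA
    exact ENNReal.rpow_le_rpow ENNReal.coe_toNNReal_le_self hp.le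

theorem hajlaszDominated_tlNorm {X : Type*} [MeasurableSpace X] {ρ : X → X → ℝ}
    (hρ : IsQuasiMetric ρ) (μ : Measure X) (s : ℝ) {q : ℝ≥0∞} (hq : 0 < q) {p : ℝ}
    (hp : 0 < p) : HajlaszDominated ρ μ s p (tlNorm ρ μ s q p) := by
  intro u A hA hN
  simp only [tlNorm, iInf_lt_iff] at hN
  obtain ⟨g, hg, hlt⟩ := hN
  refine hg.hajlaszBound hρ hp (aemeasurable_ellNorm q fun k => (hg.1 k).coe_nnreal_ennreal)
    (fun k x => le_ellNorm hq _ k) ?_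
  rw [← lebNorm_rpow hp]
  exact ENNReal.rpow_le_rpow hlt.le hp.le

/-- The majorant is the pointwise `ℓ^p` norm of the gradients: `L^p(ℓ^p) = ℓ^p(L^p)` by Tonelli, and
`ℓ^q ⊆ ℓ^p` because `q ≤ p`. -/
theorem hajlaszDominated_besovNorm {X : Type*} [MeasurableSpace X] {ρ : X → X → ℝ}
    (hρ : IsQuasiMetric ρ) (μ : Measure X) (s : ℝ) {q : ℝ≥0∞} (hq : 0 < q) {p : ℝ}
    (hp : 0 < p) (hqp : q ≤ ENNReal.ofReal p) :
    HajlaszDominated ρ μ s p (besovNorm ρ μ s q p) := by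
  intro u A hA hN
  simp only [besovNorm, iInf_lt_iff] at hN
  obtain ⟨g, hg, hlt⟩ := hN
  have hp' : 0 < ENNReal.ofReal p := ENNReal.ofReal_pos.2 hp
  refine hg.hajlaszBound hρ hp
    (aemeasurable_ellNorm (ENNReal.ofReal p) fun k => (hg.1 k).coe_nnreal_ennreal)
    (fun k x => le_ellNorm hp' _ k) ?_
  have h1 : ∀ x, ellNorm (ENNReal.ofReal p) (fun k => (g k x : ℝ≥0∞)) ^ p =
      ∑' k, (g k x : ℝ≥0∞) ^ p := fun x => by
    rw [ellNorm, if_neg ENNReal.ofReal_ne_top, ENNReal.toReal_ofReal hp.le, ← ENNReal.rpow_mul,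
      one_div_mul_cancel hp.ne', ENNReal.rpow_one]
  simp_rw [h1]
  rw [lintegral_tsum fun k => (hg.1 k).coe_nnreal_ennreal.pow_const p]
  simp_rw [← lebNorm_rpow hp]
  exact (tsum_rpow_le_ellNorm_rpow hq hqp _).trans (ENNReal.rpow_le_rpow hlt.le hp.le)

/-- Gradients `h n` whose `p`-th powers have integrals at most `2^(-n)` tend to zero almost
everywhere, and the pointwise inequality passes to the limit. This justifies dividing by `N u` when
`u` is not constant. -/
theorem HajlaszDominated.exists_ae_eq_const {X : Type*} [Nonempty X] [MeasurableSpace X]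
    {ρ : X → X → ℝ} {μ : Measure X} {s p : ℝ} (hp : 0 < p)
    {N : (X → ℝ) → ℝ≥0∞} (hN : HajlaszDominated ρ μ s p N) {u : X → ℝ} (hu : N u = 0) :
    ∃ c : ℝ, ∀ᵐ x ∂μ, u x = c := by
  rcases eq_or_ne μ 0 with rfl | hμ
  · exact ⟨0, by simp⟩
  have hε : ∀ n : ℕ, 0 < ((1 / 2 : ℝ) ^ n) ^ (1 / p) := fun n => by positivity
  choose h E hm hE hgrad hint using fun n : ℕ =>
    hN u _ (hε n) (by rw [hu]; exact ENNReal.ofReal_pos.2 (hε n))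
  have hint' : ∀ n, ∫⁻ x, (h n x : ℝ≥0∞) ^ p ∂μ ≤ ENNReal.ofReal ((1 / 2 : ℝ) ^ n) := fun n => by
    refine (hint n).trans_eq ?_
    rw [ENNReal.ofReal_rpow_of_pos (hε n), ← Real.rpow_mul (by positivity),
      one_div_mul_cancel hp.ne', Real.rpow_one]
  have hsum : ∫⁻ x, ∑' n, (h n x : ℝ≥0∞) ^ p ∂μ ≠ ∞ := by
    rw [lintegral_tsum fun n => (hm n).coe_nnreal_ennreal.pow_const p]
    refine ne_top_of_le_ne_top ?_ (ENNReal.tsum_le_tsum hint')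
    exact (summable_geometric_of_lt_one (by norm_num) (by norm_num)).tsum_ofReal_ne_top
  have hae : ∀ᵐ x ∂μ, ∑' n, (h n x : ℝ≥0∞) ^ p < ∞ :=
    ae_lt_top' (AEMeasurable.tsum fun n => (hm n).coe_nnreal_ennreal.pow_const p) hsum
  have hE' : ∀ᵐ x ∂μ, ∀ n, x ∉ E n := ae_all_iff.2 fun n => measure_eq_zero_iff_ae_notMem.1 (hE n)
  have hlim : ∀ x, ∑' n, (h n x : ℝ≥0∞) ^ p < ∞ →
      Filter.Tendsto (fun n => (h n x : ℝ)) Filter.atTop (nhds 0) := by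
    intro x hx
    have h1 := ENNReal.tendsto_atTop_zero_of_tsum_ne_top hx.ne
    have h2 := h1.ennrpow_const (1 / p)
    rw [ENNReal.zero_rpow_of_pos (by positivity)] at h2
    simp_rw [← ENNReal.rpow_mul, mul_one_div_cancel hp.ne', ENNReal.rpow_one] at h2
    have h3 : Filter.Tendsto (fun n => h n x) Filter.atTop (nhds 0) :=
      ENNReal.tendsto_coe.1 (by rwa [ENNReal.coe_zero])
    exact NNReal.tendsto_coe.2 h3
  have : (ae μ).NeBot := ae_neBot.2 hμ
  obtain ⟨x₀, hx₀, hx₀'⟩ := (hae.and hE').exists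
  refine ⟨u x₀, ?_⟩
  filter_upwards [hae, hE'] with x hx hx'
  have h1 : Filter.Tendsto (fun n => ρ x x₀ ^ s * ((h n x : ℝ) + h n x₀)) Filter.atTop (nhds 0) := by
    simpa using ((hlim x hx).add (hlim x₀ hx₀)).const_mul (ρ x x₀ ^ s)
  have h2 := ge_of_tendsto' h1 fun n => hgrad n x x₀ (hx' n) (hx₀' n)
  exact sub_eq_zero.1 (abs_nonpos_iff.1 h2)

/-! ### Norms of bump functions -/

/-- The semi-norm `N` is well-behaved on `β`-Hölder continuous functions which are supported in a
set `B` and have oscillation at most one. -/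
def BumpBound {X : Type*} [MeasurableSpace X] (ρ : X → X → ℝ) (μ : Measure X) (s β p : ℝ)
    (N : (X → ℝ) → ℝ≥0∞) : Prop :=
  ∃ K : ℝ, 0 < K ∧ ∀ (u : X → ℝ) (B : Set X) (L : ℝ), MeasurableSet B → 0 < L →
    (∀ y z, |u y - u z| ≤ 1) → (∀ y z, |u y - u z| ≤ L * ρ y z ^ β) → (∀ y, y ∉ B → u y = 0) →
      N u ≤ ENNReal.ofReal (K * L ^ (s / β)) * μ B ^ (1 / p)

/-- The profile of the gradients of bump functions. -/
noncomputable def bumpProfile (ε : ℝ) (k : ℤ) : ℝ≥0 := (2 : ℝ≥0) ^ (-(|(k : ℝ)| * ε))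

/-- For `q = ∞` boundedness suffices and `ε = 0` is allowed, which covers the endpoint `s = β`;
otherwise the two tails are geometric series. -/
theorem ellNorm_bumpProfile_ne_top {q : ℝ≥0∞} (hq : 0 < q) {ε : ℝ} (hε : 0 ≤ ε)
    (hqε : q ≠ ∞ → 0 < ε) : ellNorm q (fun k => (bumpProfile ε k : ℝ≥0∞)) ≠ ∞ := by
  unfold ellNorm
  split_ifs with h
  · refine ne_top_of_le_ne_top ENNReal.one_ne_top (iSup_le fun k => ?_)
    rw [ENNReal.coe_le_one_iff]
    exact NNReal.rpow_le_one_of_one_le_of_nonpos one_le_two (neg_nonpos.2 (by positivity))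
  · have hε' := hqε h
    have hq' : 0 < q.toReal := ENNReal.toReal_pos hq.ne' h
    refine ENNReal.rpow_ne_top_of_nonneg (by positivity) ?_
    set r : ℝ≥0 := (2 : ℝ≥0) ^ (-(ε * q.toReal)) with hr
    have hr1 : r < 1 := NNReal.rpow_lt_one_of_one_lt_of_neg one_lt_two (neg_neg_of_pos (by positivity))
    have hterm : ∀ k : ℤ, (bumpProfile ε k : ℝ≥0∞) ^ q.toReal = ((r ^ k.natAbs : ℝ≥0) : ℝ≥0∞) := by
      intro k
      rw [← ENNReal.coe_rpow_of_nonneg _ hq'.le, bumpProfile, ← NNReal.rpow_mul, hr,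
        ← NNReal.rpow_natCast, ← NNReal.rpow_mul, Nat.cast_natAbs, Int.cast_abs]
      congr 2
      ring
    simp_rw [hterm]
    rw [ENNReal.tsum_coe_ne_top_iff_summable, ← NNReal.summable_coe]
    have hgeo : Summable fun n : ℕ => (r : ℝ) ^ n :=
      summable_geometric_of_lt_one r.coe_nonneg (by exact_mod_cast hr1)
    refine Summable.of_nat_of_neg ?_ ?_
    · simpa using hgeo
    · simpa using hgeo

/-- Bump functions have fractional gradients with the expected decay. -/
theorem exists_bump_gradient {X : Type*} [MeasurableSpace X] {ρ : X → X → ℝ}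
    (μ : Measure X) {s β : ℝ} (hs : 0 < s) (hsβ : s ≤ β) {u : X → ℝ}
    {B : Set X} {L : ℝ} (hB : MeasurableSet B) (hL : 0 < L) (h1 : ∀ y z, |u y - u z| ≤ 1)
    (h2 : ∀ y z, |u y - u z| ≤ L * ρ y z ^ β) (h0 : ∀ y, y ∉ B → u y = 0) :
    ∃ m : ℤ, IsFracGradient ρ μ s u (fun k => B.indicator fun _ =>
      ((2 : ℝ) ^ (s + β) * L ^ (s / β)).toNNReal * bumpProfile (min s (β - s)) (k - m)) := by
  have hβ : 0 < β := hs.trans_le hsβ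
  set l : ℝ := Real.logb 2 L with hl
  have hLl : L = 2 ^ l := (Real.rpow_logb (by norm_num) (by norm_num) hL).symm
  -- The scale `2^(-m)` is the one at which `L ρ^β` becomes comparable to the oscillation bound `1`:
  -- `2^m ≤ L^(1/β) < 2^(m+1)`. The factor `2^(s+β)` in the gradient absorbs the rounding.
  set m : ℤ := ⌊l / β⌋ with hm
  have hm1 : m * β ≤ l := by
    have := Int.floor_le (l / β)
    rwa [le_div_iff₀ hβ] at this
  have hm2 : l < (m + 1) * β := by
    have := Int.lt_floor_add_one (l / β)
    rwa [div_lt_iff₀ hβ] at this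
  refine ⟨m, fun k => (measurable_const.indicator hB).aemeasurable, ∅, measure_empty, ?_⟩
  intro k x y _ _ hk1 hk2
  set ε := min s (β - s) with hε
  have hε0 : 0 ≤ ε := le_min hs.le (by linarith)
  have hεs : ε ≤ s := min_le_left _ _
  have hεβ : ε ≤ β - s := min_le_right _ _
  set H : ℝ≥0 := ((2 : ℝ) ^ (s + β) * L ^ (s / β)).toNNReal * bumpProfile ε (k - m) with hH
  have hHval : (H : ℝ) = 2 ^ (s + β + l * (s / β) - |(k : ℝ) - m| * ε) := by
    rw [hH, NNReal.coe_mul, Real.coe_toNNReal _ (by positivity), bumpProfile, NNReal.coe_rpow, hLl,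
      ← Real.rpow_mul (by norm_num), sub_eq_add_neg (s + β + l * (s / β)),
      Real.rpow_add (by norm_num) (s + β + l * (s / β)),
      Real.rpow_add (by norm_num) (s + β)]
    push_cast
    rfl
  have hρpos : 0 < ρ x y := lt_of_lt_of_le (by positivity) hk1
  have hρ1 : (2 : ℝ) ^ (-((k : ℝ) + 1)) ≤ ρ x y := by
    rw [← Real.rpow_intCast] at hk1
    refine le_trans (le_of_eq ?_) hk1
    push_cast
    congr 1
    ring
  have hρ2 : ρ x y ≤ (2 : ℝ) ^ (-(k : ℝ)) := by
    rw [← Real.rpow_intCast] at hk2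
    push_cast at hk2
    exact hk2.le
  have key : |u x - u y| ≤ ρ x y ^ s * H := by
    have hls : l * (s / β) ≥ m * s := by
      rw [mul_div_assoc', ge_iff_le, le_div_iff₀ hβ]
      nlinarith
    -- At distances above the scale `2^(-m)` the bound `1` on the oscillation is the better one, and
    -- the gradient decays with rate `s`. Below it the Hölder bound gives the rate `β - s`. The
    -- profile uses the smaller of the two rates.
    rcases le_or_gt k m with hkm | hkm
    · have hkm' : (k : ℝ) ≤ m := by exact_mod_cast hkm
      refine (h1 x y).trans ?_
      have e1 : ((2 : ℝ) ^ (-((k : ℝ) + 1))) ^ s ≤ ρ x y ^ s :=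
        Real.rpow_le_rpow (by positivity) hρ1 hs.le
      refine le_trans ?_ (mul_le_mul_of_nonneg_right e1 H.coe_nonneg)
      rw [hHval, ← Real.rpow_mul (by norm_num), ← Real.rpow_add (by norm_num)]
      refine Real.one_le_rpow (by norm_num) ?_
      rw [abs_of_nonpos (by linarith)]
      nlinarith
    · have hkm' : (m : ℝ) + 1 ≤ k := by exact_mod_cast hkm
      refine (h2 x y).trans ?_
      rw [show β = s + (β - s) by ring, Real.rpow_add hρpos, mul_left_comm]
      refine mul_le_mul_of_nonneg_left ?_ (by positivity)
      have e1 : ρ x y ^ (β - s) ≤ ((2 : ℝ) ^ (-(k : ℝ))) ^ (β - s) :=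
        Real.rpow_le_rpow hρpos.le hρ2 (by linarith)
      refine (mul_le_mul_of_nonneg_left e1 hL.le).trans ?_
      rw [hHval]
      conv_lhs => rw [hLl, ← Real.rpow_mul (by norm_num), ← Real.rpow_add (by norm_num)]
      refine Real.rpow_le_rpow_of_exponent_le (by norm_num) ?_
      rw [abs_of_nonneg (by linarith)]
      have e2 : l - l * (s / β) ≤ (m + 1) * (β - s) := by
        have : l - l * (s / β) = l / β * (β - s) := by field_simp
        rw [this]
        exact mul_le_mul_of_nonneg_right ((div_le_iff₀ hβ).2 hm2.le) (by linarith)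
      nlinarith
  -- The gradient may be cut off outside `B`: if one of the two points lies in `B`, its term alone
  -- suffices, and otherwise both values of `u` vanish.
  by_cases hx : x ∈ B
  · refine key.trans (mul_le_mul_of_nonneg_left ?_ (by positivity))
    have h3 : B.indicator (fun _ => H) x = H := indicator_of_mem hx _
    have h4 := (B.indicator (fun _ => H) y).coe_nonneg
    show (H : ℝ) ≤ (B.indicator (fun _ => H) x : ℝ≥0) + (B.indicator (fun _ => H) y : ℝ≥0)
    rw [h3]
    linarith
  by_cases hy : y ∈ B
  · refine key.trans (mul_le_mul_of_nonneg_left ?_ (by positivity))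
    have h3 : B.indicator (fun _ => H) y = H := indicator_of_mem hy _
    have h4 := (B.indicator (fun _ => H) x).coe_nonneg
    show (H : ℝ) ≤ (B.indicator (fun _ => H) x : ℝ≥0) + (B.indicator (fun _ => H) y : ℝ≥0)
    rw [h3]
    linarith
  rw [h0 x hx, h0 y hy, sub_self, abs_zero]
  positivity

theorem coe_indicator_mul {X : Type*} (B : Set X) (c b : ℝ≥0) (x : X) :
    ((B.indicator (fun _ => c * b) x : ℝ≥0) : ℝ≥0∞) =
      B.indicator (fun _ => (c : ℝ≥0∞) * (b : ℝ≥0∞)) x := by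
  by_cases hx : x ∈ B <;> simp [hx]

/-- The gradients are constants on `B` with a translated profile. The `ℓ^q` norm is invariant under
translation, so the scale of the bump is felt only through `L^(s/β)`. -/
theorem bumpBound_tlNorm {X : Type*} [MeasurableSpace X] (ρ : X → X → ℝ)
    (μ : Measure X) {s β : ℝ} (hs : 0 < s) (hsβ : s ≤ β) {q : ℝ≥0∞}
    (hq : 0 < q) (hqβ : q ≠ ∞ → s < β) {p : ℝ} (hp : 0 < p) :
    BumpBound ρ μ s β p (tlNorm ρ μ s q p) := by
  have hfin := ellNorm_bumpProfile_ne_top hq (ε := min s (β - s)) (le_min hs.le (by linarith))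
    (fun h => lt_min hs (by linarith [hqβ h]))
  set T := ellNorm q (fun k => (bumpProfile (min s (β - s)) k : ℝ≥0∞)) with hT
  refine ⟨(T.toReal + 1) * 2 ^ (s + β), by positivity, fun u B L hB hL h1 h2 h0 => ?_⟩
  obtain ⟨m, hm⟩ := exists_bump_gradient μ hs hsβ hB hL h1 h2 h0
  refine (iInf₂_le _ hm).trans ?_
  set c := ((2 : ℝ) ^ (s + β) * L ^ (s / β)).toNNReal with hc
  have hval : (fun x => ellNorm q fun k => ((B.indicator (fun _ =>
      c * bumpProfile (min s (β - s)) (k - m)) x : ℝ≥0) : ℝ≥0∞)) =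
      B.indicator fun _ => (c : ℝ≥0∞) * T := by
    ext x
    simp_rw [coe_indicator_mul]
    by_cases hx : x ∈ B
    · simp only [indicator_of_mem hx]
      rw [ellNorm_const_mul hq, ellNorm_sub_right q (fun k => (bumpProfile (min s (β - s)) k : ℝ≥0∞)) m]
    · simp only [indicator_of_notMem hx]
      exact ellNorm_zero hq
  rw [hval, lebNorm_indicator_const hp hB]
  refine mul_le_mul_left ?_ _
  have hT' : T ≤ ENNReal.ofReal (T.toReal + 1) := by
    conv_lhs => rw [← ENNReal.ofReal_toReal hfin]
    exact ENNReal.ofReal_le_ofReal (by linarith)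
  refine (mul_le_mul' le_rfl hT').trans_eq ?_
  rw [mul_assoc, ENNReal.ofReal_mul (by positivity), mul_comm]
  rfl

theorem bumpBound_besovNorm {X : Type*} [MeasurableSpace X] (ρ : X → X → ℝ)
    (μ : Measure X) {s β : ℝ} (hs : 0 < s) (hsβ : s ≤ β) {q : ℝ≥0∞}
    (hq : 0 < q) (hqβ : q ≠ ∞ → s < β) {p : ℝ} (hp : 0 < p) :
    BumpBound ρ μ s β p (besovNorm ρ μ s q p) := by
  have hfin := ellNorm_bumpProfile_ne_top hq (ε := min s (β - s)) (le_min hs.le (by linarith))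
    (fun h => lt_min hs (by linarith [hqβ h]))
  set T := ellNorm q (fun k => (bumpProfile (min s (β - s)) k : ℝ≥0∞)) with hT
  refine ⟨(T.toReal + 1) * 2 ^ (s + β), by positivity, fun u B L hB hL h1 h2 h0 => ?_⟩
  obtain ⟨m, hm⟩ := exists_bump_gradient μ hs hsβ hB hL h1 h2 h0
  refine (iInf₂_le _ hm).trans ?_
  set c := ((2 : ℝ) ^ (s + β) * L ^ (s / β)).toNNReal with hc
  have hval : (fun k => lebNorm μ p fun x => ((B.indicator (fun _ =>
      c * bumpProfile (min s (β - s)) (k - m)) x : ℝ≥0) : ℝ≥0∞)) =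
      fun k => (c * μ B ^ (1 / p)) * (bumpProfile (min s (β - s)) (k - m) : ℝ≥0∞) := by
    ext k
    simp_rw [coe_indicator_mul]
    rw [lebNorm_indicator_const hp hB, mul_right_comm]
  rw [hval, ellNorm_const_mul hq,
    ellNorm_sub_right q (fun k => (bumpProfile (min s (β - s)) k : ℝ≥0∞)) m, mul_right_comm]
  refine mul_le_mul_left ?_ _
  have hT' : T ≤ ENNReal.ofReal (T.toReal + 1) := by
    conv_lhs => rw [← ENNReal.ofReal_toReal hfin]
    exact ENNReal.ofReal_le_ofReal (by linarith)
  refine (mul_le_mul' le_rfl hT').trans_eq ?_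
  rw [mul_assoc, ENNReal.ofReal_mul (by positivity), mul_comm]
  rfl

/-! ### Bump functions adapted to a regularization -/

namespace IsRegularization

variable {X : Type*} {ρ : X → X → ℝ} {β K : ℝ} {F : X → X → ℝ}

theorem pos (h : IsRegularization ρ β K F) : 0 < K := zero_lt_one.trans_le h.one_le

theorem lt_of_lt (h : IsRegularization ρ β K F) (hβ : 0 < β) {x y : X} {r : ℝ} (hr : 0 < r)
    (hF : F x y < r ^ β / K) : ρ x y < r := by
  have h1 := h.ge x y
  rw [lt_div_iff₀ h.pos, mul_comm] at hF
  by_contra! hle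
  exact absurd (Real.rpow_le_rpow hr.le hle hβ.le) (not_le.2 (h1.trans_lt hF))

/-- Hölder continuity makes the sublevel sets of `F x` open and hence measurable. Balls of `ρ`
itself need not be open, so the bumps are built on sublevel sets. -/
theorem exists_ball_subset (h : IsRegularization ρ β K F) (hρ : IsQuasiMetric ρ) (hβ : 0 < β)
    {x y : X} {t : ℝ} (ht : F x y < t) : ∃ r, 0 < r ∧ ball ρ y r ⊆ {z | F x z < t} := by
  have hd : 0 < (t - F x y) / K := div_pos (sub_pos.2 ht) h.pos
  refine ⟨((t - F x y) / K) ^ (1 / β), by positivity, fun z hz => ?_⟩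
  have h1 : ρ y z ^ β < (t - F x y) / K := by
    have h2 := Real.rpow_lt_rpow (hρ.nonneg y z) hz hβ
    rwa [← Real.rpow_mul hd.le, one_div_mul_cancel hβ.ne', Real.rpow_one] at h2
  rw [lt_div_iff₀ h.pos] at h1
  have h3 := (abs_le.1 (h.holder x y z)).1
  simp only [mem_ofPred_eq]
  linarith

theorem self_le (h : IsRegularization ρ β K F) (hρ : IsQuasiMetric ρ) (hβ : 0 < β) (x : X) :
    F x x ≤ 0 := by
  simpa [hρ.self, Real.zero_rpow hβ.ne'] using h.le x x

theorem measurable [MeasurableSpace X] {μ : Measure X} (h : IsRegularization ρ β K F)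
    (hX : IsQuasiMetricMeasure ρ μ) (hβ : 0 < β) (x : X) : Measurable (F x) :=
  measurable_of_Iio fun _ => hX.borel _ fun _ hy => h.exists_ball_subset hX.quasiMetric hβ hy

theorem measure_pos [MeasurableSpace X] {μ : Measure X} (h : IsRegularization ρ β K F)
    (hX : IsQuasiMetricMeasure ρ μ) (hβ : 0 < β) (x : X) {t : ℝ} (ht : 0 < t) :
    0 < μ {y | F x y < t} := by
  obtain ⟨r, hr, hsub⟩ := h.exists_ball_subset hX.quasiMetric hβ
    ((h.self_le hX.quasiMetric hβ x).trans_lt ht)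
  exact (hX.ball_pos x r hr).trans_le (measure_mono hsub)

end IsRegularization

/-- A decreasing sequence of levels between `r ^ β / K` and `r ^ β / (2 * K)`. -/
noncomputable def level (β K r : ℝ) (j : ℕ) : ℝ := r ^ β / (2 * K) * (1 + (1 / 2) ^ j)

/-- The sublevel sets of `F x` at the levels `level β K r j`. -/
def sublevel {X : Type*} (F : X → X → ℝ) (β K r : ℝ) (x : X) (j : ℕ) : Set X :=
  {y | F x y < level β K r j}

/-- The bump function with value one on `{F x < a}` and support in `{F x < b}`. -/
noncomputable def bump {X : Type*} (F : X → X → ℝ) (x : X) (a b : ℝ) (y : X) : ℝ :=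
  max 0 (min 1 ((b - F x y) / (b - a)))

/-- The bump function between two consecutive sublevel sets. -/
noncomputable def levelBump {X : Type*} (F : X → X → ℝ) (β K r : ℝ) (x : X) (j : ℕ) : X → ℝ :=
  bump F x (level β K r (j + 1)) (level β K r j)

/-! ### Truncated affine functions of the regularization -/

section Bump

variable {X : Type*} {F : X → X → ℝ} {x : X} {a b : ℝ}

theorem bump_nonneg (y : X) : 0 ≤ bump F x a b y := le_max_left _ _

theorem bump_le_one (y : X) : bump F x a b y ≤ 1 := max_le zero_le_one (min_le_left _ _)

theorem bump_eq_one (hab : a < b) {y : X} (hy : F x y ≤ a) : bump F x a b y = 1 := by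
  have : 1 ≤ (b - F x y) / (b - a) := (one_le_div (by linarith)).2 (by linarith)
  rw [bump, min_eq_left this, max_eq_right zero_le_one]

theorem bump_eq_zero (hab : a < b) {y : X} (hy : b ≤ F x y) : bump F x a b y = 0 := by
  have : (b - F x y) / (b - a) ≤ 0 := div_nonpos_of_nonpos_of_nonneg (by linarith) (by linarith)
  exact max_eq_left ((min_le_right _ _).trans this)

theorem abs_bump_sub_le_one (y z : X) : |bump F x a b y - bump F x a b z| ≤ 1 := by
  have h1 := bump_nonneg (F := F) (x := x) (a := a) (b := b) y
  have h2 := bump_nonneg (F := F) (x := x) (a := a) (b := b) z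
  have h3 := bump_le_one (F := F) (x := x) (a := a) (b := b) y
  have h4 := bump_le_one (F := F) (x := x) (a := a) (b := b) z
  rw [abs_le]
  constructor <;> linarith

theorem abs_bump_sub_le (hab : a < b) (y z : X) :
    |bump F x a b y - bump F x a b z| ≤ |F x y - F x z| / (b - a) := by
  have h1 : |bump F x a b y - bump F x a b z| ≤ |(b - F x y) / (b - a) - (b - F x z) / (b - a)| := by
    unfold bump
    have h2 := abs_max_sub_max_le_max 0 (min 1 ((b - F x y) / (b - a))) 0
      (min 1 ((b - F x z) / (b - a)))
    have h3 := abs_min_sub_min_le_max 1 ((b - F x y) / (b - a)) 1 ((b - F x z) / (b - a))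
    rw [sub_self, abs_zero] at h2 h3
    exact h2.trans (max_le (abs_nonneg _) (h3.trans (max_le (abs_nonneg _) le_rfl)))
  refine h1.trans_eq ?_
  rw [← sub_div, abs_div, abs_of_pos (sub_pos.2 hab), abs_sub_comm (F x y)]
  congr 2
  ring

theorem measurable_bump [MeasurableSpace X] (hF : Measurable (F x)) :
    Measurable (bump F x a b) := by
  unfold bump
  fun_prop

end Bump

/-! ### Shrinking sublevel sets and the bumps between them -/

section Level

variable {X : Type*} {ρ : X → X → ℝ} {β K : ℝ} {F : X → X → ℝ}

theorem level_succ_lt (hK : 0 < K) {r : ℝ} (hr : 0 < r) (j : ℕ) :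
    level β K r (j + 1) < level β K r j := by
  unfold level
  have h1 : (0:ℝ) < (1 / 2) ^ j := by positivity
  rw [pow_succ]
  exact mul_lt_mul_of_pos_left (by linarith) (by positivity)

/-- The gaps shrink geometrically, so the Hölder constants of the bumps grow like `2^j`, which the
iteration tolerates. -/
theorem level_sub (r : ℝ) (j : ℕ) :
    level β K r j - level β K r (j + 1) = r ^ β / (4 * K) * (1 / 2) ^ j := by
  unfold level
  ring

theorem level_le (hK : 0 < K) {r : ℝ} (hr : 0 < r) (j : ℕ) : level β K r j ≤ r ^ β / K := by
  have h1 : ((1:ℝ) / 2) ^ j ≤ 1 := pow_le_one₀ (by norm_num) (by norm_num)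
  have h2 : r ^ β / (2 * K) * (1 + (1 / 2) ^ j) ≤ r ^ β / (2 * K) * (1 + 1) :=
    mul_le_mul_of_nonneg_left (by linarith) (by positivity)
  refine h2.trans_eq ?_
  field_simp
  norm_num

theorem lt_level (hK : 0 < K) {r : ℝ} (hr : 0 < r) (j : ℕ) :
    r ^ β / (2 * K) < level β K r j := by
  have h1 : (0:ℝ) < (1 / 2) ^ j := by positivity
  exact lt_mul_of_one_lt_right (by positivity) (by linarith)

theorem sublevel_subset_ball (h : IsRegularization ρ β K F) (hβ : 0 < β) {r : ℝ} (hr : 0 < r)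
    (x : X) (j : ℕ) : sublevel F β K r x j ⊆ ball ρ x r :=
  fun _ hy => h.lt_of_lt hβ hr (lt_of_lt_of_le hy (level_le h.pos hr j))

theorem levelBump_eq_one (hK : 0 < K) {r : ℝ} (hr : 0 < r) {x y : X} {j : ℕ}
    (hy : y ∈ sublevel F β K r x (j + 1)) : levelBump F β K r x j y = 1 :=
  bump_eq_one (level_succ_lt hK hr j) (le_of_lt hy)

theorem levelBump_eq_zero (hK : 0 < K) {r : ℝ} (hr : 0 < r) {x y : X} {j : ℕ}
    (hy : y ∉ sublevel F β K r x j) : levelBump F β K r x j y = 0 :=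
  bump_eq_zero (level_succ_lt hK hr j) (not_lt.1 hy)

theorem sublevel_subset_zero (hK : 0 < K) {r : ℝ} (hr : 0 < r) (x : X) (j : ℕ) :
    sublevel F β K r x j ⊆ sublevel F β K r x 0 := by
  intro y (hy : F x y < _)
  refine hy.trans_le ?_
  exact (antitone_nat_of_succ_le fun n => (level_succ_lt hK hr n).le) (Nat.zero_le j)

variable [MeasurableSpace X] {μ : Measure X}

theorem measurableSet_sublevel (h : IsRegularization ρ β K F) (hX : IsQuasiMetricMeasure ρ μ)
    (hβ : 0 < β) (r : ℝ) (x : X) (j : ℕ) : MeasurableSet (sublevel F β K r x j) :=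
  h.measurable hX hβ x measurableSet_Iio

theorem measurable_levelBump (h : IsRegularization ρ β K F) (hX : IsQuasiMetricMeasure ρ μ)
    (hβ : 0 < β) (r : ℝ) (x : X) (j : ℕ) : Measurable (levelBump F β K r x j) :=
  measurable_bump (h.measurable hX hβ x)

theorem measure_sublevel_lt_top (h : IsRegularization ρ β K F) (hX : IsQuasiMetricMeasure ρ μ)
    (hβ : 0 < β) {r : ℝ} (hr : 0 < r) (x : X) (j : ℕ) : μ (sublevel F β K r x j) < ∞ :=
  (measure_mono (sublevel_subset_ball h hβ hr x j)).trans_lt (hX.ball_lt_top x r hr)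

theorem measure_sublevel_pos (h : IsRegularization ρ β K F) (hX : IsQuasiMetricMeasure ρ μ)
    (hβ : 0 < β) {r : ℝ} (hr : 0 < r) (x : X) (j : ℕ) : 0 < μ (sublevel F β K r x j) :=
  h.measure_pos hX hβ x (lt_trans (by have := h.pos; positivity) (lt_level h.pos hr j))

/-- The semi-norm of the bump functions between consecutive sublevel sets. -/
theorem BumpBound.exists_levelBump_le {s p : ℝ} {N : (X → ℝ) → ℝ≥0∞} (hN : BumpBound ρ μ s β p N)
    (hs : 0 < s) (hp : 0 < p) (h : IsRegularization ρ β K F) (hX : IsQuasiMetricMeasure ρ μ)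
    (hβ : 0 < β) :
    ∃ C Λ : ℝ, 0 < C ∧ 1 ≤ Λ ∧ ∀ (x : X) (r : ℝ), 0 < r → ∀ j,
      MemSpace μ N (levelBump F β K r x j) ∧
      N (levelBump F β K r x j) ≤
        ENNReal.ofReal (C * Λ ^ j * r ^ (-s)) * μ (sublevel F β K r x j) ^ (1 / p) := by
  obtain ⟨C, hC, hbd⟩ := hN
  have hK := h.pos
  refine ⟨C * (4 * K ^ 2) ^ (s / β), 2 ^ (s / β), by positivity,
    Real.one_le_rpow one_le_two (by positivity), fun x r hr j => ?_⟩
  have hle : N (levelBump F β K r x j) ≤ ENNReal.ofReal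
      (C * (4 * K ^ 2) ^ (s / β) * (2 ^ (s / β)) ^ j * r ^ (-s)) *
        μ (sublevel F β K r x j) ^ (1 / p) := by
    have hd : 0 < level β K r j - level β K r (j + 1) := sub_pos.2 (level_succ_lt hK hr j)
    have := hbd (levelBump F β K r x j) (sublevel F β K r x j)
      -- The Hölder constant of the bump is that of `F` divided by the gap, equal to `4 K^2 2^j
      -- r^(-β)`; its power `s / β` yields `Λ^j` and `r^(-s)`.
      (K / (level β K r j - level β K r (j + 1)))
      (measurableSet_sublevel h hX hβ r x j) (by positivity) (abs_bump_sub_le_one) (fun y z => by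
        refine (abs_bump_sub_le (level_succ_lt hK hr j) y z).trans ?_
        rw [div_mul_eq_mul_div]
        exact div_le_div_of_nonneg_right (h.holder x y z) hd.le)
      (fun y hy => levelBump_eq_zero hK hr hy)
    refine this.trans_eq ?_
    congr 2
    rw [level_sub]
    have e1 : K / (r ^ β / (4 * K) * (1 / 2) ^ j) = 4 * K ^ 2 * 2 ^ j * r ^ (-β) := by
      rw [Real.rpow_neg hr.le, one_div, inv_pow]
      field_simp
    rw [e1, Real.mul_rpow (by positivity) (by positivity), Real.mul_rpow (by positivity)
      (by positivity), ← Real.rpow_mul hr.le, ← Real.rpow_natCast 2 j, ← Real.rpow_mul zero_le_two,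
      mul_comm (j : ℝ), Real.rpow_mul zero_le_two, Real.rpow_natCast]
    have e2 : -β * (s / β) = -s := by field_simp
    rw [e2]
    ring
  refine ⟨⟨(measurable_levelBump h hX hβ r x j).aemeasurable, hle.trans_lt ?_⟩, hle⟩
  exact ENNReal.mul_lt_top ENNReal.ofReal_lt_top
    (ENNReal.rpow_lt_top_of_nonneg (by positivity) (measure_sublevel_lt_top h hX hβ hr x j).ne)

end Level

/-- For the normalized measures `m j / r^Q`, the relation `Q τ = Q θ + s` cancels all powers of `r`,
so the threshold of the iteration is uniform in `r`. -/
theorem exists_measure_lower_of_iteration {θ τ C Λ Q s : ℝ} (hθ : 0 < θ) (hQ : 0 < Q) (hs : 0 < s)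
    (hτ : Q * τ = Q * θ + s) (hC : 0 < C) (hΛ : 1 ≤ Λ) :
    ∃ ε : ℝ, 0 < ε ∧ ∀ (m : ℕ → ℝ≥0∞) (r : ℝ) (δ : ℝ≥0∞), 0 < r → 0 < δ →
      (∀ j, δ ≤ m j) → (∀ j, m j < ∞) →
      (∀ j, m (j + 1) ^ θ ≤ ENNReal.ofReal (C * Λ ^ j * r ^ (-s)) * m j ^ τ) →
        ENNReal.ofReal (ε * r ^ Q) ≤ m 0 := by
  have hθτ : θ < τ := by
    by_contra! h
    nlinarith [mul_le_mul_of_nonneg_left h hQ.le]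
  obtain ⟨ε, hε, H⟩ := exists_le_of_iteration hθ hθτ hC hΛ
  refine ⟨ε, hε, fun m r δ hr hδ hm hfin hstep => ?_⟩
  have hδfin : δ ≠ ∞ := ((hm 0).trans_lt (hfin 0)).ne
  have hrQ : 0 < r ^ Q := by positivity
  have h1 := H (fun j => (m j).toReal / r ^ Q) (δ.toReal / r ^ Q)
    (div_pos (ENNReal.toReal_pos hδ.ne' hδfin) hrQ)
    (fun j => div_le_div_of_nonneg_right (ENNReal.toReal_mono (hfin j).ne (hm j)) hrQ.le)
    (fun j => by
      have h2 := ENNReal.toReal_mono (ENNReal.mul_ne_top ENNReal.ofReal_ne_top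
        (ENNReal.rpow_ne_top_of_nonneg (hθ.trans hθτ).le (hfin j).ne)) (hstep j)
      rw [ENNReal.toReal_mul, ENNReal.toReal_ofReal (by positivity), ← ENNReal.toReal_rpow,
        ← ENNReal.toReal_rpow] at h2
      rw [Real.div_rpow ENNReal.toReal_nonneg hrQ.le, Real.div_rpow ENNReal.toReal_nonneg hrQ.le,
        ← Real.rpow_mul hr.le, ← Real.rpow_mul hr.le, hτ, Real.rpow_add hr,
        div_le_iff₀ (by positivity)]
      refine h2.trans_eq ?_
      rw [Real.rpow_neg hr.le]
      field_simp)
  rw [le_div_iff₀ hrQ] at h1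
  exact ENNReal.ofReal_le_of_le_toReal h1

theorem sobExp_pos {s Q p : ℝ} (hs : 0 < s) (hp : p ∈ Ioo 0 (Q / s)) : 0 < sobExp s Q p := by
  have h1 : p * s < Q := (lt_div_iff₀ hs).1 hp.2
  have h2 : 0 < p * s := mul_pos hp.1 hs
  exact div_pos (mul_pos (by linarith) hp.1) (by linarith)

theorem one_div_sobExp {s Q p : ℝ} (hs : 0 < s) (hp : p ∈ Ioo 0 (Q / s)) :
    Q * (1 / p) = Q * (1 / sobExp s Q p) + s := by
  have h1 : p * s < Q := (lt_div_iff₀ hs).1 hp.2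
  have h2 : 0 < p * s := mul_pos hp.1 hs
  have h3 : Q - s * p ≠ 0 := by nlinarith
  have h4 : Q ≠ 0 := by linarith
  have h5 := hp.1.ne'
  rw [sobExp]
  field_simp
  ring

theorem le_eLpNorm_of_le {X : Type*} [MeasurableSpace X] {μ : Measure X} {P : ℝ} (hP : 0 < P)
    {S : Set X} (hS : MeasurableSet S) {f : X → ℝ} {a : ℝ} (ha : 0 ≤ a) (hf : ∀ y ∈ S, a ≤ |f y|) :
    ENNReal.ofReal a * μ S ^ (1 / P) ≤ eLpNorm f (ENNReal.ofReal P) μ := by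
  have h1 := eLpNorm_indicator_const (μ := μ) (c := a) hS (p := ENNReal.ofReal P)
    (ENNReal.ofReal_pos.2 hP).ne' ENNReal.ofReal_ne_top
  rw [ENNReal.toReal_ofReal hP.le, Real.enorm_eq_ofReal ha] at h1
  rw [← h1]
  refine eLpNorm_mono fun y => ?_
  by_cases hy : y ∈ S
  · simpa [hy, abs_of_nonneg ha] using hf y hy
  · simp [hy]

theorem eLpNorm_le_of_le {X : Type*} [MeasurableSpace X] {μ : Measure X} {P : ℝ} (hP : 0 < P)
    {S : Set X} (hS : MeasurableSet S) {f : X → ℝ} (hf : ∀ y, |f y| ≤ 1) (h0 : ∀ y, y ∉ S → f y = 0) :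
    eLpNorm f (ENNReal.ofReal P) μ ≤ μ S ^ (1 / P) := by
  have h1 := eLpNorm_indicator_const (μ := μ) (c := (1:ℝ)) hS (p := ENNReal.ofReal P)
    (ENNReal.ofReal_pos.2 hP).ne' ENNReal.ofReal_ne_top
  rw [ENNReal.toReal_ofReal hP.le, enorm_one, one_mul] at h1
  rw [← h1]
  refine eLpNorm_mono fun y => ?_
  by_cases hy : y ∈ S
  · simpa [hy] using hf y
  · simp [hy, h0 y hy]

/-- In uniformly perfect spaces, every ball contains two disjoint balls of comparable radius. -/
theorem UniformlyPerfect.exists_disjoint_balls {X : Type*} {ρ : X → X → ℝ}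
    (hU : UniformlyPerfect ρ) (hρ : IsQuasiMetric ρ) :
    ∃ a : ℝ, 0 < a ∧ ∀ (x : X) (r : ℝ), 0 < r → ENNReal.ofReal r ≤ diam ρ →
      ∃ y, Disjoint (ball ρ x (a * r)) (ball ρ y (a * r)) ∧ ball ρ x (a * r) ⊆ ball ρ x r ∧
        ball ρ y (a * r) ⊆ ball ρ x r := by
  obtain ⟨C, hC, hsymm, hmax⟩ := hρ.exists_const
  obtain ⟨l, hl0, hl1, hU⟩ := hU
  have hC0 : 0 < C := by linarith
  have hCC : C * C * (1 / (2 * C ^ 2)) = 1 / 2 := by field_simp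
  -- The radius `c r` is so small that its ball is not all of `X`, as otherwise the diameter would
  -- be at most `r / 2`. Then `a` is chosen so that a common point of the two small balls would
  -- bring the centers closer than `l c r`.
  set c : ℝ := 1 / (2 * C ^ 2) with hc
  have hc0 : 0 < c := by positivity
  set a : ℝ := l * c / C ^ 2 with ha
  have ha0 : 0 < a := by positivity
  have haC : C * C * a = l * c := by rw [ha]; field_simp
  have ha2 : C * C * a ≤ 1 / 2 := by nlinarith [mul_pos hC0 hC0]
  have ha3 : C * a ≤ 1 / 2 := by nlinarith [mul_pos hC0 ha0]
  have hCc : C * c ≤ 1 / 2 := by nlinarith [mul_pos hC0 hc0]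
  refine ⟨a, ha0, fun x r hr hrd => ?_⟩
  have hne : ((ball ρ x (c * r))ᶜ).Nonempty := by
    by_contra hempty
    rw [not_nonempty_iff_eq_empty, compl_empty_iff] at hempty
    have hall : ∀ y, ρ x y < c * r := fun y => by
      have : y ∈ ball ρ x (c * r) := hempty ▸ mem_univ y
      exact this
    have hd : diam ρ ≤ ENNReal.ofReal (r / 2) := by
      refine iSup₂_le fun y z => ENNReal.ofReal_le_ofReal ((hmax y z x).trans ?_)
      have h1 : max (ρ y x) (ρ x z) ≤ C * (c * r) :=
        max_le ((hsymm x y).trans (mul_le_mul_of_nonneg_left (hall y).le hC0.le))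
          ((hall z).le.trans (le_mul_of_one_le_left (by positivity) hC))
      calc C * max (ρ y x) (ρ x z) ≤ C * (C * (c * r)) := mul_le_mul_of_nonneg_left h1 hC0.le
        _ = C * C * c * r := by ring
        _ = r / 2 := by rw [hCC]; ring
    have := (ENNReal.ofReal_le_ofReal_iff (by positivity)).1 (hrd.trans hd)
    linarith
  obtain ⟨y, hy1, hy2⟩ := hU x (c * r) (by positivity) hne
  have hy1' : ρ x y < c * r := hy1
  have hy2' : l * (c * r) ≤ ρ x y := not_lt.1 hy2
  refine ⟨y, ?_, ?_, ?_⟩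
  · rw [Set.disjoint_left]
    intro z (hz1 : ρ x z < a * r) (hz2 : ρ y z < a * r)
    have h1 : ρ z y < C * (a * r) := (hsymm y z).trans_lt (mul_lt_mul_of_pos_left hz2 hC0)
    have h2 : max (ρ x z) (ρ z y) < C * (a * r) :=
      max_lt (hz1.trans_le (le_mul_of_one_le_left (by positivity) hC)) h1
    have h3 := (hmax x y z).trans_lt (mul_lt_mul_of_pos_left h2 hC0)
    have h4 : C * (C * (a * r)) = l * (c * r) := by
      rw [← mul_assoc, ← mul_assoc, haC]; ring
    linarith
  · intro z (hz : ρ x z < a * r)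
    have : a * r ≤ r := by nlinarith
    exact hz.trans_le this
  · intro z (hz : ρ y z < a * r)
    refine (hmax x z y).trans_lt ?_
    rw [mul_max_of_nonneg _ _ hC0.le]
    refine max_lt ((mul_lt_mul_of_pos_left hy1' hC0).trans_le ?_)
      ((mul_lt_mul_of_pos_left hz hC0).trans_le ?_)
    · nlinarith
    · nlinarith

/-! ### Necessity of the lower bound on the measure -/

section Necessity

variable {X : Type*} [MeasurableSpace X] {ρ : X → X → ℝ} {μ : Measure X} {β K : ℝ}
  {F : X → X → ℝ} {s Q p : ℝ} {N : (X → ℝ) → ℝ≥0∞}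

/-- The inequality is applied to each level bump: the left side sees `S (j + 1)`, the right side
sees `S j`, and the exponents `1/p* < 1/p` give the gain for the iteration. -/
theorem SobolevIneq.lowerAhlfors (hI : SobolevIneq ρ μ s Q p N) (hX : IsQuasiMetricMeasure ρ μ)
    (hs : 0 < s) (hQ : 0 < Q) (hp : p ∈ Ioo 0 (Q / s)) (hβ : 0 < β)
    (hF : IsRegularization ρ β K F) (hN : BumpBound ρ μ s β p N) : LowerAhlfors ρ μ Q := by
  obtain ⟨C, hC, hI⟩ := hI
  obtain ⟨C₂, Λ, hC₂, hΛ, hb⟩ := hN.exists_levelBump_le hs hp.1 hF hX hβ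
  have hp' := sobExp_pos hs hp
  obtain ⟨ε, hε, H⟩ := exists_measure_lower_of_iteration (C := C * (C₂ + 1)) (Λ := Λ)
    (one_div_pos.2 hp') hQ hs (one_div_sobExp hs hp) (by positivity) hΛ
  refine ⟨ε, hε, fun x r hr hrd => ?_⟩
  -- The levels decrease to `r^β / (2K)`, so the sublevel set at the limit is contained in all the
  -- others and its positive measure serves as `δ`.
  refine (H (fun j => μ (sublevel F β K r x j)) r (μ {y | F x y < r ^ β / (2 * K)}) hr
    (hF.measure_pos hX hβ x (by have := hF.pos; positivity))
    (fun j => measure_mono fun y hy => lt_trans hy (lt_level hF.pos hr j))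
    (fun j => measure_sublevel_lt_top hF hX hβ hr x j) fun j => ?_).trans
    (measure_mono (sublevel_subset_ball hF hβ hr x 0))
  have hu1 : eLpNorm (levelBump F β K r x j) (ENNReal.ofReal p) μ ≤
      μ (sublevel F β K r x j) ^ (1 / p) :=
    eLpNorm_le_of_le hp.1 (measurableSet_sublevel hF hX hβ r x j)
      (fun y => (abs_of_nonneg (bump_nonneg y)).trans_le (bump_le_one y))
      (fun y hy => levelBump_eq_zero hF.pos hr hy)
  have hu2 : μ (sublevel F β K r x (j + 1)) ^ (1 / sobExp s Q p) ≤
      eLpNorm (levelBump F β K r x j) (ENNReal.ofReal (sobExp s Q p)) μ := by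
    have := le_eLpNorm_of_le (μ := μ) hp' (measurableSet_sublevel hF hX hβ r x (j + 1))
      (f := levelBump F β K r x j) zero_le_one
      (fun y hy => by rw [levelBump_eq_one hF.pos hr hy, abs_one])
    simpa using this
  have hfin := ENNReal.rpow_lt_top_of_nonneg (one_div_nonneg.2 hp.1.le)
    (measure_sublevel_lt_top hF hX hβ hr x j).ne
  -- Since `r ≤ diam ρ`, the `L^p` term has at most the size of the semi-norm term.
  have hdiam : ENNReal.ofReal C / diam ρ ^ s ≤ ENNReal.ofReal (C * Λ ^ j * r ^ (-s)) := by
    rw [div_eq_mul_inv, mul_assoc, ENNReal.ofReal_mul hC.le]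
    refine mul_le_mul' le_rfl ?_
    rw [ENNReal.ofReal_mul (by positivity), Real.rpow_neg hr.le,
      ENNReal.ofReal_inv_of_pos (by positivity), ← ENNReal.ofReal_rpow_of_pos hr]
    have h1 : (1 : ℝ≥0∞) ≤ ENNReal.ofReal (Λ ^ j) := ENNReal.one_le_ofReal.2 (one_le_pow₀ hΛ)
    refine le_trans ?_ (le_mul_of_one_le_left zero_le h1)
    exact ENNReal.inv_le_inv.2 (ENNReal.rpow_le_rpow hrd hs.le)
  refine hu2.trans ((hI _ (hb x r hr j).1 (hu1.trans_lt hfin)).trans ?_)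
  refine (add_le_add (mul_le_mul' le_rfl (hb x r hr j).2) (mul_le_mul' hdiam hu1)).trans_eq ?_
  rw [← mul_assoc, ← add_mul, ← ENNReal.ofReal_mul hC.le, ← ENNReal.ofReal_add (by positivity)
    (by positivity)]
  congr 2
  ring

/-- In uniformly perfect spaces, every ball contains two disjoint sublevel sets, which we may
arrange by their measures. -/
theorem exists_sublevel_pair (hU : UniformlyPerfect ρ) (hρ : IsQuasiMetric ρ) (μ : Measure X)
    (hβ : 0 < β) (hF : IsRegularization ρ β K F) :
    ∃ a : ℝ, 0 < a ∧ ∀ (x : X) (r : ℝ), 0 < r → ENNReal.ofReal r ≤ diam ρ →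
      ∃ z w, Disjoint (sublevel F β K (a * r) z 0) (sublevel F β K (a * r) w 0) ∧
        sublevel F β K (a * r) z 0 ⊆ ball ρ x r ∧ sublevel F β K (a * r) w 0 ⊆ ball ρ x r ∧
        μ (sublevel F β K (a * r) z 0) ≤ μ (sublevel F β K (a * r) w 0) := by
  obtain ⟨a, ha, hpair⟩ := hU.exists_disjoint_balls hρ
  refine ⟨a, ha, fun x r hr hrd => ?_⟩
  obtain ⟨y, hdis, hx, hy⟩ := hpair x r hr hrd
  have hsx := sublevel_subset_ball hF hβ (mul_pos ha hr) x 0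
  have hsy := sublevel_subset_ball hF hβ (mul_pos ha hr) y 0
  rcases le_total (μ (sublevel F β K (a * r) x 0)) (μ (sublevel F β K (a * r) y 0)) with h | h
  · exact ⟨x, y, hdis.mono hsx hsy, hsx.trans hx, hsy.trans hy, h⟩
  · exact ⟨y, x, (hdis.mono hsx hsy).symm, hsy.trans hy, hsx.trans hx, h⟩

/-- A bump function around `z` is far from any given constant on a large set. -/
theorem exists_far_from_const (hK : 0 < K) {r : ℝ} (hr : 0 < r) {z w : X}
    (hdis : Disjoint (sublevel F β K r z 0) (sublevel F β K r w 0))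
    (hμ : μ (sublevel F β K r z 0) ≤ μ (sublevel F β K r w 0)) (j : ℕ) (γ : ℝ) :
    ∃ S, (S = sublevel F β K r z (j + 1) ∨ S = sublevel F β K r w 0) ∧
      μ (sublevel F β K r z (j + 1)) ≤ μ S ∧ ∀ y ∈ S, 1 / 2 ≤ |levelBump F β K r z j y - γ| := by
  rcases le_or_gt γ (1 / 2) with h | h
  · refine ⟨_, Or.inl rfl, le_rfl, fun y hy => ?_⟩
    rw [levelBump_eq_one hK hr hy]
    exact le_trans (by linarith) (le_abs_self _)
  · refine ⟨_, Or.inr rfl, (measure_mono (sublevel_subset_zero hK hr z _)).trans hμ, fun y hy => ?_⟩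
    rw [levelBump_eq_zero hK hr fun hy' =>
      Set.disjoint_left.1 hdis (sublevel_subset_zero hK hr z j hy') hy]
    rw [abs_sub_comm]
    exact le_trans (by linarith) (le_abs_self _)

/-- Subtracting `γ` can be harmless on `S (j + 1)` or on a disjoint set where the bump vanishes, but
not on both. Centering the bump in the set of smaller measure makes either case bound `μ (S (j +
1))`. -/
theorem PoincareIneq.lowerAhlfors (hI : PoincareIneq μ s Q p N) (hX : IsQuasiMetricMeasure ρ μ)
    (hs : 0 < s) (hQ : 0 < Q) (hp : p ∈ Ioo 0 (Q / s)) (hβ : 0 < β)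
    (hF : IsRegularization ρ β K F) (hN : BumpBound ρ μ s β p N) (hU : UniformlyPerfect ρ) :
    LowerAhlfors ρ μ Q := by
  obtain ⟨C, hC, hI⟩ := hI
  obtain ⟨C₂, Λ, hC₂, hΛ, hb⟩ := hN.exists_levelBump_le hs hp.1 hF hX hβ
  obtain ⟨a, ha, hpair⟩ := exists_sublevel_pair hU hX.quasiMetric μ hβ hF
  have hp' := sobExp_pos hs hp
  obtain ⟨ε, hε, H⟩ := exists_measure_lower_of_iteration (C := 2 * (C * C₂)) (Λ := Λ)
    (one_div_pos.2 hp') hQ hs (one_div_sobExp hs hp) (by positivity) hΛ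
  refine ⟨ε * a ^ Q, by positivity, fun x r hr hrd => ?_⟩
  obtain ⟨z, w, hdis, hz, -, hμ⟩ := hpair x r hr hrd
  have har : 0 < a * r := mul_pos ha hr
  rw [mul_assoc, ← Real.mul_rpow ha.le hr.le]
  refine (H (fun j => μ (sublevel F β K (a * r) z j)) (a * r)
    (μ {y | F z y < (a * r) ^ β / (2 * K)}) har
    (hF.measure_pos hX hβ z (by have := hF.pos; positivity))
    (fun j => measure_mono fun y hy => lt_trans hy (lt_level hF.pos har j))
    (fun j => measure_sublevel_lt_top hF hX hβ har z j) fun j => ?_).trans (measure_mono hz)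
  have h1 : ENNReal.ofReal (1 / 2) * μ (sublevel F β K (a * r) z (j + 1)) ^ (1 / sobExp s Q p) ≤
      ⨅ γ : ℝ, eLpNorm (fun y => levelBump F β K (a * r) z j y - γ)
        (ENNReal.ofReal (sobExp s Q p)) μ := by
    refine le_iInf fun γ => ?_
    obtain ⟨S, hS, hμS, hfar⟩ := exists_far_from_const hF.pos har hdis hμ j γ
    have hSm : MeasurableSet S := by
      rcases hS with rfl | rfl <;> exact measurableSet_sublevel hF hX hβ _ _ _
    refine le_trans ?_ (le_eLpNorm_of_le hp' hSm (by norm_num) hfar)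
    exact mul_le_mul' le_rfl (ENNReal.rpow_le_rpow hμS (by positivity))
  have h2 := h1.trans ((hI _ (hb z _ har j).1).trans (mul_le_mul' le_rfl (hb z _ har j).2))
  have h3 := mul_le_mul' (le_refl (ENNReal.ofReal 2)) h2
  rw [← mul_assoc, ← ENNReal.ofReal_mul zero_le_two, ← mul_assoc, ← mul_assoc,
    ← ENNReal.ofReal_mul zero_le_two, ← ENNReal.ofReal_mul (by positivity)] at h3
  rw [show (2:ℝ) * (1 / 2) = 1 by norm_num, ENNReal.ofReal_one, one_mul] at h3
  refine h3.trans_eq ?_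
  congr 2
  rw [Real.rpow_neg har.le]
  ring

/-- Only polynomial information is extracted from exponential integrability, whatever the exponent
`ω`; it comes from `t ≤ exp t` at `t = v^ω / (e/ω)`. -/
theorem rpow_le_mul_exp {v e ω : ℝ} (hv : 0 < v) (he : 0 < e) (hω : 0 < ω) :
    v ^ e ≤ (e / ω) ^ (e / ω) * Real.exp (v ^ ω) := by
  have hb : 0 < e / ω := div_pos he hω
  have hX : 0 < v ^ ω := by positivity
  have h1 : v ^ ω / (e / ω) ≤ Real.exp (v ^ ω / (e / ω)) :=
    (by linarith : v ^ ω / (e / ω) ≤ v ^ ω / (e / ω) + 1).trans (Real.add_one_le_exp _)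
  have h2 := Real.rpow_le_rpow (by positivity) h1 hb.le
  rw [← Real.exp_mul, div_mul_cancel₀ _ hb.ne', Real.div_rpow hX.le hb.le, ← Real.rpow_mul hv.le,
    mul_div_cancel₀ _ hω.ne', div_le_iff₀ (by positivity)] at h2
  rwa [mul_comm]

/-- Assuming that the ball has measure far below `r^Q`, the average may be replaced by an integral
bounded by `c₂ r^Q`. The set where the bump is far from its mean then satisfies `μ (S (j+1)) ≤ C r^Q
N^e`, and `N` is of order `Λ^j r^(-s) μ (S j)^(s/Q)`. -/
theorem ExpIntegrability.lowerAhlfors (hI : ExpIntegrability ρ μ N)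
    (hX : IsQuasiMetricMeasure ρ μ) (hs : 0 < s) (hQ : 0 < Q) (hβ : 0 < β)
    (hF : IsRegularization ρ β K F) (hN : BumpBound ρ μ s β (Q / s) N)
    (hH : HajlaszDominated ρ μ s (Q / s) N) (hU : UniformlyPerfect ρ) :
    LowerAhlfors ρ μ Q := by
  obtain ⟨c₁, c₂, ω, hc₁, hc₂, hω, hI⟩ := hI
  have hp : 0 < Q / s := by positivity
  obtain ⟨C₂, Λ, hC₂, hΛ, hb⟩ := hN.exists_levelBump_le hs hp hF hX hβ
  obtain ⟨a, ha, hpair⟩ := exists_sublevel_pair hU hX.quasiMetric μ hβ hF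
  -- With this power, `N^e` contributes the square of `μ (S j)`, so the iteration runs with the
  -- exponents `1 < 2`. Any power above `Q / s` would give a gain.
  set e : ℝ := 2 * Q / s with he
  have he0 : 0 < e := by positivity
  set M : ℝ := (e / ω) ^ (e / ω) * c₂ * a ^ (-Q) * (2 * C₂ / c₁) ^ e with hM
  have hM0 : 0 < M := by positivity
  obtain ⟨ε, hε, H⟩ := exists_le_of_iteration (K := M) (Λ := Λ ^ e) one_pos one_lt_two
    hM0 (Real.one_le_rpow hΛ he0.le)
  -- The entry `1` gives `μ B ≤ r^Q`, used inside the iteration; the entry with the factor `1 / 2`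
  -- contradicts its conclusion.
  refine ⟨min 1 (ε * a ^ Q / 2), by positivity, fun x r hr hrd => ?_⟩
  by_contra! hlt
  have hrQ : 0 < r ^ Q := by positivity
  have hB1 : μ (ball ρ x r) ≤ ENNReal.ofReal (r ^ Q) := hlt.le.trans
    (ENNReal.ofReal_le_ofReal (mul_le_of_le_one_left hrQ.le (min_le_left _ _)))
  have hB2 : μ (ball ρ x r) ≤ ENNReal.ofReal (ε * a ^ Q / 2 * r ^ Q) := hlt.le.trans
    (ENNReal.ofReal_le_ofReal (mul_le_mul_of_nonneg_right (min_le_right _ _) hrQ.le))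
  obtain ⟨z, w, hdis, hz, hw, hμ⟩ := hpair x r hr hrd
  have har : 0 < a * r := mul_pos ha hr
  have harQ : 0 < (a * r) ^ Q := by positivity
  set m : ℕ → ℝ := fun j => (μ (sublevel F β K (a * r) z j)).toReal with hm
  have hfin := fun j => measure_sublevel_lt_top hF hX hβ har z j
  have hmpos : ∀ j, 0 < m j := fun j =>
    ENNReal.toReal_pos (measure_sublevel_pos hF hX hβ har z j).ne' (hfin j).ne
  have hδ := hF.measure_pos hX hβ z (t := (a * r) ^ β / (2 * K)) (by have := hF.pos; positivity)
  have hδm : ∀ j, μ {y | F z y < (a * r) ^ β / (2 * K)} ≤ μ (sublevel F β K (a * r) z j) :=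
    fun j => measure_mono fun y hy => lt_trans hy (lt_level hF.pos har j)
  have hstep : ∀ j, m (j + 1) / (a * r) ^ Q ≤ M * (Λ ^ e) ^ j * (m j / (a * r) ^ Q) ^ (2:ℝ) := by
    intro j
    set u := levelBump F β K (a * r) z j with hu
    obtain ⟨hmem, hle⟩ := hb z _ har j
    have hone : ∀ y ∈ sublevel F β K (a * r) z (j + 1), u y = 1 :=
      fun y hy => levelBump_eq_one hF.pos har hy
    have hzero : ∀ y ∈ sublevel F β K (a * r) w 0, u y = 0 := fun y hy =>
      levelBump_eq_zero hF.pos har fun hy' =>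
        Set.disjoint_left.1 hdis (sublevel_subset_zero hF.pos har z j hy') hy
    have hnc : ¬ ∃ c : ℝ, ∀ᵐ y ∂μ, u y = c := by
      rintro ⟨c, hc⟩
      obtain ⟨y, hy1, hy2⟩ := Measure.exists_mem_of_measure_ne_zero_of_ae
        (measure_sublevel_pos hF hX hβ har z (j + 1)).ne' (ae_restrict_of_ae hc)
      obtain ⟨y', hy1', hy2'⟩ := Measure.exists_mem_of_measure_ne_zero_of_ae
        (measure_sublevel_pos hF hX hβ har w 0).ne' (ae_restrict_of_ae hc)
      rw [hone y hy1] at hy2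
      rw [hzero y' hy1'] at hy2'
      linarith
    have : Nonempty X := ⟨x⟩
    have hN0 : N u ≠ 0 := fun h => hnc (hH.exists_ae_eq_const hp h)
    have hNpos : 0 < (N u).toReal := ENNReal.toReal_pos hN0 hmem.2.ne
    set n : ℝ := C₂ * Λ ^ j * (a * r) ^ (-s) * m j ^ (1 / (Q / s)) with hn
    have hn0 : 0 < n := by have := hmpos j; positivity
    have hNn : (N u).toReal ≤ n := by
      have h1 := ENNReal.toReal_mono (ENNReal.mul_ne_top ENNReal.ofReal_ne_top
        (ENNReal.rpow_ne_top_of_nonneg (by positivity) (hfin j).ne)) hle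
      rwa [ENNReal.toReal_mul, ENNReal.toReal_ofReal (by positivity), ← ENNReal.toReal_rpow] at h1
    have hint := (hI x r hr hrd u hmem hnc).2
    set γ : ℝ := ⨍ y in ball ρ x r, u y ∂μ with hγ
    obtain ⟨S, hS, hμS, hfar⟩ := exists_far_from_const hF.pos har hdis hμ j γ
    have hSB : S ⊆ ball ρ x r := by
      rcases hS with rfl | rfl
      · exact (sublevel_subset_zero hF.pos har z _).trans hz
      · exact hw
    have hSm : MeasurableSet S := by
      rcases hS with rfl | rfl <;> exact measurableSet_sublevel hF hX hβ _ _ _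
    rw [setLAverage_eq, ENNReal.div_le_iff (hX.ball_pos x r hr).ne' (hX.ball_lt_top x r hr).ne]
      at hint
    have hexp : ENNReal.ofReal (Real.exp ((c₁ / (2 * n)) ^ ω)) *
        μ (sublevel F β K (a * r) z (j + 1)) ≤ ENNReal.ofReal (c₂ * r ^ Q) := by
      calc _ ≤ ENNReal.ofReal (Real.exp ((c₁ / (2 * n)) ^ ω)) * μ S := mul_le_mul' le_rfl hμS
        _ = ∫⁻ _ in S, ENNReal.ofReal (Real.exp ((c₁ / (2 * n)) ^ ω)) ∂μ := by
            rw [setLIntegral_const]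
        _ ≤ ∫⁻ y in S, ENNReal.ofReal (Real.exp
              ((c₁ * (|u y - γ| / (N u).toReal)) ^ ω)) ∂μ := by
            refine setLIntegral_mono' hSm fun y hy => ENNReal.ofReal_le_ofReal
              (Real.exp_le_exp.2 (Real.rpow_le_rpow (by positivity) ?_ hω.le))
            rw [div_eq_mul_inv]
            refine mul_le_mul_of_nonneg_left ?_ hc₁.le
            rw [mul_inv, ← one_div 2, ← div_eq_mul_inv]
            exact div_le_div₀ (abs_nonneg _) (hfar y hy) hNpos hNn
        _ ≤ _ := lintegral_mono_set hSB
        _ ≤ _ := hint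
        _ ≤ ENNReal.ofReal c₂ * ENNReal.ofReal (r ^ Q) := mul_le_mul' le_rfl hB1
        _ = _ := (ENNReal.ofReal_mul hc₂.le).symm
    have hexp' : Real.exp ((c₁ / (2 * n)) ^ ω) * m (j + 1) ≤ c₂ * r ^ Q := by
      have h1 := ENNReal.toReal_mono ENNReal.ofReal_ne_top hexp
      rwa [ENNReal.toReal_mul, ENNReal.toReal_ofReal (by positivity),
        ENNReal.toReal_ofReal (by positivity)] at h1
    have hpow := rpow_le_mul_exp (v := c₁ / (2 * n)) (by positivity) he0 hω
    have h1 : (c₁ / (2 * n)) ^ e * m (j + 1) ≤ (e / ω) ^ (e / ω) * (c₂ * r ^ Q) := by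
      refine (mul_le_mul_of_nonneg_right hpow (hmpos _).le).trans ?_
      rw [mul_assoc]
      exact mul_le_mul_of_nonneg_left hexp' (by positivity)
    have h2 : m (j + 1) ≤ (e / ω) ^ (e / ω) * (c₂ * r ^ Q) * (2 * n / c₁) ^ e := by
      have h3 : (c₁ / (2 * n)) ^ e = ((2 * n / c₁) ^ e)⁻¹ := by
        rw [← Real.inv_rpow (by positivity), inv_div]
      rw [h3, inv_mul_le_iff₀ (by positivity)] at h1
      linarith
    have hme : (m j ^ (1 / (Q / s))) ^ e = m j ^ (2:ℝ) := by
      rw [← Real.rpow_mul (hmpos j).le, he]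
      congr 1
      field_simp
    have hre : ((a * r) ^ (-s)) ^ e = ((a * r) ^ Q)⁻¹ * ((a * r) ^ Q)⁻¹ := by
      rw [← Real.rpow_mul har.le, ← Real.rpow_neg har.le, ← Real.rpow_add har, he]
      congr 1
      field_simp
      ring
    have hne : (2 * n / c₁) ^ e = (2 * C₂ / c₁) ^ e * (Λ ^ e) ^ j *
        (((a * r) ^ Q)⁻¹ * ((a * r) ^ Q)⁻¹) * m j ^ (2:ℝ) := by
      rw [← hme, ← hre, ← Real.rpow_natCast (Λ ^ e), ← Real.rpow_mul (by linarith), mul_comm e,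
        Real.rpow_mul (by linarith), Real.rpow_natCast]
      have := hmpos j
      rw [← Real.mul_rpow (by positivity) (by positivity),
        ← Real.mul_rpow (by positivity) (by positivity),
        ← Real.mul_rpow (by positivity) (by positivity), hn]
      congr 1
      ring
    rw [div_le_iff₀ harQ]
    refine h2.trans_eq ?_
    rw [hne, Real.div_rpow (hmpos j).le harQ.le, hM, Real.mul_rpow ha.le hr.le,
      Real.rpow_neg ha.le, Real.rpow_two (a ^ Q * r ^ Q)]
    field_simp
  have hfinal := H (fun j => m j / (a * r) ^ Q)
    ((μ {y | F z y < (a * r) ^ β / (2 * K)}).toReal / (a * r) ^ Q)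
    (div_pos (ENNReal.toReal_pos hδ.ne' ((hδm 0).trans_lt (hfin 0)).ne) harQ)
    (fun j => div_le_div_of_nonneg_right (ENNReal.toReal_mono (hfin j).ne (hδm j)) harQ.le)
    (fun j => by simpa only [Real.rpow_one] using hstep j)
  rw [le_div_iff₀ harQ, Real.mul_rpow ha.le hr.le] at hfinal
  have h1 : m 0 ≤ ε * a ^ Q / 2 * r ^ Q :=
    ENNReal.toReal_le_of_le_ofReal (by positivity) ((measure_mono hz).trans hB2)
  have h2 : 0 < ε * (a ^ Q * r ^ Q) := by positivity
  linarith

/-- No iteration is needed: one bump climbs from `0` to `1` within distance comparable to `r`, so `1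
≤ C r^(s - Q/p) r^(-s) μ(B)^(1/p)`. -/
theorem HolderCond.lowerAhlfors (hI : HolderCond ρ μ s Q p N) (hX : IsQuasiMetricMeasure ρ μ)
    (hs : 0 < s) (hQ : 0 < Q) (hp : p ∈ Ioi (Q / s)) (hβ : 0 < β)
    (hF : IsRegularization ρ β K F) (hN : BumpBound ρ μ s β p N) (hU : UniformlyPerfect ρ) :
    LowerAhlfors ρ μ Q := by
  obtain ⟨C, hC, hI⟩ := hI
  have hp0 : 0 < p := lt_trans (by positivity) hp
  have hα : 0 < s - Q / p := by
    have : Q / s < p := hp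
    rw [div_lt_iff₀ hs] at this
    rw [sub_pos, div_lt_iff₀ hp0]
    linarith
  obtain ⟨C₂, Λ, hC₂, hΛ, hb⟩ := hN.exists_levelBump_le hs hp0 hF hX hβ
  obtain ⟨a, ha, hpair⟩ := exists_sublevel_pair hU hX.quasiMetric μ hβ hF
  obtain ⟨D, hD, hsymm, hmax⟩ := hX.quasiMetric.exists_const
  have hD0 : 0 < D := by linarith
  set M : ℝ := C * (D * D) ^ (s - Q / p) * (C₂ * a ^ (-s)) with hM
  have hM0 : 0 < M := by positivity
  refine ⟨(M ^ p)⁻¹, by positivity, fun x r hr hrd => ?_⟩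
  obtain ⟨z, w, hdis, hz, hw, hμ⟩ := hpair x r hr hrd
  have har : 0 < a * r := mul_pos ha hr
  set u := levelBump F β K (a * r) z 0 with hu
  obtain ⟨hmem, hle⟩ := hb z _ har 0
  obtain ⟨v, huv, hv⟩ := hI u hmem
  -- The Hölder function agrees with the bump only almost everywhere, so its values `1` and `0` are
  -- found on sets of positive measure.
  obtain ⟨y, hy1, hy2⟩ := Measure.exists_mem_of_measure_ne_zero_of_ae
    (measure_sublevel_pos hF hX hβ har z 1).ne' (ae_restrict_of_ae huv)
  obtain ⟨y', hy1', hy2'⟩ := Measure.exists_mem_of_measure_ne_zero_of_ae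
    (measure_sublevel_pos hF hX hβ har w 0).ne' (ae_restrict_of_ae huv)
  have hv1 : v y = 1 := by rw [← hy2]; exact levelBump_eq_one hF.pos har hy1
  have hv0 : v y' = 0 := by
    rw [← hy2']
    exact levelBump_eq_zero hF.pos har fun hy' => Set.disjoint_left.1 hdis hy' hy1'
  have hyB : ρ x y < r := hz (sublevel_subset_zero hF.pos har z 1 hy1)
  have hyB' : ρ x y' < r := hw hy1'
  have hρ : ρ y y' ≤ D * D * r := by
    refine (hmax y y' x).trans ?_
    rw [mul_assoc]
    refine mul_le_mul_of_nonneg_left (max_le ((hsymm x y).trans ?_) (hyB'.le.trans ?_)) hD0.le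
    · exact mul_le_mul_of_nonneg_left hyB.le hD0.le
    · exact le_mul_of_one_le_left hr.le hD
  have h1 := hv y y'
  rw [hv1, hv0, sub_zero, abs_one] at h1
  set m := (μ (ball ρ x r)).toReal with hm
  have hm0 : 0 ≤ m := ENNReal.toReal_nonneg
  have hNn : (N u).toReal ≤ C₂ * (a * r) ^ (-s) * m ^ (1 / p) := by
    have h2 := ENNReal.toReal_mono (ENNReal.mul_ne_top ENNReal.ofReal_ne_top
      (ENNReal.rpow_ne_top_of_nonneg (by positivity) (hX.ball_lt_top x r hr).ne))
      (hle.trans (mul_le_mul' le_rfl (ENNReal.rpow_le_rpow (measure_mono hz)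
        (one_div_nonneg.2 hp0.le))))
    rw [ENNReal.toReal_mul, ENNReal.toReal_ofReal (by positivity), ← ENNReal.toReal_rpow] at h2
    simpa using h2
  have h2 : 1 ≤ M * r ^ (-(Q / p)) * m ^ (1 / p) := by
    refine h1.trans ?_
    have h3 : ρ y y' ^ (s - Q / p) ≤ (D * D) ^ (s - Q / p) * r ^ (s - Q / p) := by
      rw [← Real.mul_rpow (by positivity) hr.le]
      exact Real.rpow_le_rpow (hX.quasiMetric.nonneg _ _) hρ hα.le
    calc C * ρ y y' ^ (s - Q / p) * (N u).toReal ≤ C * ((D * D) ^ (s - Q / p) * r ^ (s - Q / p)) *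
          (C₂ * (a * r) ^ (-s) * m ^ (1 / p)) := by
          refine mul_le_mul (mul_le_mul_of_nonneg_left h3 hC.le) hNn ENNReal.toReal_nonneg
            (by positivity)
      _ = M * (r ^ (s - Q / p) * r ^ (-s)) * m ^ (1 / p) := by
          rw [Real.mul_rpow ha.le hr.le, hM]; ring
      _ = _ := by
          rw [← Real.rpow_add hr]
          congr 3
          ring
  have h3 := Real.rpow_le_rpow zero_le_one h2 hp0.le
  rw [Real.one_rpow, Real.mul_rpow (by positivity) (by positivity), Real.mul_rpow hM0.le
    (by positivity), ← Real.rpow_mul hr.le, ← Real.rpow_mul hm0, one_div_mul_cancel hp0.ne',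
    Real.rpow_one, neg_mul, div_mul_cancel₀ _ hp0.ne', Real.rpow_neg hr.le] at h3
  refine ENNReal.ofReal_le_of_le_toReal ?_
  rw [inv_mul_le_iff₀ (by positivity)]
  have h4 : M ^ p * (r ^ Q)⁻¹ * m = M ^ p * m / r ^ Q := by ring
  rw [h4, one_le_div (by positivity)] at h3
  exact h3

end Necessity

/-! ### The telescoping argument -/

section Chain

variable {X : Type*} [MeasurableSpace X] {ρ : X → X → ℝ} {μ : Measure X} {s Q p : ℝ}

/-- A ball whose measure is large meets the sublevel set of an `L^p` function. -/
theorem exists_mem_ball_le {h : X → ℝ≥0} {E : Set X} {A t : ℝ} (hp : 0 < p) (hA : 0 < A)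
    (ht : 0 < t) (hh : AEMeasurable h μ) (hE : μ E = 0)
    (hint : ∫⁻ x, (h x : ℝ≥0∞) ^ p ∂μ ≤ ENNReal.ofReal A ^ p) {B : Set X}
    (hB : ENNReal.ofReal (A ^ p / t ^ p) < μ B) : ∃ y ∈ B, y ∉ E ∧ (h y : ℝ) ≤ t := by
  by_contra! hcon
  have hsub : B ⊆ E ∪ {x | ENNReal.ofReal (t ^ p) ≤ (h x : ℝ≥0∞) ^ p} := by
    intro y hy
    by_cases hyE : y ∈ E
    · exact Or.inl hyE
    · refine Or.inr ?_
      have h1 := (hcon y hy hyE).le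
      simp only [mem_ofPred_eq]
      rw [← ENNReal.ofReal_rpow_of_pos ht, ← ENNReal.ofReal_coe_nnreal]
      exact ENNReal.rpow_le_rpow (ENNReal.ofReal_le_ofReal h1) hp.le
  have h1 : μ B ≤ μ {x | ENNReal.ofReal (t ^ p) ≤ (h x : ℝ≥0∞) ^ p} :=
    (measure_mono hsub).trans ((measure_union_le _ _).trans_eq (by rw [hE, zero_add]))
  have h2 := mul_meas_ge_le_lintegral₀ (hh.coe_nnreal_ennreal.pow_const p) (ENNReal.ofReal (t ^ p))
  have h3 := (mul_le_mul' (le_refl (ENNReal.ofReal (t ^ p))) h1).trans (h2.trans hint)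
  rw [ENNReal.ofReal_rpow_of_pos hA] at h3
  have htp : 0 < t ^ p := by positivity
  have h4 : μ B ≤ ENNReal.ofReal (A ^ p / t ^ p) := by
    rw [ENNReal.ofReal_div_of_pos htp, ENNReal.le_div_iff_mul_le
      (Or.inl (ENNReal.ofReal_pos.2 htp).ne') (Or.inl ENNReal.ofReal_ne_top), mul_comm]
    exact h3
  exact absurd hB (not_lt.2 h4)

/-- The telescoping chain: from a point at which the gradient is at most `t * M ^ (k + d)` one
reaches a nearby point at which the gradient is at most `t * M ^ k`. -/
theorem exists_chain (hρ : IsQuasiMetric ρ) {C κ M η : ℝ} (hC : 1 ≤ C)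
    (hmax : ∀ x y z, ρ x y ≤ C * max (ρ x z) (ρ z y)) (hκ : 0 < κ)
    (hlow : ∀ (x : X) (r : ℝ), 0 < r → ENNReal.ofReal r ≤ diam ρ →
      ENNReal.ofReal (κ * r ^ Q) ≤ μ (ball ρ x r))
    (hs : 0 < s) (hp : 0 < p) (hM : 1 < M) (hη : 0 < η) (hCη : C * η ≤ 1)
    (hηM : η ^ Q * M ^ p = 1)
    {u : X → ℝ} {h : X → ℝ≥0} {E : Set X} {A t r₀ : ℝ} (hA : 0 < A) (ht : 0 < t) (hr₀ : 0 < r₀)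
    (hr₀d : ENNReal.ofReal r₀ ≤ diam ρ) (hAt : A ^ p < κ * r₀ ^ Q * t ^ p)
    (hh : AEMeasurable h μ) (hE : μ E = 0)
    (hgrad : ∀ x y, x ∉ E → y ∉ E → |u x - u y| ≤ ρ x y ^ s * ((h x : ℝ) + h y))
    (hint : ∫⁻ x, (h x : ℝ≥0∞) ^ p ∂μ ≤ ENNReal.ofReal A ^ p) {x : X} (hx : x ∉ E) (d : ℕ) :
    ∀ k : ℕ, (h x : ℝ) ≤ t * M ^ (k + d) → ∃ y, y ∉ E ∧ (h y : ℝ) ≤ t * M ^ k ∧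
      ρ x y ≤ C * (r₀ * η ^ k) ∧
      |u x - u y| ≤ 2 * M * t * r₀ ^ s * ∑ j ∈ Finset.range d, (M * η ^ s) ^ (k + j) := by
  have hC0 : 0 < C := by linarith
  have hM0 : 0 < M := by linarith
  have hη1 : η ≤ 1 := by nlinarith
  induction d with
  | zero =>
    intro k hk
    exact ⟨x, hx, by simpa using hk, by rw [hρ.self]; positivity, by simp⟩
  | succ d ih =>
    intro k hk
    -- The induction hypothesis handles all steps down to level `k + 1`; one more jump, in the ball
    -- of radius `r₀ η^k`, reaches level `k`.
    obtain ⟨y, hyE, hy1, hy2, hy3⟩ := ih (k + 1) (by rwa [add_right_comm])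
    have hrk : 0 < r₀ * η ^ k := by positivity
    have hrk' : r₀ * η ^ k ≤ r₀ := mul_le_of_le_one_right hr₀.le (pow_le_one₀ hη.le hη1)
    have hball : ENNReal.ofReal (A ^ p / (t * M ^ k) ^ p) < μ (ball ρ y (r₀ * η ^ k)) := by
      refine lt_of_lt_of_le ?_ (hlow y _ hrk ((ENNReal.ofReal_le_ofReal hrk').trans hr₀d))
      refine (ENNReal.ofReal_lt_ofReal_iff (by positivity)).2 ?_
      rw [div_lt_iff₀ (by positivity)]
      refine hAt.trans_eq ?_
      -- The radii are matched to the levels: the lower bound for the ball and the Chebyshev bound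
      -- scale in the same way, so `hAt` suffices for every `k`.
      have e1 : (η ^ k) ^ Q * (M ^ k) ^ p = 1 := by
        rw [← Real.rpow_natCast η, ← Real.rpow_natCast M, ← Real.rpow_mul hη.le,
          ← Real.rpow_mul hM0.le, mul_comm (k : ℝ) Q, mul_comm (k : ℝ) p, Real.rpow_mul hη.le,
          Real.rpow_mul hM0.le, ← Real.mul_rpow (by positivity) (by positivity), hηM, Real.one_rpow]
      rw [Real.mul_rpow hr₀.le (by positivity), Real.mul_rpow ht.le (by positivity)]
      calc κ * r₀ ^ Q * t ^ p = κ * r₀ ^ Q * t ^ p * ((η ^ k) ^ Q * (M ^ k) ^ p) := by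
            rw [e1, mul_one]
        _ = _ := by ring
    obtain ⟨z, hz1, hzE, hz2⟩ := exists_mem_ball_le hp hA (by positivity) hh hE hint hball
    have hyz : ρ y z < r₀ * η ^ k := hz1
    refine ⟨z, hzE, hz2, (hmax x z y).trans (mul_le_mul_of_nonneg_left (max_le (hy2.trans ?_)
      hyz.le) hC0.le), ?_⟩
    -- By `C η ≤ 1` the earlier jumps together cost no more than the last one, so quasi-metric
    -- constants do not accumulate along the chain.
    · calc C * (r₀ * η ^ (k + 1)) = C * η * (r₀ * η ^ k) := by rw [pow_succ]; ring
        _ ≤ 1 * (r₀ * η ^ k) := mul_le_mul_of_nonneg_right hCη hrk.le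
        _ = _ := one_mul _
    · have h1 : |u y - u z| ≤ 2 * M * t * r₀ ^ s * (M * η ^ s) ^ k := by
        have e1 : ρ y z ^ s ≤ r₀ ^ s * (η ^ s) ^ k := by
          refine (Real.rpow_le_rpow (hρ.nonneg _ _) hyz.le hs.le).trans_eq ?_
          rw [Real.mul_rpow hr₀.le (by positivity), ← Real.rpow_natCast, ← Real.rpow_mul hη.le,
            mul_comm (k : ℝ), Real.rpow_mul hη.le, Real.rpow_natCast]
        have e2 : (h y : ℝ) + h z ≤ 2 * M * t * M ^ k := by
          have : t * M ^ k ≤ M * (t * M ^ k) := le_mul_of_one_le_left (by positivity) hM.le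
          rw [pow_succ] at hy1
          linarith
        calc |u y - u z| ≤ ρ y z ^ s * ((h y : ℝ) + h z) := hgrad y z hyE hzE
          _ ≤ (r₀ ^ s * (η ^ s) ^ k) * (2 * M * t * M ^ k) :=
              mul_le_mul e1 e2 (by positivity) (by positivity)
          _ = _ := by rw [mul_pow]; ring
      rw [Finset.sum_range_succ', mul_add, add_zero]
      have h2 : ∑ j ∈ Finset.range d, (M * η ^ s) ^ (k + 1 + j) =
          ∑ j ∈ Finset.range d, (M * η ^ s) ^ (k + (j + 1)) :=
        Finset.sum_congr rfl fun j _ => by congr 1; omega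
      rw [h2] at hy3
      calc |u x - u z| ≤ |u x - u y| + |u y - u z| := abs_sub_le _ _ _
        _ ≤ _ := add_le_add hy3 h1

/-- On each ball, a function with a Hajłasz gradient in `L^p` is controlled by the levels of the
gradient. -/
theorem LowerAhlfors.exists_center (hX : IsQuasiMetricMeasure ρ μ) (hL : LowerAhlfors ρ μ Q)
    (hs : 0 < s) (hQ : 0 < Q) (hp : 0 < p) :
    ∃ M D b : ℝ, 1 < M ∧ 0 < D ∧ 0 < b ∧ ∀ (u : X → ℝ) (h : X → ℝ≥0) (E : Set X) (A : ℝ),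
      0 < A → AEMeasurable h μ → μ E = 0 →
      (∀ x y, x ∉ E → y ∉ E → |u x - u y| ≤ ρ x y ^ s * ((h x : ℝ) + h y)) →
      ∫⁻ x, (h x : ℝ≥0∞) ^ p ∂μ ≤ ENNReal.ofReal A ^ p →
      ∀ (x₀ : X) (r₀ : ℝ), 0 < r₀ → ENNReal.ofReal r₀ ≤ diam ρ →
      ∃ c : ℝ, ∀ x, x ∉ E → ρ x₀ x ≤ r₀ → ∀ n : ℕ, (h x : ℝ) ≤ b * A * r₀ ^ (-(Q / p)) * M ^ n →
        |u x - c| ≤ D * A * r₀ ^ (s - Q / p) *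
          (1 + ∑ j ∈ Finset.range n, (M ^ (1 - s * p / Q)) ^ j) := by
  have hρ := hX.quasiMetric
  obtain ⟨C, hC, hsymm, hmax⟩ := hρ.exists_const
  obtain ⟨κ, hκ, hlow⟩ := hL
  have hC0 : 0 < C := by linarith
  -- The choice `η = (1 + C)⁻¹` gives `C η ≤ 1`, and `M` is then dictated by `η^Q M^p = 1`.
  set M : ℝ := (1 + C) ^ (Q / p) with hM
  have hM1 : 1 < M := Real.one_lt_rpow (by linarith) (by positivity)
  have hM0 : 0 < M := by linarith
  set η : ℝ := (1 + C)⁻¹ with hη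
  have hη0 : 0 < η := by positivity
  have hCη : C * η ≤ 1 := by
    rw [hη, ← div_eq_mul_inv, div_le_one (by linarith)]
    linarith
  have hηM : η ^ Q * M ^ p = 1 := by
    rw [hM, ← Real.rpow_mul (by linarith), div_mul_cancel₀ _ hp.ne', hη,
      Real.inv_rpow (by linarith)]
    exact inv_mul_cancel₀ (by positivity)
  have hratio : M * η ^ s = M ^ (1 - s * p / Q) := by
    rw [Real.rpow_sub hM0, Real.rpow_one, div_eq_mul_inv]
    congr 1
    rw [hM, ← Real.rpow_mul (by linarith), hη, Real.inv_rpow (by linarith)]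
    congr 2
    field_simp
  -- The base level `t = b A r₀^(-Q/p)` satisfies `κ r₀^Q t^p = 2 A^p`, so the strict Chebyshev
  -- condition holds.
  set b : ℝ := (2 / κ) ^ (1 / p) with hb
  have hb0 : 0 < b := by positivity
  clear_value M η
  refine ⟨M, b * (2 * M + 2 * (C ^ 4) ^ s), b, hM1,
    mul_pos hb0 (add_pos (by linarith) (mul_pos two_pos (Real.rpow_pos_of_pos (pow_pos hC0 4) _))), hb0, ?_⟩
  intro u h E A hA hh hE hgrad hint x₀ r₀ hr₀ hr₀d
  set t : ℝ := b * A * r₀ ^ (-(Q / p)) with ht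
  have ht0 : 0 < t := by positivity
  have hAt : A ^ p < κ * r₀ ^ Q * t ^ p := by
    have : t ^ p = 2 / κ * A ^ p * (r₀ ^ Q)⁻¹ := by
      rw [ht, Real.mul_rpow (by positivity) (by positivity), Real.mul_rpow (by positivity) hA.le,
        hb, ← Real.rpow_mul (by positivity), one_div_mul_cancel hp.ne', Real.rpow_one,
        ← Real.rpow_mul hr₀.le, neg_mul, div_mul_cancel₀ _ hp.ne', Real.rpow_neg hr₀.le]
    have h2 : κ * r₀ ^ Q * t ^ p = 2 * A ^ p := by
      rw [this]
      field_simp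
    have : 0 < A ^ p := by positivity
    linarith
  clear_value t
  have hchain : ∀ x, x ∉ E → ∀ n : ℕ, (h x : ℝ) ≤ t * M ^ n → ∃ y, y ∉ E ∧ (h y : ℝ) ≤ t ∧
      ρ x y ≤ C * r₀ ∧ |u x - u y| ≤ 2 * M * t * r₀ ^ s *
        ∑ j ∈ Finset.range n, (M ^ (1 - s * p / Q)) ^ j := by
    intro x hx n hn
    have := exists_chain hρ hC hmax hκ hlow hs hp hM1 hη0 hCη hηM hA ht0 hr₀ hr₀d hAt hh hE hgrad
      hint hx n 0 (by rwa [zero_add])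
    simpa only [pow_zero, mul_one, zero_add, hratio] using this
  by_cases hne : ∃ x₁, x₁ ∉ E ∧ ρ x₀ x₁ ≤ r₀
  · obtain ⟨x₁, hx₁E, hx₁⟩ := hne
    obtain ⟨n₁, hn₁⟩ := pow_unbounded_of_one_lt ((h x₁ : ℝ) / t) hM1
    rw [div_lt_iff₀ ht0, mul_comm] at hn₁
    obtain ⟨y₁, hy₁E, hy₁h, hy₁ρ, -⟩ := hchain x₁ hx₁E n₁ hn₁.le
    -- The constant is the value of `u` at the end of one reference chain. Any other chain also ends
    -- at gradient level at most `t`, and two such endpoints at distance at most `C^4 r₀` are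
    -- compared directly.
    refine ⟨u y₁, fun x hxE hx n hn => ?_⟩
    obtain ⟨y, hyE, hyh, hyρ, hyu⟩ := hchain x hxE n hn
    have hyy : ρ y y₁ ≤ C ^ 4 * r₀ := by
      have hmm : ∀ a b c : X, ∀ m : ℝ, ρ a c ≤ m → ρ c b ≤ m → ρ a b ≤ C * m := fun a b c m h1 h2 =>
        (hmax a b c).trans (mul_le_mul_of_nonneg_left (max_le h1 h2) hC0.le)
      have hup : ∀ m : ℝ, 0 ≤ m → m ≤ C * m := fun m hm => le_mul_of_one_le_left hm hC
      have e1 : ρ x x₁ ≤ C * (C * r₀) := hmm x x₁ x₀ _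
        ((hsymm x₀ x).trans (mul_le_mul_of_nonneg_left hx hC0.le)) (hx₁.trans (hup _ hr₀.le))
      have e2 : ρ x y₁ ≤ C * (C * (C * r₀)) := hmm x y₁ x₁ _ e1
        (hy₁ρ.trans (hup _ (by positivity)))
      have e3 : ρ y x ≤ C * (C * r₀) :=
        (hsymm x y).trans (mul_le_mul_of_nonneg_left hyρ hC0.le)
      have e4 := hmm y y₁ x _ (e3.trans (hup _ (by positivity))) e2
      refine e4.trans_eq ?_
      ring
    have h1 : |u y - u y₁| ≤ (C ^ 4) ^ s * r₀ ^ s * (2 * t) := by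
      refine (hgrad y y₁ hyE hy₁E).trans ?_
      refine mul_le_mul ?_ (by linarith) (by positivity)
        (mul_nonneg (Real.rpow_nonneg (pow_nonneg hC0.le 4) _) (Real.rpow_nonneg hr₀.le _))
      rw [← Real.mul_rpow (pow_nonneg hC0.le 4) hr₀.le]
      exact Real.rpow_le_rpow (hρ.nonneg _ _) hyy hs.le
    have h2 : 0 ≤ ∑ j ∈ Finset.range n, (M ^ (1 - s * p / Q)) ^ j :=
      Finset.sum_nonneg fun _ _ => pow_nonneg (Real.rpow_nonneg hM0.le _) _
    have h3 : A * r₀ ^ (s - Q / p) * b = t * r₀ ^ s := by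
      rw [ht, sub_eq_add_neg, Real.rpow_add hr₀]
      ring
    set S := ∑ j ∈ Finset.range n, (M ^ (1 - s * p / Q)) ^ j
    calc |u x - u y₁| ≤ |u x - u y| + |u y - u y₁| := abs_sub_le _ _ _
      _ ≤ 2 * M * t * r₀ ^ s * S + (C ^ 4) ^ s * r₀ ^ s * (2 * t) := add_le_add hyu h1
      _ = (t * r₀ ^ s) * (2 * M * S + 2 * (C ^ 4) ^ s) := by ring
      _ ≤ (t * r₀ ^ s) * ((2 * M + 2 * (C ^ 4) ^ s) * (1 + S)) := by
          refine mul_le_mul_of_nonneg_left ?_ (mul_nonneg ht0.le (Real.rpow_nonneg hr₀.le _))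
          have : 0 ≤ 2 * (C ^ 4) ^ s * S :=
            mul_nonneg (mul_nonneg zero_le_two (Real.rpow_nonneg (pow_nonneg hC0.le 4) _)) h2
          nlinarith
      _ = _ := by rw [← h3]; ring
  · push Not at hne
    exact ⟨0, fun x hxE hx => absurd hx (not_le.2 (hne x hxE))⟩

theorem exists_pow_near {M : ℝ} (hM : 1 < M) (z : ℝ) :
    ∃ n : ℕ, z ≤ M ^ n ∧ M ^ n ≤ max 1 (M * z) := by
  rcases le_or_gt z 1 with hz | hz
  · exact ⟨0, by simpa using hz, by simp⟩
  · obtain ⟨n, hn1, hn2⟩ := exists_nat_pow_near hz.le hM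
    refine ⟨n + 1, hn2.le, le_max_of_le_right ?_⟩
    rw [pow_succ, mul_comm]
    exact mul_le_mul_of_nonneg_left hn1 (by linarith)

/-! ### Hölder continuity -/

/-- For `sp > Q` the ratio `M^(1 - sp/Q)` is below one, so the chain sums are bounded independently
of the size of the gradient. The ball is centered at `x` with radius `ρ x y`; the estimate includes
points at distance exactly the radius, so it covers `y`. -/
theorem LowerAhlfors.exists_holder_off_null (hX : IsQuasiMetricMeasure ρ μ)
    (hL : LowerAhlfors ρ μ Q) (hs : 0 < s) (hQ : 0 < Q) (hp : p ∈ Ioi (Q / s)) :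
    ∃ D : ℝ, 0 < D ∧ ∀ (u : X → ℝ) (A : ℝ), 0 < A → HajlaszBound ρ μ s p A u →
      ∃ E : Set X, μ E = 0 ∧ ∀ x y, x ∉ E → y ∉ E → |u x - u y| ≤ D * A * ρ x y ^ (s - Q / p) := by
  have hp0 : 0 < p := lt_trans (by positivity) hp
  obtain ⟨M, D, b, hM, hD, hb, H⟩ := hL.exists_center hX hs hQ hp0
  set a := M ^ (1 - s * p / Q) with ha
  have hM0 : 0 < M := by linarith
  have ha0 : 0 < a := by positivity
  have ha1 : a < 1 := by
    refine Real.rpow_lt_one_of_one_lt_of_neg hM ?_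
    have : Q / s < p := hp
    rw [div_lt_iff₀ hs] at this
    rw [sub_neg, one_lt_div hQ]
    linarith
  have hsum : ∀ n, ∑ j ∈ Finset.range n, a ^ j ≤ (1 - a)⁻¹ := fun n => by
    rw [← tsum_geometric_of_lt_one ha0.le ha1]
    exact (summable_geometric_of_lt_one ha0.le ha1).sum_le_tsum _ fun _ _ => by positivity
  have h1a : 0 < (1 - a)⁻¹ := inv_pos.2 (by linarith)
  refine ⟨2 * (D * (1 + (1 - a)⁻¹)), by positivity, fun u A hA hu => ?_⟩
  obtain ⟨h, E, hh, hE, hgrad, hint⟩ := hu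
  refine ⟨E, hE, fun x y hx hy => ?_⟩
  rcases eq_or_ne x y with rfl | hne
  · rw [sub_self, abs_zero]
    have := Real.rpow_nonneg (hX.quasiMetric.nonneg x x) (s - Q / p)
    positivity
  set r := ρ x y with hr
  have hr0 : 0 < r := hX.quasiMetric.pos hne
  have hrd : ENNReal.ofReal r ≤ diam ρ := le_iSup₂ (f := fun x y => ENNReal.ofReal (ρ x y)) x y
  obtain ⟨c, hc⟩ := H u h E A hA hh hE hgrad hint x r hr0 hrd
  have key : ∀ z, z ∉ E → ρ x z ≤ r →
      |u z - c| ≤ D * A * r ^ (s - Q / p) * (1 + (1 - a)⁻¹) := by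
    intro z hz hzr
    have hτ : 0 < b * A * r ^ (-(Q / p)) := by positivity
    obtain ⟨n, hn⟩ := pow_unbounded_of_one_lt ((h z : ℝ) / (b * A * r ^ (-(Q / p)))) hM
    rw [div_lt_iff₀ hτ, mul_comm] at hn
    refine (hc z hz hzr n hn.le).trans ?_
    exact mul_le_mul_of_nonneg_left (by linarith [hsum n]) (by positivity)
  have h1 := key x hx (by rw [hX.quasiMetric.self]; exact hr0.le)
  have h2 := key y hy le_rfl
  rw [abs_sub_comm] at h2
  calc |u x - u y| ≤ |u x - c| + |c - u y| := abs_sub_le _ _ _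
    _ ≤ _ := by linarith

/-- A function which is Hölder continuous off a null set agrees almost everywhere with a
Hölder continuous function. -/
theorem exists_holder_extension (hX : IsQuasiMetricMeasure ρ μ) {α : ℝ} (hα : 0 < α) :
    ∃ D : ℝ, 0 < D ∧ ∀ (u : X → ℝ) (L : ℝ) (E : Set X), 0 < L → μ E = 0 →
      (∀ x y, x ∉ E → y ∉ E → |u x - u y| ≤ L * ρ x y ^ α) →
      ∃ v : X → ℝ, (∀ᵐ x ∂μ, u x = v x) ∧ ∀ x y, |v x - v y| ≤ L * (D * ρ x y ^ α) := by
  have hρ := hX.quasiMetric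
  obtain ⟨C, hC, hsymm, hmax⟩ := hρ.exists_const
  have hC0 : 0 < C := by linarith
  refine ⟨(C * C) ^ α, by positivity, fun u L E hL hE hu => ?_⟩
  -- Balls have positive measure, so `E` contains none of them and its complement is dense. Taking
  -- `y = x` off `E` makes the extension agree with `u` there.
  have hex : ∀ (x : X) (n : ℕ), ∃ y, y ∉ E ∧ ρ x y < 1 / ((n : ℝ) + 1) ∧ (x ∉ E → y = x) := by
    intro x n
    have hn : 0 < 1 / ((n : ℝ) + 1) := by positivity
    by_cases hx : x ∈ E
    · have hpos := hX.ball_pos x _ hn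
      have hns : ¬ ball ρ x (1 / ((n : ℝ) + 1)) ⊆ E := fun hsub =>
        hpos.ne' (measure_mono_null hsub hE)
      obtain ⟨y, hy, hyE⟩ := Set.not_subset.1 hns
      exact ⟨y, hyE, hy, fun h => absurd hx h⟩
    · exact ⟨x, hx, by rw [hρ.self]; exact hn, fun _ => rfl⟩
  choose ξ hξE hξρ hξx using hex
  have hdist : ∀ x y (e : ℝ) (n m : ℕ), 1 / ((n : ℝ) + 1) ≤ e → 1 / ((m : ℝ) + 1) ≤ e →
      |u (ξ x n) - u (ξ y m)| ≤ L * ((C * C) * max e (ρ x y)) ^ α := by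
    intro x y e n m hn hm
    refine (hu _ _ (hξE x n) (hξE y m)).trans (mul_le_mul_of_nonneg_left ?_ hL.le)
    refine Real.rpow_le_rpow (hρ.nonneg _ _) ?_ hα.le
    have h1 : ρ (ξ x n) x ≤ C * max e (ρ x y) := (hsymm x (ξ x n)).trans
      (mul_le_mul_of_nonneg_left (le_max_of_le_left ((hξρ x n).le.trans hn)) hC0.le)
    have h2 : ρ x (ξ y m) ≤ C * max e (ρ x y) := (hmax _ _ y).trans
      (mul_le_mul_of_nonneg_left (max_le (le_max_right _ _)
        (le_max_of_le_left ((hξρ y m).le.trans hm))) hC0.le)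
    refine (hmax _ _ x).trans ((mul_le_mul_of_nonneg_left (max_le h1 h2) hC0.le).trans_eq ?_)
    ring
  have hlim0 : Filter.Tendsto (fun n : ℕ => 1 / ((n : ℝ) + 1)) Filter.atTop (nhds 0) :=
    tendsto_one_div_add_atTop_nhds_zero_nat
  have hlim : ∀ x y, Filter.Tendsto (fun n : ℕ => L * ((C * C) * max (1 / ((n : ℝ) + 1)) (ρ x y)) ^ α)
      Filter.atTop (nhds (L * ((C * C) * ρ x y) ^ α)) := by
    intro x y
    have h1 := hlim0.max (tendsto_const_nhds (x := ρ x y))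
    rw [max_eq_right (hρ.nonneg x y)] at h1
    exact ((h1.const_mul (C * C)).rpow_const (Or.inr hα.le)).const_mul L
  have hcau : ∀ x, CauchySeq fun n => u (ξ x n) := by
    intro x
    refine cauchySeq_of_le_tendsto_0 _ (fun n m k hn hm => ?_) (by
      have := hlim x x
      rwa [hρ.self, mul_zero, Real.zero_rpow hα.ne', mul_zero] at this)
    rw [Real.dist_eq, ← hρ.self x]
    exact hdist x x _ n m (Nat.one_div_le_one_div hn) (Nat.one_div_le_one_div hm)
  choose v hv using fun x => cauchySeq_tendsto_of_complete (hcau x)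
  refine ⟨v, ?_, fun x y => ?_⟩
  · filter_upwards [measure_eq_zero_iff_ae_notMem.1 hE] with x hx
    refine tendsto_nhds_unique ?_ (hv x)
    simp_rw [fun n => hξx x n hx]
    exact tendsto_const_nhds
  · rw [← Real.mul_rpow (by positivity) (hρ.nonneg _ _)]
    exact le_of_tendsto_of_tendsto' ((hv x).sub (hv y)).abs (hlim x y)
      fun n => hdist x y _ n n le_rfl le_rfl

theorem exists_bound_of_memSpace {N : (X → ℝ) → ℝ≥0∞} (hH : HajlaszDominated ρ μ s p N)
    {u : X → ℝ} (hu : MemSpace μ N u) (h0 : N u ≠ 0) :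
    0 < (N u).toReal ∧ HajlaszBound ρ μ s p (2 * (N u).toReal) u := by
  have hpos : 0 < (N u).toReal := ENNReal.toReal_pos h0 hu.2.ne
  refine ⟨hpos, hH u _ (by positivity) ?_⟩
  rw [ENNReal.lt_ofReal_iff_toReal_lt hu.2.ne]
  linarith

theorem LowerAhlfors.holderCond [Nonempty X] (hX : IsQuasiMetricMeasure ρ μ)
    (hL : LowerAhlfors ρ μ Q) (hs : 0 < s) (hQ : 0 < Q) (hp : p ∈ Ioi (Q / s))
    {N : (X → ℝ) → ℝ≥0∞} (hH : HajlaszDominated ρ μ s p N) : HolderCond ρ μ s Q p N := by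
  have hp0 : 0 < p := lt_trans (by positivity) hp
  have hα : 0 < s - Q / p := by
    have : Q / s < p := hp
    rw [div_lt_iff₀ hs] at this
    rw [sub_pos, div_lt_iff₀ hp0]
    linarith
  obtain ⟨D₁, hD₁, H₁⟩ := hL.exists_holder_off_null hX hs hQ hp
  obtain ⟨D₂, hD₂, H₂⟩ := exists_holder_extension hX hα
  refine ⟨2 * D₁ * D₂, by positivity, fun u hu => ?_⟩
  rcases eq_or_ne (N u) 0 with h0 | h0
  · obtain ⟨c, hc⟩ := hH.exists_ae_eq_const hp0 h0
    exact ⟨fun _ => c, hc, fun x y => by simp [h0]⟩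
  · obtain ⟨hpos, hb⟩ := exists_bound_of_memSpace hH hu h0
    obtain ⟨E, hE, hEu⟩ := H₁ u _ (by positivity) hb
    obtain ⟨v, hv1, hv2⟩ := H₂ u _ E (by positivity) hE hEu
    refine ⟨v, hv1, fun x y => (hv2 x y).trans_eq ?_⟩
    ring

end Chain

section Sobolev

variable {X : Type*} [MeasurableSpace X] {ρ : X → X → ℝ} {μ : Measure X} {s Q p : ℝ}

/-! ### Local Sobolev and exponential estimates -/

theorem lintegral_const_add_mul_le {h : X → ℝ≥0} {A a : ℝ} (hA : 0 < A) (S : Set X)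
    (hint : ∫⁻ x, (h x : ℝ≥0∞) ^ p ∂μ ≤ ENNReal.ofReal A ^ p) :
    ∫⁻ x in S, (ENNReal.ofReal a + ENNReal.ofReal (A ^ (-p)) * (h x : ℝ≥0∞) ^ p) ∂μ ≤
      ENNReal.ofReal a * μ S + 1 := by
  rw [lintegral_add_left measurable_const, setLIntegral_const]
  refine add_le_add le_rfl ?_
  rw [lintegral_const_mul' _ _ ENNReal.ofReal_ne_top]
  refine (mul_le_mul' le_rfl ((setLIntegral_le_lintegral _ _).trans hint)).trans_eq ?_
  rw [ENNReal.ofReal_rpow_of_pos hA, ← ENNReal.ofReal_mul (by positivity),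
    ← Real.rpow_add hA, neg_add_cancel, Real.rpow_zero, ENNReal.ofReal_one]

theorem ofReal_add_mul_rpow {A a k : ℝ} (hp : 0 < p) (hA : 0 < A) (ha : 0 ≤ a) (hk : 0 ≤ k)
    (h : ℝ≥0) : ENNReal.ofReal (k * (a + A ^ (-p) * (h : ℝ) ^ p)) =
      ENNReal.ofReal k * (ENNReal.ofReal a + ENNReal.ofReal (A ^ (-p)) * (h : ℝ≥0∞) ^ p) := by
  rw [ENNReal.ofReal_mul hk, ENNReal.ofReal_add ha (by positivity),
    ENNReal.ofReal_mul (by positivity), ← ENNReal.ofReal_rpow_of_nonneg h.coe_nonneg hp.le,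
    ENNReal.ofReal_coe_nnreal]

theorem pow_rpow_le {M z : ℝ} (hp : 0 < p) (hM : 1 < M) (hz : 0 ≤ z) {n : ℕ}
    (hn : M ^ n ≤ max 1 (M * z)) : (M ^ n) ^ p ≤ 1 + M ^ p * z ^ p := by
  have hM0 : 0 < M := by linarith
  refine (Real.rpow_le_rpow (by positivity) hn hp.le).trans ?_
  rw [← Real.mul_rpow hM0.le hz]
  have h1 : 0 ≤ (M * z) ^ p := by positivity
  rcases le_total 1 (M * z) with h | h
  · rw [max_eq_right h]
    linarith
  · rw [max_eq_left h, Real.one_rpow]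
    linarith

/-- For `sp < Q` the chain sum is dominated by its last term `a^n` with `a = M^(1 - sp/Q)`. Since
`(1 - sp/Q) p* = p`, its power `p*` is `(M^n)^p`, which is comparable to a constant plus the
normalized `h^p`. A general set `S` within non-strict distance `r₀` is allowed so that it can be the
whole space when `r₀` is the diameter. -/
theorem LowerAhlfors.exists_sobolev_local (hX : IsQuasiMetricMeasure ρ μ)
    (hL : LowerAhlfors ρ μ Q) (hs : 0 < s) (hQ : 0 < Q) (hp : p ∈ Ioo 0 (Q / s)) :
    ∃ K : ℝ, 0 < K ∧ ∀ (u : X → ℝ) (A : ℝ), 0 < A → HajlaszBound ρ μ s p A u →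
      ∀ (x₀ : X) (r₀ : ℝ), 0 < r₀ → ENNReal.ofReal r₀ ≤ diam ρ → ∀ S : Set X,
        NullMeasurableSet S μ → (∀ x ∈ S, ρ x₀ x ≤ r₀) →
        ∃ c : ℝ, ∫⁻ x in S, ‖u x - c‖ₑ ^ sobExp s Q p ∂μ ≤
          ENNReal.ofReal (K * A ^ sobExp s Q p) * (ENNReal.ofReal (r₀ ^ (-Q)) * μ S + 1) := by
  have hp0 := hp.1
  have hP := sobExp_pos hs hp
  have hP1 := one_div_sobExp hs hp
  set P := sobExp s Q p with hPdef
  have hspQ : s * p < Q := by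
    have := (lt_div_iff₀ hs).1 hp.2
    linarith
  have hδP : (1 - s * p / Q) * P = p := by
    have : Q - s * p ≠ 0 := by linarith
    rw [hPdef, sobExp]
    field_simp
  have hexp : (s - Q / p) * P = -Q := by
    have e : s - Q / p = -(Q * (1 / P)) := by
      rw [div_eq_mul_one_div, hP1]; ring
    rw [e]
    field_simp
  clear_value P
  obtain ⟨M, D, b, hM, hD, hb, H⟩ := hL.exists_center hX hs hQ hp0
  have hM0 : 0 < M := by linarith
  set a := M ^ (1 - s * p / Q) with ha
  have ha1 : 1 < a := Real.one_lt_rpow hM (by rw [sub_pos, div_lt_one hQ]; exact hspQ)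
  have ha0 : 0 < a - 1 := by linarith
  have hsum : ∀ n, 1 + ∑ j ∈ Finset.range n, a ^ j ≤ (1 + 1 / (a - 1)) * a ^ n := fun n => by
    have h1 : 1 ≤ a ^ n := one_le_pow₀ ha1.le
    rw [geom_sum_eq ha1.ne', add_mul, one_mul, one_div_mul_eq_div]
    exact add_le_add h1 (div_le_div_of_nonneg_right (by linarith) ha0.le)
  have haP : ∀ n : ℕ, (a ^ n) ^ P = (M ^ n) ^ p := fun n => by
    rw [← Real.rpow_natCast a, ← Real.rpow_mul (by linarith), mul_comm (n : ℝ),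
      Real.rpow_mul (by linarith), ha, ← Real.rpow_mul hM0.le, hδP, ← Real.rpow_mul hM0.le,
      mul_comm p, Real.rpow_mul hM0.le, Real.rpow_natCast]
  clear_value a
  set G := D * (1 + 1 / (a - 1)) with hG
  have hG0 : 0 < G := by positivity
  refine ⟨G ^ P * (1 + M ^ p * b ^ (-p)), by positivity, ?_⟩
  intro u A hA ⟨h, E, hh, hE, hgrad, hint⟩ x₀ r₀ hr₀ hr₀d S hS hSr
  obtain ⟨c, hc⟩ := H u h E A hA hh hE hgrad hint x₀ r₀ hr₀ hr₀d
  refine ⟨c, ?_⟩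
  have key : ∀ x, x ∉ E → x ∈ S → |u x - c| ^ P ≤
      G ^ P * (1 + M ^ p * b ^ (-p)) * A ^ P * (r₀ ^ (-Q) + A ^ (-p) * (h x : ℝ) ^ p) := by
    intro x hxE hxS
    have hτ : 0 < b * A * r₀ ^ (-(Q / p)) := by positivity
    set z := (h x : ℝ) / (b * A * r₀ ^ (-(Q / p))) with hz
    have hz0 : 0 ≤ z := by positivity
    obtain ⟨n, hn1, hn2⟩ := exists_pow_near hM z
    have h1 : (h x : ℝ) ≤ b * A * r₀ ^ (-(Q / p)) * M ^ n := by
      rw [hz, div_le_iff₀ hτ] at hn1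
      linarith
    have h2 : |u x - c| ≤ G * A * r₀ ^ (s - Q / p) * a ^ n := by
      refine (hc x hxE (hSr x hxS) n h1).trans ((mul_le_mul_of_nonneg_left (hsum n)
        (by positivity)).trans_eq ?_)
      rw [hG]
      ring
    have h3 := Real.rpow_le_rpow (abs_nonneg _) h2 hP.le
    rw [Real.mul_rpow (by positivity) (by positivity), haP, Real.mul_rpow (by positivity)
      (by positivity), Real.mul_rpow hG0.le hA.le, ← Real.rpow_mul hr₀.le, hexp] at h3
    have hzp : z ^ p = b ^ (-p) * A ^ (-p) * r₀ ^ Q * (h x : ℝ) ^ p := by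
      rw [hz, Real.div_rpow (h x).coe_nonneg hτ.le, Real.mul_rpow (by positivity) (by positivity),
        Real.mul_rpow hb.le hA.le, ← Real.rpow_mul hr₀.le, neg_mul, div_mul_cancel₀ _ hp0.ne',
        Real.rpow_neg hr₀.le, Real.rpow_neg hb.le, Real.rpow_neg hA.le]
      field_simp
    refine h3.trans ((mul_le_mul_of_nonneg_left (pow_rpow_le hp0 hM hz0 hn2)
      (by positivity)).trans ?_)
    rw [hzp]
    have hrr : r₀ ^ (-Q) * r₀ ^ Q = 1 := by
      rw [← Real.rpow_add hr₀, neg_add_cancel, Real.rpow_zero]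
    calc G ^ P * A ^ P * r₀ ^ (-Q) * (1 + M ^ p * (b ^ (-p) * A ^ (-p) * r₀ ^ Q * (h x : ℝ) ^ p))
        = G ^ P * A ^ P * (r₀ ^ (-Q) + (r₀ ^ (-Q) * r₀ ^ Q) * (M ^ p * b ^ (-p)) *
            (A ^ (-p) * (h x : ℝ) ^ p)) := by ring
      _ = G ^ P * A ^ P * (r₀ ^ (-Q) + (M ^ p * b ^ (-p)) * (A ^ (-p) * (h x : ℝ) ^ p)) := by
          rw [hrr, one_mul]
      _ ≤ G ^ P * A ^ P * ((1 + M ^ p * b ^ (-p)) * (r₀ ^ (-Q) + A ^ (-p) * (h x : ℝ) ^ p)) := by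
          refine mul_le_mul_of_nonneg_left ?_ (by positivity)
          have e1 : 0 ≤ M ^ p * b ^ (-p) * r₀ ^ (-Q) := by positivity
          have e2 : 0 ≤ A ^ (-p) * (h x : ℝ) ^ p := by positivity
          linarith
      _ = _ := by ring
  calc ∫⁻ x in S, ‖u x - c‖ₑ ^ P ∂μ ≤ ∫⁻ x in S,
        ENNReal.ofReal (G ^ P * (1 + M ^ p * b ^ (-p)) * A ^ P) *
          (ENNReal.ofReal (r₀ ^ (-Q)) + ENNReal.ofReal (A ^ (-p)) * (h x : ℝ≥0∞) ^ p) ∂μ := by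
        refine lintegral_mono_ae ((ae_restrict_iff'₀ hS).2 ?_)
        filter_upwards [measure_eq_zero_iff_ae_notMem.1 hE] with x hxE hxS
        rw [Real.enorm_eq_ofReal_abs, ENNReal.ofReal_rpow_of_nonneg (abs_nonneg _) hP.le,
          ← ofReal_add_mul_rpow hp0 hA (by positivity) (by positivity)]
        exact ENNReal.ofReal_le_ofReal (key x hxE hxS)
    _ ≤ _ := by
        rw [lintegral_const_mul' _ _ ENNReal.ofReal_ne_top]
        exact mul_le_mul' le_rfl (lintegral_const_add_mul_le hA S hint)

/-- For `sp = Q` the ratio is one, so `|u - c| ≤ D A (1 + n)` with `n` logarithmic in the gradient.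
Exponentiating at the rate `p log M / (D A)` gives back `M^p (M^n)^p`, which is integrable like
`h^p`. -/
theorem LowerAhlfors.exists_exp_local (hX : IsQuasiMetricMeasure ρ μ)
    (hL : LowerAhlfors ρ μ Q) (hs : 0 < s) (hQ : 0 < Q) :
    ∃ l K : ℝ, 0 < l ∧ 0 < K ∧ ∀ (u : X → ℝ) (A : ℝ), 0 < A →
      HajlaszBound ρ μ s (Q / s) A u →
      ∀ (x₀ : X) (r₀ : ℝ), 0 < r₀ → ENNReal.ofReal r₀ ≤ diam ρ →
        ∃ c : ℝ, ∫⁻ x in ball ρ x₀ r₀, ENNReal.ofReal (Real.exp (l / A * |u x - c|)) ∂μ ≤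
          ENNReal.ofReal K * μ (ball ρ x₀ r₀) := by
  have hp0 : 0 < Q / s := by positivity
  obtain ⟨M, D, b, hM, hD, hb, H⟩ := hL.exists_center hX hs hQ hp0
  obtain ⟨κ, hκ, hlow⟩ := hL
  have hM0 : 0 < M := by linarith
  have hlog : 0 < Real.log M := Real.log_pos hM
  have e1 : 1 - s * (Q / s) / Q = 0 := by field_simp; ring
  have e2 : s - Q / (Q / s) = 0 := by field_simp; ring
  have e3 : Q / (Q / s) = s := by field_simp
  have e4 : s * (Q / s) = Q := by field_simp
  rw [e1, e2, e3] at H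
  set p := Q / s with hp
  clear_value p
  refine ⟨p * Real.log M / D, M ^ p * (1 + M ^ p * b ^ (-p)) * (1 + κ⁻¹), by positivity,
    by positivity, ?_⟩
  intro u A hA ⟨h, E, hh, hE, hgrad, hint⟩ x₀ r₀ hr₀ hr₀d
  obtain ⟨c, hc⟩ := H u h E A hA hh hE hgrad hint x₀ r₀ hr₀ hr₀d
  refine ⟨c, ?_⟩
  have key : ∀ x, x ∉ E → ρ x₀ x < r₀ → Real.exp (p * Real.log M / D / A * |u x - c|) ≤
      M ^ p * (1 + M ^ p * b ^ (-p)) * r₀ ^ Q * (r₀ ^ (-Q) + A ^ (-p) * (h x : ℝ) ^ p) := by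
    intro x hxE hx
    have hτ : 0 < b * A * r₀ ^ (-s) := by positivity
    set z := (h x : ℝ) / (b * A * r₀ ^ (-s)) with hz
    have hz0 : 0 ≤ z := by positivity
    obtain ⟨n, hn1, hn2⟩ := exists_pow_near hM z
    have h1 : (h x : ℝ) ≤ b * A * r₀ ^ (-s) * M ^ n := by
      rw [hz, div_le_iff₀ hτ] at hn1
      linarith
    have h2 := hc x hxE hx.le n h1
    simp only [Real.rpow_zero, one_pow, Finset.sum_const, Finset.card_range, nsmul_eq_mul,
      mul_one] at h2
    have h3 : p * Real.log M / D / A * |u x - c| ≤ Real.log M * p * (1 + n) := by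
      refine (mul_le_mul_of_nonneg_left h2 (by positivity)).trans_eq ?_
      field_simp
    have h4 : Real.exp (Real.log M * p * (1 + n)) = M ^ p * (M ^ n) ^ p := by
      rw [mul_add, mul_one, Real.exp_add, ← Real.rpow_def_of_pos hM0, Real.exp_mul,
        ← Real.rpow_def_of_pos hM0, ← Real.rpow_natCast M n, ← Real.rpow_mul hM0.le,
        ← Real.rpow_mul hM0.le, mul_comm (n : ℝ)]
    have hzp : z ^ p = b ^ (-p) * A ^ (-p) * r₀ ^ Q * (h x : ℝ) ^ p := by
      rw [hz, Real.div_rpow (h x).coe_nonneg hτ.le, Real.mul_rpow (by positivity) (by positivity),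
        Real.mul_rpow hb.le hA.le, ← Real.rpow_mul hr₀.le, neg_mul, e4,
        Real.rpow_neg hr₀.le, Real.rpow_neg hb.le, Real.rpow_neg hA.le]
      field_simp
    have hrr : r₀ ^ Q * r₀ ^ (-Q) = 1 := by
      rw [← Real.rpow_add hr₀, add_neg_cancel, Real.rpow_zero]
    calc Real.exp (p * Real.log M / D / A * |u x - c|)
        ≤ M ^ p * (M ^ n) ^ p := (Real.exp_le_exp.2 h3).trans_eq h4
      _ ≤ M ^ p * (1 + M ^ p * z ^ p) :=
          mul_le_mul_of_nonneg_left (pow_rpow_le hp0 hM hz0 hn2) (by positivity)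
      _ = M ^ p * (1 + (M ^ p * b ^ (-p)) * (r₀ ^ Q * (A ^ (-p) * (h x : ℝ) ^ p))) := by
          rw [hzp]; ring
      _ ≤ M ^ p * ((1 + M ^ p * b ^ (-p)) * (1 + r₀ ^ Q * (A ^ (-p) * (h x : ℝ) ^ p))) := by
          refine mul_le_mul_of_nonneg_left ?_ (by positivity)
          have i1 : 0 ≤ M ^ p * b ^ (-p) := by positivity
          have i2 : 0 ≤ r₀ ^ Q * (A ^ (-p) * (h x : ℝ) ^ p) := by positivity
          linarith
      _ = M ^ p * ((1 + M ^ p * b ^ (-p)) *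
            (r₀ ^ Q * r₀ ^ (-Q) + r₀ ^ Q * (A ^ (-p) * (h x : ℝ) ^ p))) := by rw [hrr]
      _ = _ := by ring
  have hS := hX.ball_measurable x₀ r₀ hr₀
  calc ∫⁻ x in ball ρ x₀ r₀, ENNReal.ofReal (Real.exp (p * Real.log M / D / A * |u x - c|)) ∂μ
      ≤ ∫⁻ x in ball ρ x₀ r₀, ENNReal.ofReal (M ^ p * (1 + M ^ p * b ^ (-p)) * r₀ ^ Q) *
          (ENNReal.ofReal (r₀ ^ (-Q)) + ENNReal.ofReal (A ^ (-p)) * (h x : ℝ≥0∞) ^ p) ∂μ := by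
        refine lintegral_mono_ae ((ae_restrict_iff'₀ hS).2 ?_)
        filter_upwards [measure_eq_zero_iff_ae_notMem.1 hE] with x hxE hxS
        rw [← ofReal_add_mul_rpow hp0 hA (by positivity) (by positivity)]
        exact ENNReal.ofReal_le_ofReal (key x hxE hxS)
    _ ≤ ENNReal.ofReal (M ^ p * (1 + M ^ p * b ^ (-p)) * r₀ ^ Q) *
          (ENNReal.ofReal (r₀ ^ (-Q)) * μ (ball ρ x₀ r₀) +
            ENNReal.ofReal (κ⁻¹ * r₀ ^ (-Q)) * μ (ball ρ x₀ r₀)) := by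
        rw [lintegral_const_mul' _ _ ENNReal.ofReal_ne_top]
        refine mul_le_mul' le_rfl ((lintegral_const_add_mul_le hA _ hint).trans
          (add_le_add le_rfl ?_))
        -- The gradient contributes `1`, which lower regularity bounds by `κ⁻¹ r₀^(-Q) μ(B)`; this
        -- makes the estimate proportional to `μ(B)`.
        refine le_trans (le_of_eq ?_) (mul_le_mul' le_rfl (hlow x₀ r₀ hr₀ hr₀d))
        rw [← ENNReal.ofReal_mul (by positivity), Real.rpow_neg hr₀.le, ← ENNReal.ofReal_one]
        congr 1
        field_simp
    _ = _ := by
        rw [← add_mul, ← ENNReal.ofReal_add (by positivity) (by positivity), ← mul_assoc,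
          ← ENNReal.ofReal_mul (by positivity), Real.rpow_neg hr₀.le]
        congr 2
        field_simp

/-! ### Exponential integrability -/

/-- The local estimate holds with some constant `c`. It also bounds the mean of `|u - c|`, so `u_B`
differs from `c` by at most `(A/l) K`, and exchanging the two costs a factor `exp K`. -/
theorem LowerAhlfors.expIntegrability [Nonempty X] (hX : IsQuasiMetricMeasure ρ μ)
    (hL : LowerAhlfors ρ μ Q) (hs : 0 < s) (hQ : 0 < Q) {N : (X → ℝ) → ℝ≥0∞}
    (hH : HajlaszDominated ρ μ s (Q / s) N) :
    ExpIntegrability ρ μ N := by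
  have hp0 : 0 < Q / s := by positivity
  obtain ⟨l, K, hl, hK, H⟩ := hL.exists_exp_local hX hs hQ
  -- With `A = 2 N u`, the rate `l / A` is `(l / 2) / N u`.
  refine ⟨l / 2, Real.exp K * K, 1, by positivity, by positivity, one_pos, ?_⟩
  intro x₀ r hr hrd u hu hnc
  have hN : N u ≠ 0 := fun h => hnc (hH.exists_ae_eq_const hp0 h)
  obtain ⟨hpos, hb⟩ := exists_bound_of_memSpace hH hu hN
  set A := 2 * (N u).toReal with hA
  have hA0 : 0 < A := by positivity
  obtain ⟨c, hc⟩ := H u A hA0 hb x₀ r hr hrd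
  set B := ball ρ x₀ r with hB
  have hBpos := hX.ball_pos x₀ r hr
  have hBfin := hX.ball_lt_top x₀ r hr
  have hle : ∀ x, |u x - c| ≤ A / l * Real.exp (l / A * |u x - c|) := fun x => by
    have h1 : l / A * |u x - c| ≤ Real.exp (l / A * |u x - c|) :=
      (by linarith : _ ≤ l / A * |u x - c| + 1).trans (Real.add_one_le_exp _)
    have h2 := mul_le_mul_of_nonneg_left h1 (div_nonneg hA0.le hl.le)
    refine le_trans (le_of_eq ?_) h2
    field_simp
  have hint : ∫⁻ x in B, ‖u x - c‖ₑ ∂μ ≤ ENNReal.ofReal (A / l * K) * μ B := by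
    calc ∫⁻ x in B, ‖u x - c‖ₑ ∂μ
        ≤ ∫⁻ x in B, ENNReal.ofReal (A / l) *
            ENNReal.ofReal (Real.exp (l / A * |u x - c|)) ∂μ := by
          refine lintegral_mono fun x => ?_
          rw [Real.enorm_eq_ofReal_abs, ← ENNReal.ofReal_mul (by positivity)]
          exact ENNReal.ofReal_le_ofReal (hle x)
      _ ≤ ENNReal.ofReal (A / l) * (ENNReal.ofReal K * μ B) := by
          rw [lintegral_const_mul' _ _ ENNReal.ofReal_ne_top]
          exact mul_le_mul' le_rfl hc
      _ = _ := by rw [← mul_assoc, ← ENNReal.ofReal_mul (by positivity)]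
  have hfin : ENNReal.ofReal (A / l * K) * μ B < ∞ :=
    ENNReal.mul_lt_top ENNReal.ofReal_lt_top hBfin
  have hcint : IntegrableOn (fun _ => c) B μ := integrableOn_const hBfin.ne
  have hsub : IntegrableOn (fun x => u x - c) B μ :=
    ⟨(hu.1.sub_const c).aestronglyMeasurable.restrict, hint.trans_lt hfin⟩
  have huint : IntegrableOn u B μ := by
    have := hsub.add hcint
    refine this.congr (Filter.Eventually.of_forall fun x => ?_)
    simp
  refine ⟨huint, ?_⟩
  set γ := ⨍ y in B, u y ∂μ with hγ
  have hμB : 0 < μ.real B := ENNReal.toReal_pos hBpos.ne' hBfin.ne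
  have hγc : |γ - c| ≤ A / l * K := by
    have h1 : γ - c = (μ.real B)⁻¹ * ∫ y in B, (u y - c) ∂μ := by
      rw [integral_sub huint hcint, hγ, setAverage_eq, setIntegral_const, smul_eq_mul, smul_eq_mul,
        mul_sub, ← mul_assoc _ _ c, inv_mul_cancel₀ hμB.ne', one_mul]
    have h2 : |∫ y in B, (u y - c) ∂μ| ≤ A / l * K * μ.real B := by
      have h3 := enorm_integral_le_lintegral_enorm (μ := μ.restrict B) fun y => u y - c
      have h4 := ENNReal.toReal_mono hfin.ne (h3.trans hint)
      rwa [ENNReal.toReal_mul, ENNReal.toReal_ofReal (by positivity), toReal_enorm,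
        Real.norm_eq_abs] at h4
    rw [h1, abs_mul, abs_of_pos (inv_pos.2 hμB), inv_mul_le_iff₀ hμB]
    linarith
  rw [setLAverage_eq, ENNReal.div_le_iff hBpos.ne' hBfin.ne]
  calc ∫⁻ x in B, ENNReal.ofReal (Real.exp ((l / 2 * (|u x - γ| / (N u).toReal)) ^ (1:ℝ))) ∂μ
      ≤ ∫⁻ x in B, ENNReal.ofReal (Real.exp K) *
          ENNReal.ofReal (Real.exp (l / A * |u x - c|)) ∂μ := by
        refine lintegral_mono fun x => ?_
        rw [← ENNReal.ofReal_mul (Real.exp_nonneg _), ← Real.exp_add, Real.rpow_one]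
        refine ENNReal.ofReal_le_ofReal (Real.exp_le_exp.2 ?_)
        have h1 : |u x - γ| ≤ |u x - c| + A / l * K := by
          have := abs_sub_le (u x) c γ
          rw [abs_sub_comm c γ] at this
          linarith
        have h2 : l / 2 * (|u x - γ| / (N u).toReal) = l / A * |u x - γ| := by
          rw [hA]; field_simp
        rw [h2]
        refine (mul_le_mul_of_nonneg_left h1 (by positivity)).trans_eq ?_
        field_simp
        ring
    _ ≤ ENNReal.ofReal (Real.exp K) * (ENNReal.ofReal K * μ B) := by
        rw [lintegral_const_mul' _ _ ENNReal.ofReal_ne_top]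
        exact mul_le_mul' le_rfl hc
    _ = _ := by rw [← mul_assoc, ← ENNReal.ofReal_mul (Real.exp_nonneg _)]

end Sobolev

/-! ### Global Sobolev and Sobolev–Poincaré inequalities -/

/-- The semi-norm is an infimum that need not be attained, so estimates are proved for every real
`A` above it and then passed to the limit. -/
theorem le_mul_of_forall_lt {a b : ℝ≥0∞} {K : ℝ} (hK : 0 < K)
    (h : ∀ A : ℝ, 0 < A → b < ENNReal.ofReal A → a ≤ ENNReal.ofReal K * ENNReal.ofReal A) :
    a ≤ ENNReal.ofReal K * b := by
  have hK0 : ENNReal.ofReal K ≠ 0 := (ENNReal.ofReal_pos.2 hK).ne'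
  rw [mul_comm, ← ENNReal.div_le_iff hK0 ENNReal.ofReal_ne_top]
  refine le_of_forall_gt_imp_ge_of_dense fun t ht => ?_
  rcases eq_or_ne t ∞ with rfl | htop
  · exact le_top
  · rw [ENNReal.div_le_iff hK0 ENNReal.ofReal_ne_top, mul_comm]
    have htpos : 0 < t.toReal := ENNReal.toReal_pos (ne_bot_of_gt ht) htop
    have := h t.toReal htpos (by rwa [ENNReal.ofReal_toReal htop])
    rwa [ENNReal.ofReal_toReal htop] at this

theorem eLpNorm_le_of_lintegral_le {X : Type*} [MeasurableSpace X] {μ : Measure X} {P V A : ℝ}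
    (hP : 0 < P) (hV : 0 ≤ V) (hA : 0 ≤ A) {f : X → ℝ}
    (h : ∫⁻ x, ‖f x‖ₑ ^ P ∂μ ≤ ENNReal.ofReal (V * A ^ P)) :
    eLpNorm f (ENNReal.ofReal P) μ ≤ ENNReal.ofReal (V ^ (1 / P) * A) := by
  rw [eLpNorm_eq_lintegral_rpow_enorm_toReal (ENNReal.ofReal_pos.2 hP).ne' ENNReal.ofReal_ne_top,
    ENNReal.toReal_ofReal hP.le]
  refine (ENNReal.rpow_le_rpow h (by positivity)).trans_eq ?_
  rw [ENNReal.ofReal_rpow_of_nonneg (by positivity) (by positivity),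
    Real.mul_rpow hV (by positivity), ← Real.rpow_mul hA, mul_one_div_cancel hP.ne', Real.rpow_one]

section Global

variable {X : Type*} [MeasurableSpace X] {ρ : X → X → ℝ} {μ : Measure X} {s Q p : ℝ}

theorem measure_univ_lt_top_of_diam_lt_top [Nonempty X] (hX : IsQuasiMetricMeasure ρ μ)
    (hd : diam ρ < ∞) : μ univ < ∞ := by
  obtain ⟨x₀⟩ := ‹Nonempty X›
  refine (measure_mono fun y _ => ?_).trans_lt
    (hX.ball_lt_top x₀ ((diam ρ).toReal + 1) (by positivity))
  have h1 : ENNReal.ofReal (ρ x₀ y) ≤ diam ρ :=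
    le_iSup₂ (f := fun x y => ENNReal.ofReal (ρ x y)) x₀ y
  have h2 := (ENNReal.ofReal_le_iff_le_toReal hd.ne).1 h1
  show ρ x₀ y < _
  linarith

theorem diam_pos [Nontrivial X] (hX : IsQuasiMetricMeasure ρ μ) : 0 < diam ρ := by
  obtain ⟨x, y, hxy⟩ := exists_pair_ne X
  exact (ENNReal.ofReal_pos.2 (hX.quasiMetric.pos hxy)).trans_le
    (le_iSup₂ (f := fun x y => ENNReal.ofReal (ρ x y)) x y)

/-- Comparison with the unit ball gives growth of order `R^Q`. It compensates the factor `r₀^(-Q)`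
in the local Sobolev estimate, which therefore stays uniform on large balls. -/
theorem QDoubling.exists_measure_ball_le (hX : IsQuasiMetricMeasure ρ μ) (hD : QDoubling ρ μ Q)
    (x : X) : ∃ K : ℝ, 0 < K ∧ ∀ R : ℝ, 1 ≤ R → μ (ball ρ x R) ≤ ENNReal.ofReal (K * R ^ Q) := by
  obtain ⟨κ, hκ, hD⟩ := hD
  have h1 := hX.ball_pos x 1 one_pos
  have h1' := hX.ball_lt_top x 1 one_pos
  refine ⟨(μ (ball ρ x 1)).toReal / κ, div_pos (ENNReal.toReal_pos h1.ne' h1'.ne) hκ,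
    fun R hR => ?_⟩
  have hR0 : 0 < R := by linarith
  have h2 := hD x x 1 R (fun y hy => lt_of_lt_of_le (show ρ x y < 1 from hy) hR) one_pos hR
  rw [ENNReal.le_div_iff_mul_le (Or.inl (hX.ball_pos x R hR0).ne')
    (Or.inl (hX.ball_lt_top x R hR0).ne)] at h2
  have h3 : 0 < κ * (1 / R) ^ Q := by positivity
  rw [mul_comm, ← ENNReal.le_div_iff_mul_le (Or.inl (ENNReal.ofReal_pos.2 h3).ne')
    (Or.inl ENNReal.ofReal_ne_top)] at h2
  refine h2.trans_eq ?_
  rw [← ENNReal.ofReal_toReal h1'.ne, ← ENNReal.ofReal_div_of_pos h3,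
    ENNReal.toReal_ofReal ENNReal.toReal_nonneg, Real.div_rpow zero_le_one hR0.le, Real.one_rpow]
  congr 1
  field_simp

theorem LowerAhlfors.measure_univ_eq_top [Nonempty X] (hL : LowerAhlfors ρ μ Q) (hQ : 0 < Q)
    (hd : diam ρ = ∞) : μ univ = ∞ := by
  obtain ⟨x₀⟩ := ‹Nonempty X›
  obtain ⟨κ, hκ, hlow⟩ := hL
  refine ENNReal.eq_top_of_forall_nnreal_le fun r => ?_
  have hr : 0 < ((r : ℝ) + 1) / κ := by positivity
  have h1 := hlow x₀ ((((r : ℝ) + 1) / κ) ^ (1 / Q)) (by positivity) (by rw [hd]; exact le_top)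
  rw [← Real.rpow_mul hr.le, one_div_mul_cancel hQ.ne', Real.rpow_one,
    mul_div_cancel₀ _ hκ.ne'] at h1
  refine le_trans ?_ (h1.trans (measure_mono (subset_univ _)))
  rw [← ENNReal.ofReal_coe_nnreal]
  exact ENNReal.ofReal_le_ofReal (by linarith)

/-- Passing through the maximum covers exponents below one as well as above. -/
theorem enorm_sub_rpow_le {P : ℝ} (hP : 0 < P) (t a b : ℝ) :
    ‖a - b‖ₑ ^ P ≤ 2 ^ P * (‖t - a‖ₑ ^ P + ‖t - b‖ₑ ^ P) := by
  have h1 : ‖a - b‖ₑ ≤ 2 * max ‖t - a‖ₑ ‖t - b‖ₑ := by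
    calc ‖a - b‖ₑ = ‖(t - b) - (t - a)‖ₑ := by congr 1; ring
      _ ≤ ‖t - b‖ₑ + ‖t - a‖ₑ := enorm_sub_le
      _ ≤ max ‖t - a‖ₑ ‖t - b‖ₑ + max ‖t - a‖ₑ ‖t - b‖ₑ :=
          add_le_add (le_max_right _ _) (le_max_left _ _)
      _ = _ := (two_mul _).symm
  refine (ENNReal.rpow_le_rpow h1 hP.le).trans ?_
  rw [ENNReal.mul_rpow_of_nonneg _ _ hP.le]
  refine mul_le_mul' le_rfl ?_
  rcases le_total ‖t - a‖ₑ ‖t - b‖ₑ with h | h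
  · rw [max_eq_right h]; exact le_add_self
  · rw [max_eq_left h]; exact le_self_add

/-- Local estimates which are uniform along an exhaustion by sets yield a global estimate. -/
theorem exists_global_const {P : ℝ} (hP : 0 < P) {u : X → ℝ} (hu : AEMeasurable u μ)
    {B : ℕ → Set X} (hB : ∀ n, NullMeasurableSet (B n) μ) (hmono : Monotone B)
    (hunion : ∀ x, ∃ n, x ∈ B n) (hpos : 0 < μ (B 0)) (hfin : μ (B 0) ≠ ∞) {V : ℝ≥0∞} (hV : V ≠ ∞)
    {c : ℕ → ℝ} (hc : ∀ n, ∫⁻ x in B n, ‖u x - c n‖ₑ ^ P ∂μ ≤ V) :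
    ∃ c₀ : ℝ, ∫⁻ x, ‖u x - c₀‖ₑ ^ P ∂μ ≤ V := by
  -- Both `c n` and `c 0` approximate `u` on `B 0`, a set of positive finite measure, so the
  -- constants stay bounded. A subsequence converges, and Fatou's lemma gives the global estimate.
  have hdiff : ∀ n, ‖c n - c 0‖ₑ ^ P ≤ 2 ^ P * (V + V) / μ (B 0) := by
    intro n
    rw [ENNReal.le_div_iff_mul_le (Or.inl hpos.ne') (Or.inl hfin)]
    calc ‖c n - c 0‖ₑ ^ P * μ (B 0) = ∫⁻ _ in B 0, ‖c n - c 0‖ₑ ^ P ∂μ := by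
          rw [setLIntegral_const]
      _ ≤ ∫⁻ x in B 0, 2 ^ P * (‖u x - c n‖ₑ ^ P + ‖u x - c 0‖ₑ ^ P) ∂μ :=
          lintegral_mono fun x => enorm_sub_rpow_le hP _ _ _
      _ = 2 ^ P * (∫⁻ x in B 0, ‖u x - c n‖ₑ ^ P ∂μ + ∫⁻ x in B 0, ‖u x - c 0‖ₑ ^ P ∂μ) := by
          rw [lintegral_const_mul' _ _ (ENNReal.rpow_ne_top_of_nonneg hP.le (by norm_num)),
            lintegral_add_left' ((hu.sub_const _).enorm.pow_const _).restrict]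
      _ ≤ _ := mul_le_mul' le_rfl (add_le_add
          ((lintegral_mono_set (hmono (Nat.zero_le n))).trans (hc n)) (hc 0))
  set W : ℝ≥0∞ := (2 ^ P * (V + V) / μ (B 0)) ^ (1 / P) with hW
  have hWfin : W ≠ ∞ := by
    refine ENNReal.rpow_ne_top_of_nonneg (by positivity) (ENNReal.div_ne_top (ENNReal.mul_ne_top
      (ENNReal.rpow_ne_top_of_nonneg hP.le (by norm_num)) (ENNReal.add_ne_top.2 ⟨hV, hV⟩)) hpos.ne')
  have hball : ∀ n, c n ∈ Metric.closedBall (c 0) W.toReal := by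
    intro n
    have h1 := ENNReal.rpow_le_rpow (hdiff n) (one_div_nonneg.2 hP.le)
    rw [← ENNReal.rpow_mul, mul_one_div_cancel hP.ne', ENNReal.rpow_one] at h1
    have h2 := ENNReal.toReal_mono hWfin h1
    rwa [toReal_enorm] at h2
  obtain ⟨c₀, -, φ, hφ, hlim⟩ := tendsto_subseq_of_bounded Metric.isBounded_closedBall hball
  refine ⟨c₀, ?_⟩
  have hmeas : ∀ n, AEMeasurable ((B (φ n)).indicator fun x => ‖u x - c (φ n)‖ₑ ^ P) μ :=
    fun n => ((hu.sub_const _).enorm.pow_const _).indicator₀ (hB _)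
  have hpt : ∀ x, Filter.liminf (fun n => (B (φ n)).indicator (fun x => ‖u x - c (φ n)‖ₑ ^ P) x)
      Filter.atTop = ‖u x - c₀‖ₑ ^ P := by
    intro x
    refine Filter.Tendsto.liminf_eq ?_
    have h1 : Filter.Tendsto (fun n => ‖u x - c (φ n)‖ₑ ^ P) Filter.atTop
        (nhds (‖u x - c₀‖ₑ ^ P)) :=
      ((tendsto_const_nhds.sub hlim).enorm).ennrpow_const P
    refine h1.congr' ?_
    obtain ⟨n₀, hn₀⟩ := hunion x
    filter_upwards [Filter.eventually_ge_atTop n₀] with n hn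
    rw [indicator_of_mem (hmono (hn.trans (hφ.id_le n)) hn₀)]
  calc ∫⁻ x, ‖u x - c₀‖ₑ ^ P ∂μ = ∫⁻ x, Filter.liminf
        (fun n => (B (φ n)).indicator (fun x => ‖u x - c (φ n)‖ₑ ^ P) x) Filter.atTop ∂μ := by
        simp_rw [hpt]
    _ ≤ _ := lintegral_liminf_le' hmeas
    _ ≤ V := by
        refine Filter.liminf_le_of_frequently_le' (Filter.Frequently.of_forall fun n => ?_)
        rw [lintegral_indicator₀ (hB _)]
        exact hc _

/-- If the diameter is finite, the local estimate at radius `diam ρ` already covers the whole space.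
Otherwise the balls of radius `n + 1` exhaust it, with bounds made uniform by doubling. -/
theorem LowerAhlfors.exists_sobolev_global [Nontrivial X] (hX : IsQuasiMetricMeasure ρ μ)
    (hL : LowerAhlfors ρ μ Q) (hs : 0 < s) (hQ : 0 < Q) (hp : p ∈ Ioo 0 (Q / s))
    (hbd : diam ρ < ∞ ∨ QDoubling ρ μ Q) :
    ∃ K : ℝ, 0 < K ∧ ∀ (u : X → ℝ) (A : ℝ), 0 < A → AEMeasurable u μ → HajlaszBound ρ μ s p A u →
      ∃ c : ℝ, eLpNorm (fun x => u x - c) (ENNReal.ofReal (sobExp s Q p)) μ ≤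
        ENNReal.ofReal (K * A) := by
  have hP := sobExp_pos hs hp
  obtain ⟨K, hK, H⟩ := hL.exists_sobolev_local hX hs hQ hp
  obtain ⟨x₀⟩ := (inferInstance : Nonempty X)
  by_cases hd : diam ρ < ∞
  · have hμ := measure_univ_lt_top_of_diam_lt_top hX hd
    have hr : 0 < (diam ρ).toReal := ENNReal.toReal_pos (diam_pos hX).ne' hd.ne
    set r := (diam ρ).toReal with hrdef
    set V := K * (r ^ (-Q) * (μ univ).toReal + 1) with hV
    have hV0 : 0 < V := by positivity
    refine ⟨V ^ (1 / sobExp s Q p), by positivity, fun u A hA _ hb => ?_⟩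
    obtain ⟨c, hc⟩ := H u A hA hb x₀ r hr ENNReal.ofReal_toReal_le univ nullMeasurableSet_univ
      fun x _ => (ENNReal.ofReal_le_iff_le_toReal hd.ne).1
        (le_iSup₂ (f := fun x y => ENNReal.ofReal (ρ x y)) x₀ x)
    refine ⟨c, eLpNorm_le_of_lintegral_le hP hV0.le hA.le ?_⟩
    rw [setLIntegral_univ] at hc
    refine hc.trans_eq ?_
    rw [← ENNReal.ofReal_toReal hμ.ne, ← ENNReal.ofReal_mul (by positivity), ← ENNReal.ofReal_one,
      ← ENNReal.ofReal_add (by positivity) zero_le_one, ← ENNReal.ofReal_mul (by positivity), hV]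
    congr 1
    ring
  · have hdtop : diam ρ = ∞ := not_lt_top_iff.1 hd
    obtain ⟨K₁, hK₁, hup⟩ := (hbd.resolve_left hd).exists_measure_ball_le hX x₀
    set V := K * (K₁ + 1) with hV
    have hV0 : 0 < V := by positivity
    refine ⟨V ^ (1 / sobExp s Q p), by positivity, fun u A hA hu hb => ?_⟩
    have hR : ∀ n : ℕ, (1:ℝ) ≤ (n : ℝ) + 1 := fun n => by
      have : (0:ℝ) ≤ n := n.cast_nonneg
      linarith
    have hR0 : ∀ n : ℕ, (0:ℝ) < (n : ℝ) + 1 := fun n => by positivity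
    have hloc : ∀ n : ℕ, ∃ c : ℝ, ∫⁻ x in ball ρ x₀ ((n : ℝ) + 1), ‖u x - c‖ₑ ^ sobExp s Q p ∂μ ≤
        ENNReal.ofReal (V * A ^ sobExp s Q p) := by
      intro n
      obtain ⟨c, hc⟩ := H u A hA hb x₀ ((n : ℝ) + 1) (hR0 n) (by rw [hdtop]; exact le_top)
        (ball ρ x₀ ((n : ℝ) + 1)) (hX.ball_measurable _ _ (hR0 n)) fun x hx => le_of_lt hx
      refine ⟨c, hc.trans ((mul_le_mul' le_rfl (add_le_add (mul_le_mul' le_rfl (hup _ (hR n)))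
        le_rfl)).trans_eq ?_)⟩
      have := hR0 n
      rw [← ENNReal.ofReal_mul (by positivity), ← ENNReal.ofReal_one,
        ← ENNReal.ofReal_add (by positivity) zero_le_one, ← ENNReal.ofReal_mul (by positivity),
        Real.rpow_neg (hR0 n).le, hV]
      congr 1
      field_simp
    choose c hc using hloc
    obtain ⟨c₀, hc₀⟩ := exists_global_const hP hu
      (B := fun n : ℕ => ball ρ x₀ ((n : ℝ) + 1)) (fun n => hX.ball_measurable _ _ (hR0 n))
      (fun m n hmn x hx => lt_of_lt_of_le (show ρ x₀ x < (m : ℝ) + 1 from hx) (by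
        have : (m : ℝ) ≤ n := by exact_mod_cast hmn
        linarith))
      (fun x => by
        obtain ⟨n, hn⟩ := exists_nat_gt (ρ x₀ x)
        exact ⟨n, by show ρ x₀ x < _; linarith⟩)
      (hX.ball_pos _ _ (hR0 0)) (hX.ball_lt_top _ _ (hR0 0)).ne ENNReal.ofReal_ne_top hc
    exact ⟨c₀, eLpNorm_le_of_lintegral_le hP hV0.le hA.le hc₀⟩

theorem LowerAhlfors.poincareIneq [Nontrivial X] (hX : IsQuasiMetricMeasure ρ μ)
    (hL : LowerAhlfors ρ μ Q) (hs : 0 < s) (hQ : 0 < Q) (hp : p ∈ Ioo 0 (Q / s))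
    (hbd : diam ρ < ∞ ∨ QDoubling ρ μ Q) {N : (X → ℝ) → ℝ≥0∞}
    (hH : HajlaszDominated ρ μ s p N) : PoincareIneq μ s Q p N := by
  obtain ⟨K, hK, H⟩ := hL.exists_sobolev_global hX hs hQ hp hbd
  refine ⟨K, hK, fun u hu => le_mul_of_forall_lt hK fun A hA hlt => ?_⟩
  obtain ⟨c, hc⟩ := H u A hA hu.1 (hH u A hA hlt)
  rw [← ENNReal.ofReal_mul hK.le]
  exact (iInf_le _ c).trans hc

/-- In a space of infinite measure, `u` and `u - c` can only be integrable to some powers if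
`c = 0`. -/
theorem eq_zero_of_eLpNorm_lt_top (hμ : μ univ = ∞) {u : X → ℝ} (hu : AEMeasurable u μ)
    {p₁ p₂ : ℝ} (hp₁ : 0 < p₁) (hp₂ : 0 < p₂) (h₁ : eLpNorm u (ENNReal.ofReal p₁) μ < ∞) {c : ℝ}
    (h₂ : eLpNorm (fun x => u x - c) (ENNReal.ofReal p₂) μ < ∞) : c = 0 := by
  by_contra hc
  set ε : ℝ≥0 := ‖c‖₊ / 2 with hε
  have hε0 : ε ≠ 0 := by simpa [hε] using hc
  have m₁ : MemLp u (ENNReal.ofReal p₁) μ := ⟨hu.aestronglyMeasurable, h₁⟩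
  have m₂ : MemLp (fun x => u x - c) (ENNReal.ofReal p₂) μ :=
    ⟨(hu.sub_const c).aestronglyMeasurable, h₂⟩
  have f₁ := m₁.meas_ge_lt_top (ENNReal.ofReal_pos.2 hp₁).ne' ENNReal.ofReal_ne_top hε0
  have f₂ := m₂.meas_ge_lt_top (ENNReal.ofReal_pos.2 hp₂).ne' ENNReal.ofReal_ne_top hε0
  have hsub : univ ⊆ {x | ε ≤ ‖u x‖₊} ∪ {x | ε ≤ ‖u x - c‖₊} := by
    intro x _
    by_contra hx
    simp only [mem_union, mem_ofPred_eq, not_or, not_le] at hx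
    have h3 : ‖c‖₊ ≤ ‖u x‖₊ + ‖u x - c‖₊ := by
      calc ‖c‖₊ = ‖u x - (u x - c)‖₊ := by congr 1; ring
        _ ≤ _ := nnnorm_sub_le _ _
    have h4 := h3.trans_lt (add_lt_add hx.1 hx.2)
    rw [hε, add_halves] at h4
    exact lt_irrefl _ h4
  have := (measure_mono hsub).trans_lt ((measure_union_le _ _).trans_lt (ENNReal.add_lt_top.2 ⟨f₁, f₂⟩))
  rw [hμ] at this
  exact lt_irrefl _ this

/-- On spaces of finite measure, the constant in the Sobolev–Poincaré inequality can be absorbed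
by adding a multiple of a weaker norm. -/
theorem exists_eLpNorm_le_add (hμ0 : 0 < μ univ) (hμ : μ univ < ∞) {p₁ p₂ : ℝ} (hp₁ : 0 < p₁)
    (hpp : p₁ ≤ p₂) : ∃ K : ℝ, 0 < K ∧ ∀ (u : X → ℝ) (c : ℝ), AEMeasurable u μ →
      eLpNorm u (ENNReal.ofReal p₂) μ ≤ ENNReal.ofReal K *
        (eLpNorm (fun x => u x - c) (ENNReal.ofReal p₂) μ + eLpNorm u (ENNReal.ofReal p₁) μ) := by
  have hp₂ : 0 < p₂ := hp₁.trans_le hpp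
  -- The exponents may be below one, where the triangle inequality holds only up to a constant.
  set a₁ := ENNReal.LpAddConst (ENNReal.ofReal p₁)
  set a₂ := ENNReal.LpAddConst (ENNReal.ofReal p₂)
  have ha₁ : a₁ ≠ ∞ := (ENNReal.LpAddConst_lt_top _).ne
  have ha₂ : a₂ ≠ ∞ := (ENNReal.LpAddConst_lt_top _).ne
  have hpow : ∀ e : ℝ, μ univ ^ e ≠ ∞ := fun e =>
    ENNReal.rpow_ne_top_of_ne_zero hμ0.ne' hμ.ne
  set m₁ := μ univ ^ (1 / p₁) with hm₁
  set m₂ := μ univ ^ (1 / p₂) with hm₂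
  set m₃ := μ univ ^ (1 / p₁ - 1 / p₂) with hm₃
  have hm₁0 : m₁ ≠ 0 := (ENNReal.rpow_pos hμ0 hμ.ne).ne'
  set T : ℝ≥0∞ := a₂ * (1 + m₂ / m₁ * (a₁ * (m₃ + 1))) with hT
  have hTfin : T ≠ ∞ := by
    refine ENNReal.mul_ne_top ha₂ (ENNReal.add_ne_top.2 ⟨ENNReal.one_ne_top, ENNReal.mul_ne_top
      (ENNReal.div_ne_top (hpow _) hm₁0) (ENNReal.mul_ne_top ha₁
        (ENNReal.add_ne_top.2 ⟨hpow _, ENNReal.one_ne_top⟩))⟩)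
  refine ⟨T.toReal + 1, by positivity, fun u c hu => ?_⟩
  set f : X → ℝ := fun x => u x - c with hf
  have hfm : AEStronglyMeasurable f μ := (hu.sub_const c).aestronglyMeasurable
  have hcm : AEStronglyMeasurable (fun _ : X => c) μ := aestronglyMeasurable_const
  have hcn : ∀ P : ℝ, 0 < P → eLpNorm (fun _ : X => c) (ENNReal.ofReal P) μ =
      ‖c‖ₑ * μ univ ^ (1 / P) := fun P hP => by
    rw [eLpNorm_const' _ (ENNReal.ofReal_pos.2 hP).ne' ENNReal.ofReal_ne_top,
      ENNReal.toReal_ofReal hP.le]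
  set x₂ := eLpNorm f (ENNReal.ofReal p₂) μ with hx₂
  set y₁ := eLpNorm u (ENNReal.ofReal p₁) μ with hy₁
  have h1 : eLpNorm u (ENNReal.ofReal p₂) μ ≤ a₂ * (x₂ + ‖c‖ₑ * m₂) := by
    have := eLpNorm_add_le' hfm hcm (ENNReal.ofReal p₂)
    rw [hcn p₂ hp₂] at this
    refine le_trans (le_of_eq ?_) this
    congr 1
    ext x
    simp [hf]
  have h2 : ‖c‖ₑ * m₁ ≤ a₁ * (y₁ + x₂ * m₃) := by
    have h3 := eLpNorm_add_le' hu.aestronglyMeasurable hfm.neg (ENNReal.ofReal p₁)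
    have h4 : u + -f = fun _ => c := by
      ext x
      simp [hf]
    rw [h4, hcn p₁ hp₁, eLpNorm_neg] at h3
    refine h3.trans (mul_le_mul' le_rfl (add_le_add le_rfl ?_))
    have h5 := eLpNorm_le_eLpNorm_mul_rpow_measure_univ (μ := μ) (ENNReal.ofReal_le_ofReal hpp) hfm
    rwa [ENNReal.toReal_ofReal hp₁.le, ENNReal.toReal_ofReal hp₂.le] at h5
  -- Writing `c = u - (u - c)` in `L^{p₁}` bounds `|c|` by the two norms on the right, as the norm
  -- of a constant is explicit on a space of finite measure.
  have h3 : ‖c‖ₑ ≤ a₁ * (y₁ + x₂ * m₃) / m₁ := by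
    rwa [ENNReal.le_div_iff_mul_le (Or.inl hm₁0) (Or.inl (hpow _))]
  have hTle : T ≤ ENNReal.ofReal (T.toReal + 1) := by
    conv_lhs => rw [← ENNReal.ofReal_toReal hTfin]
    exact ENNReal.ofReal_le_ofReal (by linarith)
  refine le_trans ?_ (mul_le_mul' hTle le_rfl)
  refine h1.trans ?_
  rw [hT, mul_assoc]
  refine mul_le_mul' le_rfl ?_
  rw [add_mul, one_mul]
  refine add_le_add le_self_add ((mul_le_mul' h3 le_rfl).trans ?_)
  calc a₁ * (y₁ + x₂ * m₃) / m₁ * m₂ = m₂ / m₁ * (a₁ * (y₁ + x₂ * m₃)) := by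
        simp only [div_eq_mul_inv]; ring
    _ ≤ m₂ / m₁ * (a₁ * ((m₃ + 1) * (x₂ + y₁))) := by
        refine mul_le_mul' le_rfl (mul_le_mul' le_rfl ?_)
        calc y₁ + x₂ * m₃ ≤ y₁ + x₂ * m₃ + (x₂ + m₃ * y₁) := le_self_add
          _ = _ := by ring
    _ = _ := by ring

/-- The constant in the global estimate is absorbed by the `L^p` term when the diameter is finite.
When it is infinite, the measure is infinite and `u ∈ L^p` forces the constant to be zero. -/
theorem LowerAhlfors.sobolevIneq [Nontrivial X] (hX : IsQuasiMetricMeasure ρ μ)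
    (hL : LowerAhlfors ρ μ Q) (hs : 0 < s) (hQ : 0 < Q) (hp : p ∈ Ioo 0 (Q / s))
    (hbd : diam ρ < ∞ ∨ QDoubling ρ μ Q) {N : (X → ℝ) → ℝ≥0∞}
    (hH : HajlaszDominated ρ μ s p N) : SobolevIneq ρ μ s Q p N := by
  have hP := sobExp_pos hs hp
  obtain ⟨K, hK, H⟩ := hL.exists_sobolev_global hX hs hQ hp hbd
  obtain ⟨x₀⟩ := (inferInstance : Nonempty X)
  by_cases hd : diam ρ < ∞
  · have hμ0 : 0 < μ univ := (hX.ball_pos x₀ 1 one_pos).trans_le (measure_mono (subset_univ _))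
    have hpP : p ≤ sobExp s Q p := by
      have h1 := one_div_sobExp hs hp
      have h2 : 1 / sobExp s Q p ≤ 1 / p := by
        by_contra! h
        nlinarith [mul_lt_mul_of_pos_left h hQ]
      exact (one_div_le_one_div hP hp.1).1 h2
    obtain ⟨K₁, hK₁, H₁⟩ :=
      exists_eLpNorm_le_add hμ0 (measure_univ_lt_top_of_diam_lt_top hX hd) hp.1 hpP
    have hd0 := (diam_pos hX).ne'
    have hds0 : diam ρ ^ s ≠ 0 := (ENNReal.rpow_pos (diam_pos hX) hd.ne).ne'
    have hds : diam ρ ^ s ≠ ∞ := ENNReal.rpow_ne_top_of_nonneg hs.le hd.ne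
    have hdpos : 0 < (diam ρ ^ s).toReal := ENNReal.toReal_pos hds0 hds
    refine ⟨max (K₁ * K) (K₁ * (diam ρ ^ s).toReal), lt_max_of_lt_left (by positivity),
      fun u hu _ => ?_⟩
    set y := eLpNorm u (ENNReal.ofReal p) μ
    have hmain : eLpNorm u (ENNReal.ofReal (sobExp s Q p)) μ ≤
        ENNReal.ofReal (K₁ * K) * N u + ENNReal.ofReal K₁ * y := by
      -- The `L^p` term is moved to the left so that the limit over `A` involves the semi-norm
      -- alone.
      have h0 : eLpNorm u (ENNReal.ofReal (sobExp s Q p)) μ - ENNReal.ofReal K₁ * y ≤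
          ENNReal.ofReal (K₁ * K) * N u := by
        refine le_mul_of_forall_lt (by positivity) fun A hA hlt => ?_
        obtain ⟨c, hc⟩ := H u A hA hu.1 (hH u A hA hlt)
        rw [tsub_le_iff_right]
        refine (H₁ u c hu.1).trans ?_
        rw [mul_add]
        refine add_le_add ((mul_le_mul' le_rfl hc).trans_eq ?_) le_rfl
        rw [← ENNReal.ofReal_mul hK₁.le, ← ENNReal.ofReal_mul (by positivity), mul_assoc]
      exact tsub_le_iff_right.1 h0
    refine hmain.trans (add_le_add (mul_le_mul' (ENNReal.ofReal_le_ofReal (le_max_left _ _)) le_rfl)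
      (mul_le_mul' ?_ le_rfl))
    rw [ENNReal.le_div_iff_mul_le (Or.inl hds0) (Or.inl hds)]
    conv_lhs => rw [← ENNReal.ofReal_toReal hds, ← ENNReal.ofReal_mul hK₁.le]
    exact ENNReal.ofReal_le_ofReal (le_max_right _ _)
  · have hdtop : diam ρ = ∞ := not_lt_top_iff.1 hd
    refine ⟨K, hK, fun u hu hup => le_add_right (le_mul_of_forall_lt hK fun A hA hlt => ?_)⟩
    obtain ⟨c, hc⟩ := H u A hA hu.1 (hH u A hA hlt)
    have hc0 : c = 0 := eq_zero_of_eLpNorm_lt_top (hL.measure_univ_eq_top hQ hdtop) hu.1 hp.1 hP hup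
      (hc.trans_lt ENNReal.ofReal_lt_top)
    subst hc0
    simp only [sub_zero] at hc
    rw [← ENNReal.ofReal_mul hK.le]
    exact hc

end Global

end HajlaszEmbedding

/-! ### Assembly of the equivalences -/

open HajlaszEmbedding in
theorem theorem1p3 {X : Type*} [Nontrivial X] [MeasurableSpace X]
    (ρ : X → X → ℝ) (μ : Measure X) (hX : IsQuasiMetricMeasure ρ μ)
    (s Q : ℝ) (q : ℝ≥0∞) (hs : 0 < s) (hQ : 0 < Q) (hq : 0 < q)
    (hind : PrecInd ρ s q) (hbd : diam ρ < ∞ ∨ QDoubling ρ μ Q) :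
    -- Triebel–Lizorkin spaces
    (List.TFAE [
        LowerAhlfors ρ μ Q,
        ∃ p ∈ Ioo 0 (Q / s), SobolevIneq ρ μ s Q p (tlNorm ρ μ s q p),
        ∀ p ∈ Ioo 0 (Q / s), SobolevIneq ρ μ s Q p (tlNorm ρ μ s q p)]
      ∧ (UniformlyPerfect ρ → List.TFAE [
        LowerAhlfors ρ μ Q,
        ∃ p ∈ Ioo 0 (Q / s), SobolevIneq ρ μ s Q p (tlNorm ρ μ s q p),
        ∃ p ∈ Ioo 0 (Q / s), PoincareIneq μ s Q p (tlNorm ρ μ s q p),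
        ∀ p ∈ Ioo 0 (Q / s), PoincareIneq μ s Q p (tlNorm ρ μ s q p),
        ExpIntegrability ρ μ (tlNorm ρ μ s q (Q / s)),
        ∃ p ∈ Ioi (Q / s), HolderCond ρ μ s Q p (tlNorm ρ μ s q p),
        ∀ p ∈ Ioi (Q / s), HolderCond ρ μ s Q p (tlNorm ρ μ s q p)]))
    -- Besov spaces, for exponents `p` with `q ≤ p`
    ∧ (q < ENNReal.ofReal (Q / s) → List.TFAE [
        LowerAhlfors ρ μ Q,
        ∃ p ∈ Ioo 0 (Q / s), q ≤ ENNReal.ofReal p ∧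
          SobolevIneq ρ μ s Q p (besovNorm ρ μ s q p),
        ∀ p ∈ Ioo 0 (Q / s), q ≤ ENNReal.ofReal p →
          SobolevIneq ρ μ s Q p (besovNorm ρ μ s q p)])
    ∧ (UniformlyPerfect ρ →
        (q < ENNReal.ofReal (Q / s) → List.TFAE [
          LowerAhlfors ρ μ Q,
          ∃ p ∈ Ioo 0 (Q / s), q ≤ ENNReal.ofReal p ∧
            PoincareIneq μ s Q p (besovNorm ρ μ s q p),
          ∀ p ∈ Ioo 0 (Q / s), q ≤ ENNReal.ofReal p →
            PoincareIneq μ s Q p (besovNorm ρ μ s q p)])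
        ∧ (q ≤ ENNReal.ofReal (Q / s) →
          (LowerAhlfors ρ μ Q ↔ ExpIntegrability ρ μ (besovNorm ρ μ s q (Q / s))))
        ∧ (q < ∞ → List.TFAE [
          LowerAhlfors ρ μ Q,
          ∃ p ∈ Ioi (Q / s), q ≤ ENNReal.ofReal p ∧
            HolderCond ρ μ s Q p (besovNorm ρ μ s q p),
          ∀ p ∈ Ioi (Q / s), q ≤ ENNReal.ofReal p →
            HolderCond ρ μ s Q p (besovNorm ρ μ s q p)])) := by
  have hρ := hX.quasiMetric
  obtain ⟨β, K, F, hsβ, hqβ, hF⟩ := hind.exists_regularization hρ hs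
  have hβ : 0 < β := hs.trans_le hsβ
  have hQs : 0 < Q / s := div_pos hQ hs
  have hIoi : ∀ {p : ℝ}, p ∈ Ioi (Q / s) → 0 < p := fun hp => hQs.trans hp
  have hmid : Q / s / 2 ∈ Ioo 0 (Q / s) := ⟨by positivity, half_lt_self hQs⟩
  have tlH := fun {p : ℝ} (hp : 0 < p) => hajlaszDominated_tlNorm hρ μ s hq hp
  have tlB := fun {p : ℝ} (hp : 0 < p) => bumpBound_tlNorm ρ μ hs hsβ hq hqβ hp
  have beH := fun {p : ℝ} (hp : 0 < p) (hqp : q ≤ ENNReal.ofReal p) =>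
    hajlaszDominated_besovNorm hρ μ s hq hp hqp
  have beB := fun {p : ℝ} (hp : 0 < p) => bumpBound_besovNorm ρ μ hs hsβ hq hqβ hp
  -- The Besov statements for every `p ≥ q` would be void without such an exponent.
  have hexp : q < ENNReal.ofReal (Q / s) → ∃ p ∈ Ioo 0 (Q / s), q ≤ ENNReal.ofReal p := by
    intro h
    obtain ⟨t, ht1, ht2⟩ := exists_between h
    have htop : t ≠ ∞ := (ht2.trans ENNReal.ofReal_lt_top).ne
    refine ⟨t.toReal, ⟨ENNReal.toReal_pos (hq.trans ht1).ne' htop,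
      (ENNReal.lt_ofReal_iff_toReal_lt htop).1 ht2⟩, ?_⟩
    rw [ENNReal.ofReal_toReal htop]
    exact ht1.le
  refine ⟨⟨?_, fun hU => ?_⟩, fun hqQ => ?_, fun hU => ⟨fun hqQ => ?_, fun hqQ => ?_, fun hqt => ?_⟩⟩
  · tfae_have 1 → 3 := fun h p hp => h.sobolevIneq hX hs hQ hp hbd (tlH hp.1)
    tfae_have 3 → 2 := fun h => ⟨_, hmid, h _ hmid⟩
    tfae_have 2 → 1 := fun ⟨p, hp, h⟩ => h.lowerAhlfors hX hs hQ hp hβ hF (tlB hp.1)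
    tfae_finish
  · tfae_have 1 → 2 := fun h => ⟨_, hmid, h.sobolevIneq hX hs hQ hmid hbd (tlH hmid.1)⟩
    tfae_have 2 → 1 := fun ⟨p, hp, h⟩ => h.lowerAhlfors hX hs hQ hp hβ hF (tlB hp.1)
    tfae_have 1 → 4 := fun h p hp => h.poincareIneq hX hs hQ hp hbd (tlH hp.1)
    tfae_have 4 → 3 := fun h => ⟨_, hmid, h _ hmid⟩
    tfae_have 3 → 1 := fun ⟨p, hp, h⟩ => h.lowerAhlfors hX hs hQ hp hβ hF (tlB hp.1) hU
    tfae_have 1 → 5 := fun h => h.expIntegrability hX hs hQ (tlH hQs)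
    tfae_have 5 → 1 := fun h => h.lowerAhlfors hX hs hQ hβ hF (tlB hQs) (tlH hQs) hU
    tfae_have 1 → 7 := fun h p hp => h.holderCond hX hs hQ hp (tlH (hIoi hp))
    tfae_have 7 → 6 := fun h => ⟨Q / s + 1, mem_Ioi.2 (lt_add_one _), h _ (mem_Ioi.2 (lt_add_one _))⟩
    tfae_have 6 → 1 := fun ⟨p, hp, h⟩ => h.lowerAhlfors hX hs hQ hp hβ hF (tlB (hIoi hp)) hU
    tfae_finish
  · tfae_have 1 → 3 := fun h p hp hqp => h.sobolevIneq hX hs hQ hp hbd (beH hp.1 hqp)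
    tfae_have 3 → 2 := fun h => by
      obtain ⟨p, hp, hqp⟩ := hexp hqQ
      exact ⟨p, hp, hqp, h p hp hqp⟩
    tfae_have 2 → 1 := fun ⟨p, hp, _, h⟩ => h.lowerAhlfors hX hs hQ hp hβ hF (beB hp.1)
    tfae_finish
  · tfae_have 1 → 3 := fun h p hp hqp => h.poincareIneq hX hs hQ hp hbd (beH hp.1 hqp)
    tfae_have 3 → 2 := fun h => by
      obtain ⟨p, hp, hqp⟩ := hexp hqQ
      exact ⟨p, hp, hqp, h p hp hqp⟩
    tfae_have 2 → 1 := fun ⟨p, hp, _, h⟩ => h.lowerAhlfors hX hs hQ hp hβ hF (beB hp.1) hU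
    tfae_finish
  · exact ⟨fun h => h.expIntegrability hX hs hQ (beH hQs hqQ),
      fun h => h.lowerAhlfors hX hs hQ hβ hF (beB hQs) (beH hQs hqQ) hU⟩
  · tfae_have 1 → 3 := fun h p hp hqp => h.holderCond hX hs hQ hp (beH (hIoi hp) hqp)
    tfae_have 3 → 2 := fun h => by
      -- The exponent must exceed `Q / s` and be at least `q`; the latter is possible because `q <
      -- ∞`.
      have hp : max (Q / s + 1) q.toReal ∈ Ioi (Q / s) :=
        mem_Ioi.2 (lt_max_of_lt_left (lt_add_one _))
      have hqp : q ≤ ENNReal.ofReal (max (Q / s + 1) q.toReal) := by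
        conv_lhs => rw [← ENNReal.ofReal_toReal hqt.ne]
        exact ENNReal.ofReal_le_ofReal (le_max_right _ _)
      exact ⟨_, hp, hqp, h _ hp hqp⟩
    tfae_have 2 → 1 := fun ⟨p, hp, _, h⟩ => h.lowerAhlfors hX hs hQ hp hβ hF (beB (hIoi hp)) hU
    tfae_finish
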